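/- Let $K$ be an algebraically closed field of characteristic $p>2$. Let $\mathfrak g=\mathfrak{osp}(1|2)$ be the restricted Lie superalgebra of matrices $\begin{bmatrix}0&v&u\\u&a&b\\-v&c&-a\end{bmatrix}$ over $K$, with even part $u=v=0$, odd part $a=b=c=0$, and $p$-map $x\mapsto x^{[p]}$ on the even part given by the $p$-th power of matrices. Let $e,f,h$ and $E,F$ be the basis vectors belonging to the coordinates $b,c,a$ and $u,v$, so that $e^{[p]}=f^{[p]}=0$ and $h^{[p]}=h$. Let $U_0(\mathfrak g)=U(\mathfrak g)/(x^p-x^{[p]} : x\in\mathfrak g_{\bar 0})$ be the restricted enveloping superalgebra. Modules and submodules are $\mathbb Z_2$-graded, and isomorphisms may be even or odd. For $\lambda\in\{0,1,\dots,p-1\}$ let $L(\lambda)$ be the $U_0(\mathfrak g)$-module with basis $v_0,\dots,v_{2\lambda}$, where $v_i$ has the parity of $i$ and, with $v_i=0$ for $i<0$ or $i>2\lambda$, $$h v_i=(\lambda-i)v_i,\qquad f v_i=-v_{i+2},\qquad F v_i=v_{i+1},$$ $$e v_i=-\tfrac i2\left(\lambda+1-\tfrac i2\right)v_{i-2},\qquad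 E v_i=-\tfrac i2 v_{i-1}\qquad (i\text{ even}),$$ $$e v_i=-\tfrac{i-1}2\left(\lambda-\tfrac{i-1}2\right)v_{i-2},\qquad E v_i=\left(\lambda-\tfrac{i-1}2\right)v_{i-1}\qquad (i\text{ odd}).$$ Let $Z(\lambda)=U_0(\mathfrak g)\otimes_{U_0(\mathfrak b)}K_\lambda$ be the baby Verma module, where $\mathfrak b=Ke+Kh+KE$ and $K_\lambda$ is the one-dimensional $\mathfrak b$-module on which $e$ and $E$ act by $0$ and $h$ acts by $\lambda$. Then: (i) The algebra $U_0(\mathfrak g)$ has exactly $p$ isomorphism classes of irreducible modules, represented by $L(\lambda)$ for $\lambda=0,\dots,p-1$. Moreover $\dim L(\lambda)=2\lambda+1$. (ii) For each $\lambda$, $Z(\lambda)$ has a composition series of length two with submodule $L(p-\lambda-1)$ and quotient $L(\lambda)$. Thus it has the two composition factors $L(\lambda)$ and $L(p-\lambda-1)$. (iii) For each $\lambda$, the projective cover $P(\lambda)$ of $L(\lambda)$ exists, and it has a baby Verma filtration of length two with submodule $Z(p-\lambda-1)$ and quotient $Z(\lambda)$. -/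

import Mathlib

universe u

noncomputable section

namespace OspSuper

/-! ### Jacobson's formula: `p`-th powers of sums, modulo a Lie subalgebra -/

open Polynomial in
theorem derivative_pow_sum {R : Type*} [Ring R] (q : R[X]) (n : ℕ) :
    derivative (q ^ n) = ∑ j ∈ Finset.range n, q ^ j * derivative q * q ^ (n - 1 - j) := by
  induction n with
  | zero => simp
  | succ n ih =>
    rw [pow_succ, derivative_mul, ih, Finset.sum_range_succ, Finset.sum_mul]
    congr 1
    · refine Finset.sum_congr rfl fun j hj => ?_
      have : n + 1 - 1 - j = (n - 1 - j) + 1 := by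
        have := Finset.mem_range.1 hj; omega
      rw [this, pow_succ]; simp only [mul_assoc]
    · simp

theorem choose_pred_cast {R : Type*} [Ring R] {p : ℕ} (hp : p.Prime) (h0 : (p : R) = 0) (m : ℕ)
    (hm : m < p) : (((p - 1).choose m : ℕ) : R) = (-1) ^ m := by
  induction m with
  | zero => simp
  | succ m ih =>
    have h1 : (p.choose (m + 1) : R) = 0 := by
      obtain ⟨c, hc⟩ := hp.dvd_choose_self (Nat.succ_ne_zero m) hm
      rw [hc]; simp [h0]
    have h2 := Nat.choose_succ_succ (p - 1) m
    rw [Nat.succ_eq_add_one, Nat.sub_add_cancel hp.one_le] at h2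
    rw [h2] at h1
    push_cast at h1
    rw [ih (by omega)] at h1
    rw [pow_succ, mul_neg, mul_one]
    exact (neg_eq_of_add_eq_zero_right h1).symm

theorem sum_eq_ad_iterate {R : Type*} [Ring R] {p : ℕ} (hp : p.Prime) (hodd : Odd p)
    (h0 : (p : R) = 0) (z x : R) :
    ∑ j ∈ Finset.range p, z ^ j * x * z ^ (p - 1 - j) = (fun q => z * q - q * z)^[p - 1] x := by
  have hc : Commute (LinearMap.mulLeft ℤ z) (-(LinearMap.mulRight ℤ z)) :=
    (LinearMap.commute_mulLeft_right (R := ℤ) z z).neg_right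
  have h := congrArg (fun φ : Module.End ℤ R => φ x) (hc.add_pow (p - 1))
  have e1 : (fun q => z * q - q * z) =
      ⇑(LinearMap.mulLeft ℤ z + -(LinearMap.mulRight ℤ z)) := by
    ext q; simp [sub_eq_add_neg]
  rw [e1, ← Module.End.pow_apply]
  refine Eq.trans ?_ h.symm
  rw [Nat.sub_add_cancel hp.one_le]
  simp only [LinearMap.sum_apply]
  refine Finset.sum_congr rfl fun j hj => ?_
  have hj := Finset.mem_range.1 hj
  rw [neg_pow, LinearMap.pow_mulLeft, LinearMap.pow_mulRight]
  have h3 : (-1 : Module.End ℤ R) ^ (p - 1 - j) = ((-1) ^ (p - 1 - j) : ℤ) • 1 := by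
    rcases Nat.even_or_odd (p - 1 - j) with h | h <;> simp [h.neg_one_pow]
  have h4 : ((p - 1).choose j : Module.End ℤ R) = ((p - 1).choose j : ℤ) • 1 := by
    simp
  have h5 : (((-1) ^ (p - 1 - j) * ((p - 1).choose j : ℤ) : ℤ) : R) = 1 := by
    push_cast
    rw [choose_pred_cast hp h0 j hj, ← pow_add, Nat.sub_add_cancel (by omega)]
    exact (hodd.tsub_odd odd_one).neg_one_pow
  rw [h3, h4]
  simp only [Module.End.mul_apply, LinearMap.smul_apply, Module.End.one_apply,
    LinearMap.mulLeft_apply, LinearMap.mulRight_apply, map_zsmul, smul_smul]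
  rw [← zsmul_one] at h5
  have : ∀ (n : ℤ) (r : R), n • r = (n : R) * r := fun n r => by simp
  rw [this]
  rw [zsmul_one, mul_comm] at h5
  rw [h5, one_mul, mul_assoc]

open Polynomial in
theorem add_pow_sub_mem {K : Type*} [Field K] {p : ℕ} [CharP K p] (hp : p.Prime) (hodd : Odd p)
    {B : Type*} [Ring B] [Algebra K B] (S : Submodule K B)
    (hS : ∀ x ∈ S, ∀ y ∈ S, x * y - y * x ∈ S) {x y : B} (hx : x ∈ S) (hy : y ∈ S) :
    (x + y) ^ p - x ^ p - y ^ p ∈ S := by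
  set z : B[X] := C x * X + C y with hz
  have h0 : (p : B[X]) = 0 := by
    have : (p : B) = 0 := by
      rw [← map_natCast (algebraMap K B), CharP.cast_eq_zero, map_zero]
    rw [← map_natCast (C : B →+* B[X]), this, map_zero]
  have hz' : derivative z = C x := by simp [hz]
  have hd : derivative (z ^ p) = (fun q => z * q - q * z)^[p - 1] (C x) := by
    rw [derivative_pow_sum, hz', sum_eq_ad_iterate hp hodd h0]
  have hmem : ∀ k n, (((fun q => z * q - q * z)^[k] (C x)).coeff n) ∈ S := by
    intro k
    induction k with
    | zero =>
      intro n
      simp only [Function.iterate_zero, id, coeff_C]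
      split_ifs
      exacts [hx, S.zero_mem]
    | succ k ih =>
      intro n
      rw [Function.iterate_succ_apply']
      generalize ((fun q => z * q - q * z)^[k] (C x)) = q at ih
      have e : z * q - q * z = (C x * q - q * C x) * X + (C y * q - q * C y) := by
        rw [hz, add_mul, mul_add, mul_assoc, X_mul, sub_mul, mul_assoc, mul_assoc]
        abel
      rw [e, coeff_add]
      refine S.add_mem ?_ ?_
      · cases n with
        | zero => simp
        | succ n =>
          rw [coeff_mul_X, coeff_sub, coeff_C_mul, coeff_mul_C]
          exact hS _ hx _ (ih n)
      · rw [coeff_sub, coeff_C_mul, coeff_mul_C]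
        exact hS _ hy _ (ih n)
  have hc : ∀ k, k + 1 < p → (z ^ p).coeff (k + 1) ∈ S := by
    intro k hk
    have h1 := hmem (p - 1) k
    rw [← hd, coeff_derivative] at h1
    have h2 : ((k + 1 : ℕ) : K) ≠ 0 := by
      rw [Ne, CharP.cast_eq_zero_iff K p]
      exact fun h => absurd (Nat.le_of_dvd (Nat.succ_pos k) h) (by omega)
    have h3 := S.smul_mem ((k + 1 : ℕ) : K)⁻¹ h1
    have h4 : (z ^ p).coeff (k + 1) * ((k : B) + 1) = ((k + 1 : ℕ) : K) • (z ^ p).coeff (k + 1) := by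
      rw [Algebra.smul_def, map_natCast, ← Nat.cast_succ, Nat.cast_comm]
    rwa [h4, smul_smul, inv_mul_cancel₀ h2, one_smul] at h3
  have hdeg : z.natDegree ≤ 1 := natDegree_linear_le
  have hz1 : z.coeff 1 = x := by simp [hz]
  have hz0 : z.coeff 0 = y := by simp [hz]
  have hp1 : (z ^ p).coeff p = x ^ p := by
    have := coeff_pow_of_natDegree_le (m := p) hdeg
    rwa [mul_one, hz1] at this
  have hp0 : (z ^ p).coeff 0 = y ^ p := by
    have := map_pow (constantCoeff : B[X] →+* B) z p
    simpa [hz0] using this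
  let ev : B[X] →+* B := eval₂RingHom' (RingHom.id B) 1 (fun a => Commute.one_right a)
  have hev : ev (z ^ p) = (x + y) ^ p := by
    rw [map_pow]; congr 1
    simp [ev, hz]
  have hsum : (x + y) ^ p = ∑ i ∈ Finset.range (p + 1), (z ^ p).coeff i := by
    rw [← hev]
    have hd2 : (z ^ p).natDegree < p + 1 := by
      have := natDegree_pow_le_of_le p hdeg
      omega
    change eval₂ (RingHom.id B) 1 (z ^ p) = _
    rw [eval₂_eq_sum_range' _ hd2]
    simp
  have hpp : p = (p - 1) + 1 := (Nat.sub_add_cancel hp.one_le).symm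
  rw [hsum, Finset.sum_range_succ, hp1]
  have : ∑ i ∈ Finset.range p, (z ^ p).coeff i =
      ∑ i ∈ Finset.range (p - 1), (z ^ p).coeff (i + 1) + y ^ p := by
    conv_lhs => rw [hpp, Finset.sum_range_succ']
    rw [← hpp, hp0]
  rw [this]
  have e : ∀ s : B, s + y ^ p + x ^ p - x ^ p - y ^ p = s := fun s => by abel
  rw [e]
  refine S.sum_mem fun i hi => hc i ?_
  have := Finset.mem_range.1 hi
  omega

/-! ### The Lie superalgebra `osp(1|2)` -/

/-- `osp(1|2)`: the matrices `[[0, v, u], [u, a, b], [-v, c, -a]]`. -/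
def osp (K : Type u) [Field K] : Submodule K (Matrix (Fin 3) (Fin 3) K) where
  carrier := {A | A 0 0 = 0 ∧ A 1 0 = A 0 2 ∧ A 2 0 = -A 0 1 ∧ A 2 2 = -A 1 1}
  add_mem' := by
    rintro A B ⟨a1, a2, a3, a4⟩ ⟨b1, b2, b3, b4⟩
    refine ⟨?_, ?_, ?_, ?_⟩ <;>
      simp only [Matrix.add_apply, a1, a2, a3, a4, b1, b2, b3, b4] <;> ring
  zero_mem' := by simp
  smul_mem' := by
    rintro c A ⟨a1, a2, a3, a4⟩
    simp [a1, a2, a3, a4]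

/-- The parity of the three basis vectors of the natural module, of superdimension `1|2`. -/
def idxParity : Fin 3 → ZMod 2 := ![0, 1, 1]

/-- The homogeneous component of `osp(1|2)` of parity `i`. -/
def ospPart (K : Type u) [Field K] (i : ZMod 2) : Submodule K (Matrix (Fin 3) (Fin 3) K) where
  carrier := {A | A ∈ osp K ∧ ∀ r s, idxParity r + idxParity s ≠ i → A r s = 0}
  add_mem' := by
    rintro A B ⟨a1, a2⟩ ⟨b1, b2⟩
    refine ⟨(osp K).add_mem a1 b1, fun r s h => ?_⟩
    simp [a2 r s h, b2 r s h]
  zero_mem' := ⟨(osp K).zero_mem, by simp⟩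
  smul_mem' := by
    rintro c A ⟨a1, a2⟩
    refine ⟨(osp K).smul_mem c a1, fun r s h => ?_⟩
    simp [a2 r s h]

theorem mem_osp {K : Type u} [Field K] {A : Matrix (Fin 3) (Fin 3) K} :
    A ∈ osp K ↔ A 0 0 = 0 ∧ A 1 0 = A 0 2 ∧ A 2 0 = -A 0 1 ∧ A 2 2 = -A 1 1 := Iff.rfl

theorem mem_even {K : Type u} [Field K] {A : Matrix (Fin 3) (Fin 3) K} :
    A ∈ ospPart K 0 ↔ A 0 0 = 0 ∧ A 0 1 = 0 ∧ A 0 2 = 0 ∧ A 1 0 = 0 ∧ A 2 0 = 0 ∧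
      A 2 2 = -A 1 1 := by
  constructor
  · rintro ⟨⟨h1, -, -, h4⟩, h⟩
    exact ⟨h1, h 0 1 (by decide), h 0 2 (by decide), h 1 0 (by decide), h 2 0 (by decide), h4⟩
  · rintro ⟨h1, h2, h3, h4, h5, h6⟩
    refine ⟨⟨h1, by rw [h4, h3], by rw [h5, h2, neg_zero], h6⟩, fun r s => ?_⟩
    have : (1 : ZMod 2) + 1 = 0 := by decide
    fin_cases r <;> fin_cases s <;> simp_all [idxParity]

theorem mem_odd {K : Type u} [Field K] {A : Matrix (Fin 3) (Fin 3) K} :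
    A ∈ ospPart K 1 ↔ A 0 0 = 0 ∧ A 1 0 = A 0 2 ∧ A 2 0 = -A 0 1 ∧ A 1 1 = 0 ∧ A 1 2 = 0 ∧
      A 2 1 = 0 ∧ A 2 2 = 0 := by
  constructor
  · rintro ⟨⟨h1, h2, h3, -⟩, h⟩
    exact ⟨h1, h2, h3, h 1 1 (by decide), h 1 2 (by decide), h 2 1 (by decide), h 2 2 (by decide)⟩
  · rintro ⟨h1, h2, h3, h4, h5, h6, h7⟩
    refine ⟨⟨h1, h2, h3, by rw [h7, h4, neg_zero]⟩, fun r s => ?_⟩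
    have : (1 : ZMod 2) + 1 = 0 := by decide
    fin_cases r <;> fin_cases s <;> simp_all [idxParity]

theorem zmod_two_cases (i : ZMod 2) : i = 0 ∨ i = 1 := by revert i; decide

theorem superbracket_mem {K : Type u} [Field K] {i j : ZMod 2} {A B : Matrix (Fin 3) (Fin 3) K}
    (hA : A ∈ ospPart K i) (hB : B ∈ ospPart K j) :
    A * B - (-1 : K) ^ (i.val * j.val) • (B * A) ∈ osp K := by
  rw [mem_osp]
  rcases zmod_two_cases i with rfl | rfl <;> rcases zmod_two_cases j with rfl | rfl <;>
    simp only [mem_even, mem_odd] at hA hB <;>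
    simp [Matrix.mul_apply, Fin.sum_univ_three, hA, hB, ZMod.val_one] <;>
    ring_nf <;> simp

/-- The superbracket `[x, y] = x y - (-1)^(|x||y|) y x` of homogeneous elements. -/
def superbracket {K : Type u} [Field K] {i j : ZMod 2} (x : ospPart K i) (y : ospPart K j) :
    osp K :=
  ⟨x.1 * y.1 - (-1 : K) ^ (i.val * j.val) • (y.1 * x.1), superbracket_mem x.2 y.2⟩

/-- A homogeneous element, seen in `osp(1|2)`. -/
def toOsp {K : Type u} [Field K] {i : ZMod 2} (x : ospPart K i) : osp K := ⟨x.1, x.2.1⟩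

theorem even_pow {K : Type u} [Field K] {A : Matrix (Fin 3) (Fin 3) K} (hA : A ∈ ospPart K 0)
    (k : ℕ) : A ^ (2 * k + 1) = (A 1 1 ^ 2 + A 1 2 * A 2 1) ^ k • A := by
  induction k with
  | zero => simp
  | succ k ih =>
    rw [show 2 * (k + 1) + 1 = (2 * k + 1) + 2 by ring, pow_add, ih,
      pow_succ (A 1 1 ^ 2 + A 1 2 * A 2 1) k, mul_smul, smul_mul_assoc]
    congr 1
    rw [mem_even] at hA
    obtain ⟨h1, h2, h3, h4, h5, h6⟩ := hA
    ext r s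
    fin_cases r <;> fin_cases s <;>
      simp [pow_two, Matrix.mul_apply, Fin.sum_univ_three, h1, h2, h3, h4, h5, h6] <;> ring

theorem even_pow_mem {K : Type u} [Field K] {p : ℕ} (hp : Odd p) {A : Matrix (Fin 3) (Fin 3) K}
    (hA : A ∈ ospPart K 0) : A ^ p ∈ ospPart K 0 := by
  obtain ⟨k, rfl⟩ := hp
  rw [even_pow hA]
  exact Submodule.smul_mem _ _ hA

section Enveloping

variable (K : Type u) [Field K] (p : ℕ) [Fact p.Prime] [Fact (2 < p)]

theorem odd_of_fact : Odd p :=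
  (Fact.out : p.Prime).odd_of_ne_two (by have : 2 < p := Fact.out; omega)

variable {K} in
/-- The `p`-th power map of the restricted structure: the `p`-th power of matrices. On the
standard basis of the even part it is `e ↦ 0`, `f ↦ 0`, `h ↦ h`. -/
def pMap (x : ospPart K 0) : ospPart K 0 := ⟨x.1 ^ p, even_pow_mem (odd_of_fact p) x.2⟩

/-- The defining relations of the restricted enveloping superalgebra:
`x y - (-1)^(|x||y|) y x = [x, y]` for homogeneous `x`, `y`, and `x ^ p = x^[p]` for even `x`. -/
inductive Rel : TensorAlgebra K (osp K) → TensorAlgebra K (osp K) → Prop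
  | bracket {i j : ZMod 2} (x : ospPart K i) (y : ospPart K j) :
      Rel (TensorAlgebra.ι K (toOsp x) * TensorAlgebra.ι K (toOsp y) -
          (-1 : K) ^ (i.val * j.val) •
            (TensorAlgebra.ι K (toOsp y) * TensorAlgebra.ι K (toOsp x)))
        (TensorAlgebra.ι K (superbracket x y))
  | pPower (x : ospPart K 0) :
      Rel (TensorAlgebra.ι K (toOsp x) ^ p) (TensorAlgebra.ι K (toOsp (pMap p x)))

/-- The restricted enveloping superalgebra `U_0(osp(1|2))` (`p`-character `χ = 0`). -/
def U : Type u := RingQuot (Rel K p)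

instance : Ring (U K p) := inferInstanceAs (Ring (RingQuot (Rel K p)))

instance : Algebra K (U K p) := inferInstanceAs (Algebra K (RingQuot (Rel K p)))

/-- The quotient map from the tensor algebra. -/
def mkU : TensorAlgebra K (osp K) →ₐ[K] U K p := RingQuot.mkAlgHom K (Rel K p)

/-- The canonical map from `osp(1|2)` to its restricted enveloping superalgebra. -/
def gen : osp K →ₗ[K] U K p :=
  (mkU K p).toLinearMap ∘ₗ TensorAlgebra.ι K

variable {K p} in
theorem mkU_rel {a b : TensorAlgebra K (osp K)} (h : Rel K p a b) : mkU K p a = mkU K p b :=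
  RingQuot.mkAlgHom_rel K h

theorem mkU_ι (x : osp K) : mkU K p (TensorAlgebra.ι K x) = gen K p x := rfl

variable {K} in
theorem gen_bracket {i j : ZMod 2} (x : ospPart K i) (y : ospPart K j) :
    gen K p (toOsp x) * gen K p (toOsp y) -
      (-1 : K) ^ (i.val * j.val) • (gen K p (toOsp y) * gen K p (toOsp x)) =
      gen K p (superbracket x y) := by
  have := mkU_rel (Rel.bracket (p := p) x y)
  simpa only [map_sub, map_smul, map_mul, mkU_ι] using this

variable {K} in
theorem gen_pow (x : ospPart K 0) :
    gen K p (toOsp x) ^ p = gen K p (toOsp (pMap p x)) := by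
  have := mkU_rel (Rel.pPower (p := p) x)
  simpa only [map_pow, mkU_ι] using this

variable {K} in
/-- The universal property of `U_0(osp(1|2))`. -/
def liftU {A : Type*} [Ring A] [Algebra K A] (ρ : osp K →ₗ[K] A)
    (hb : ∀ (i j : ZMod 2) (x : ospPart K i) (y : ospPart K j),
      ρ (toOsp x) * ρ (toOsp y) - (-1 : K) ^ (i.val * j.val) • (ρ (toOsp y) * ρ (toOsp x)) =
        ρ (superbracket x y))
    (hp : ∀ x : ospPart K 0, ρ (toOsp x) ^ p = ρ (toOsp (pMap p x))) : U K p →ₐ[K] A :=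
  RingQuot.liftAlgHom K ⟨TensorAlgebra.lift K ρ, by
    rintro _ _ (⟨x, y⟩ | x)
    · simpa only [map_sub, map_smul, map_mul, TensorAlgebra.lift_ι_apply] using hb _ _ x y
    · simpa only [map_pow, TensorAlgebra.lift_ι_apply] using hp x⟩

variable {K} in
theorem liftU_gen {A : Type*} [Ring A] [Algebra K A] (ρ : osp K →ₗ[K] A) (hb) (hp) (x : osp K) :
    liftU p ρ hb hp (gen K p x) = ρ x := by
  change RingQuot.liftAlgHom K _ (RingQuot.mkAlgHom K (Rel K p) (TensorAlgebra.ι K x)) = _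
  rw [RingQuot.liftAlgHom_mkAlgHom_apply, TensorAlgebra.lift_ι_apply]

/-! ### The `ℤ/2`-grading of the enveloping superalgebra -/

/-- Change of the sign of the odd part of a matrix. -/
def sigmaMat (A : Matrix (Fin 3) (Fin 3) K) : Matrix (Fin 3) (Fin 3) K :=
  Matrix.of fun r s => if idxParity r = idxParity s then A r s else -A r s

variable {K} in
theorem sigmaMat_mem {A : Matrix (Fin 3) (Fin 3) K} (hA : A ∈ osp K) : sigmaMat K A ∈ osp K := by
  rw [mem_osp] at hA ⊢
  obtain ⟨h1, h2, h3, h4⟩ := hA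
  simp [sigmaMat, idxParity, h1, h2, h3, h4]

/-- The parity involution of `osp(1|2)`: `1` on the even part and `-1` on the odd part. -/
def sigma : osp K →ₗ[K] osp K where
  toFun x := ⟨sigmaMat K x.1, sigmaMat_mem x.2⟩
  map_add' x y := Subtype.ext <| Matrix.ext fun r s => by
    change (if _ then x.1 r s + y.1 r s else -(x.1 r s + y.1 r s)) =
      (if _ then x.1 r s else -x.1 r s) + (if _ then y.1 r s else -y.1 r s)
    split_ifs
    exacts [rfl, neg_add _ _]
  map_smul' c x := Subtype.ext <| Matrix.ext fun r s => by
    change (if _ then c * x.1 r s else -(c * x.1 r s)) = c * (if _ then x.1 r s else -x.1 r s)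
    split_ifs
    exacts [rfl, (mul_neg _ _).symm]

theorem sigma_coe (x : osp K) (r s : Fin 3) :
    (sigma K x).1 r s = if idxParity r = idxParity s then x.1 r s else -x.1 r s := rfl

variable {K} in
theorem sigma_apply_of_mem {i : ZMod 2} (x : osp K) (hx : x.1 ∈ ospPart K i) :
    sigma K x = (-1 : K) ^ i.val • x := by
  ext r s
  have h := hx.2 r s
  have h2 : (1 : ZMod 2) + 1 = 0 := by decide
  rcases zmod_two_cases i with rfl | rfl <;> fin_cases r <;> fin_cases s <;>
    simp_all [sigma_coe, idxParity, ZMod.val_one]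

variable {K} in
theorem superbracket_part {i j : ZMod 2} (x : ospPart K i) (y : ospPart K j) :
    (superbracket x y).1 ∈ ospPart K (i + j) := by
  obtain ⟨x, hx⟩ := x
  obtain ⟨y, hy⟩ := y
  have h2 : (1 : ZMod 2) + 1 = 0 := by decide
  rcases zmod_two_cases i with rfl | rfl <;> rcases zmod_two_cases j with rfl | rfl <;>
    simp only [h2, add_zero, zero_add] <;>
    simp only [mem_even, mem_odd] at hx hy ⊢ <;>
    simp [superbracket, Matrix.mul_apply, Fin.sum_univ_three, hx, hy, ZMod.val_one] <;>
    ring_nf <;> simp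

theorem neg_one_pow_val_add (i j : ZMod 2) :
    (-1 : K) ^ (i + j).val = (-1) ^ i.val * (-1) ^ j.val := by
  have h2 : (1 : ZMod 2) + 1 = 0 := by decide
  rcases zmod_two_cases i with rfl | rfl <;> rcases zmod_two_cases j with rfl | rfl <;>
    simp [h2, ZMod.val_one]

/-- The parity automorphism of `U_0(osp(1|2))`: it extends `sigma`. -/
def parityAut : U K p →ₐ[K] U K p :=
  liftU p (gen K p ∘ₗ sigma K)
    (by
      intro i j x y
      simp only [LinearMap.comp_apply]
      rw [sigma_apply_of_mem (toOsp x) x.2, sigma_apply_of_mem (toOsp y) y.2,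
        sigma_apply_of_mem (superbracket x y) (superbracket_part x y), neg_one_pow_val_add]
      simp only [map_smul, smul_mul_smul_comm]
      rw [← gen_bracket, smul_sub, smul_comm ((-1 : K) ^ (i.val * j.val)),
        mul_comm ((-1 : K) ^ j.val)])
    (by
      intro x
      simp only [LinearMap.comp_apply]
      rw [sigma_apply_of_mem (toOsp x) x.2, sigma_apply_of_mem (toOsp (pMap p x)) (pMap p x).2]
      simpa using gen_pow p x)

theorem parityAut_gen (x : osp K) : parityAut K p (gen K p x) = gen K p (sigma K x) := by
  simp [parityAut, liftU_gen]

theorem sigma_sigma (x : osp K) : sigma K (sigma K x) = x := by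
  ext r s
  by_cases h : idxParity r = idxParity s <;> simp [sigma_coe, h]

theorem parityAut_parityAut (u : U K p) : parityAut K p (parityAut K p u) = u := by
  have : (parityAut K p).comp (parityAut K p) = AlgHom.id K _ := by
    apply RingQuot.ringQuot_ext' (S := K) (s := Rel K p)
    apply TensorAlgebra.hom_ext
    ext x
    change parityAut K p (parityAut K p (gen K p x)) = gen K p x
    rw [parityAut_gen, parityAut_gen, sigma_sigma]
  exact DFunLike.congr_fun this u

/-- The homogeneous component of `U_0(osp(1|2))` of parity `i`: since `2` is invertible, it is the
eigenspace of the parity automorphism for the eigenvalue `(-1)^i`. -/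
def uPart (i : ZMod 2) : Submodule K (U K p) where
  carrier := {u | parityAut K p u = (-1 : K) ^ i.val • u}
  add_mem' := by
    intro a b (ha : _ = _) (hb : _ = _)
    change _ = _
    rw [map_add, ha, hb, smul_add]
  zero_mem' := by change _ = _; simp
  smul_mem' := by
    intro c a (ha : _ = _)
    change _ = _
    rw [map_smul, ha, smul_comm]

variable {K p} in
theorem mem_uPart {i : ZMod 2} {u : U K p} :
    u ∈ uPart K p i ↔ parityAut K p u = (-1 : K) ^ i.val • u := Iff.rfl

variable {K} in
theorem gen_mem_uPart {i : ZMod 2} (x : ospPart K i) : gen K p (toOsp x) ∈ uPart K p i := by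
  rw [mem_uPart, parityAut_gen, sigma_apply_of_mem (toOsp x) x.2, map_smul]

variable {K p} in
theorem mul_mem_uPart {i j : ZMod 2} {u w : U K p} (hu : u ∈ uPart K p i)
    (hw : w ∈ uPart K p j) : u * w ∈ uPart K p (i + j) := by
  rw [mem_uPart] at *
  rw [map_mul, hu, hw, smul_mul_smul_comm, neg_one_pow_val_add]

theorem two_ne_zero_of_fact (K : Type u) [Field K] (p : ℕ) [Fact p.Prime] [Fact (2 < p)]
    [CharP K p] : (2 : K) ≠ 0 := by
  have h : ((2 : ℕ) : K) ≠ 0 := by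
    rw [Ne, CharP.cast_eq_zero_iff K p]
    have : 2 < p := Fact.out
    exact fun h => absurd (Nat.le_of_dvd two_pos h) (by omega)
  exact_mod_cast h

theorem half_add_mem (u : U K p) : (2 : K)⁻¹ • (u + parityAut K p u) ∈ uPart K p 0 := by
  rw [mem_uPart, map_smul, map_add, parityAut_parityAut, add_comm]
  simp

theorem half_sub_mem (u : U K p) : (2 : K)⁻¹ • (u - parityAut K p u) ∈ uPart K p 1 := by
  rw [mem_uPart, map_smul, map_sub, parityAut_parityAut, ZMod.val_one, pow_one, neg_one_smul,
    ← smul_neg, neg_sub]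

theorem half_add_half [CharP K p] (u : U K p) :
    (2 : K)⁻¹ • (u + parityAut K p u) + (2 : K)⁻¹ • (u - parityAut K p u) = u := by
  rw [← smul_add, add_add_sub_cancel, ← two_smul K u, smul_smul,
    inv_mul_cancel₀ (two_ne_zero_of_fact K p), one_smul]

/-! ### Supermodules -/

/-- A `U_0(osp(1|2))`-supermodule: a module `M = M₀ ⊕ M₁` on which the homogeneous elements of
`osp(1|2)` (which generate the enveloping superalgebra) act homogeneously. -/
structure SuperModule where
  carrier : Type u
  [addCommGroup : AddCommGroup carrier]
  [moduleK : Module K carrier]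
  [moduleU : Module (U K p) carrier]
  [tower : IsScalarTower K (U K p) carrier]
  part : ZMod 2 → Submodule K carrier
  isCompl : IsCompl (part 0) (part 1)
  gen_smul_mem : ∀ {i j : ZMod 2} (x : ospPart K i) {m : carrier}, m ∈ part j →
    gen K p (toOsp x) • m ∈ part (i + j)

instance : CoeSort (SuperModule K p) (Type u) := ⟨SuperModule.carrier⟩

attribute [instance] SuperModule.addCommGroup SuperModule.moduleK SuperModule.moduleU
  SuperModule.tower

variable {K p}

/-- A submodule in the super sense: `N = (N ∩ M₀) ⊕ (N ∩ M₁)`. -/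
def IsSuperSubmodule {M : SuperModule K p} (N : Submodule (U K p) M) : Prop :=
  ∀ m ∈ N, ∃ m₀ ∈ M.part 0, ∃ m₁ ∈ M.part 1, m₀ ∈ N ∧ m₁ ∈ N ∧ m = m₀ + m₁

/-- A linear map is homogeneous of parity `c` if it sends `M_i` to `N_(i+c)`. -/
def IsHomogeneousMap {M N : SuperModule K p} (c : ZMod 2) (φ : M →ₗ[U K p] N) : Prop :=
  ∀ i, ∀ m ∈ M.part i, φ m ∈ N.part (i + c)

/-- Isomorphism of supermodules, by an even or an odd map. (Odd maps with the sign rule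
`φ (x m) = (-1)^|x| x φ(m)` become linear after composition with the parity involution, so the
relation is the same.) -/
def SuperIso (M N : SuperModule K p) : Prop :=
  ∃ (φ : M ≃ₗ[U K p] N) (c : ZMod 2), IsHomogeneousMap c φ.toLinearMap

/-- A simple (irreducible) supermodule. -/
def SuperModule.IsSimple (M : SuperModule K p) : Prop :=
  Nontrivial M ∧ ∀ N : Submodule (U K p) M, IsSuperSubmodule N → N = ⊥ ∨ N = ⊤

/-- The subquotient `N / N'` of `M` (where `N' ≤ N`) is isomorphic to `X` as a supermodule, by an
even or an odd map. -/
def SubquotientIso {M : SuperModule K p} (N' N : Submodule (U K p) M) (X : SuperModule K p) :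
    Prop :=
  ∃ (φ : (N ⧸ N'.submoduleOf N) ≃ₗ[U K p] X) (c : ZMod 2),
    ∀ (i : ZMod 2) (x : N), (x : M) ∈ M.part i → φ (Submodule.Quotient.mk x) ∈ X.part (i + c)

/-- `M` has a filtration `0 = N_0 ⊆ N_1 ⊆ ⋯ ⊆ N_n = M` by super submodules with
`N_(i+1) / N_i` isomorphic to `X_i`. -/
def HasFiltration (M : SuperModule K p) {n : ℕ} (X : Fin n → SuperModule K p) : Prop :=
  ∃ N : Fin (n + 1) → Submodule (U K p) M,
    (∀ i, IsSuperSubmodule (N i)) ∧ N 0 = ⊥ ∧ N (Fin.last n) = ⊤ ∧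
    ∀ i : Fin n, N i.castSucc ≤ N i.succ ∧ SubquotientIso (N i.castSucc) (N i.succ) (X i)

/-- `M` has a composition series with composition factors `X_0, …, X_(n-1)` (from the bottom
to the top). -/
def HasCompositionFactors (M : SuperModule K p) {n : ℕ} (X : Fin n → SuperModule K p) : Prop :=
  (∀ i, (X i).IsSimple) ∧ HasFiltration M X

/-- Projective supermodules: even maps lift along even surjections. -/
def SuperModule.IsProjective (P : SuperModule K p) : Prop :=
  ∀ (M N : SuperModule K p) (g : M →ₗ[U K p] N) (f : P →ₗ[U K p] N),
    IsHomogeneousMap 0 g → IsHomogeneousMap 0 f → Function.Surjective g →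
      ∃ k : P →ₗ[U K p] M, IsHomogeneousMap 0 k ∧ g ∘ₗ k = f

/-- `π : P → M` is a projective cover: `P` is projective and `π` is an even surjection with
superfluous kernel. -/
def IsProjectiveCover {P M : SuperModule K p} (π : P →ₗ[U K p] M) : Prop :=
  P.IsProjective ∧ IsHomogeneousMap 0 π ∧ Function.Surjective π ∧
    ∀ N : Submodule (U K p) P, IsSuperSubmodule N → N ⊔ LinearMap.ker π = ⊤ → N = ⊤

/-! ### Baby Verma modules -/

variable (p) in
/-- The left ideal of `U_0(osp(1|2))` generated by `x - l(x)`, `x` in the Borel subalgebra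
`K e + K h + K E`, where `l` is the character of the Borel subalgebra with `l(h) = l`,
`l(e) = l(E) = 0`. -/
def borelIdeal (l : K) : Submodule (U K p) (U K p) :=
  Submodule.span (U K p)
    {u | ∃ x : osp K, x.1 0 1 = 0 ∧ x.1 2 1 = 0 ∧
      u = gen K p x - algebraMap K (U K p) (l * x.1 1 1)}

theorem parityAut_mem_borelIdeal {l : K} {u : U K p} (hu : u ∈ borelIdeal p l) :
    parityAut K p u ∈ borelIdeal p l := by
  induction hu using Submodule.span_induction with
  | mem u h =>
    obtain ⟨x, h1, h2, rfl⟩ := h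
    refine Submodule.subset_span ⟨sigma K x, ?_, ?_, ?_⟩
    · simp [sigma_coe, idxParity, h1]
    · simp [sigma_coe, idxParity, h2]
    · rw [map_sub, parityAut_gen, AlgHom.commutes]
      simp [sigma_coe, idxParity]
  | zero => simp
  | add u w _ _ hu hw => rw [map_add]; exact Submodule.add_mem _ hu hw
  | smul a u _ hu => rw [smul_eq_mul, map_mul]; exact Submodule.smul_mem _ _ hu

variable (K p) in
/-- The baby Verma module `Z(l) = U_0(g) ⊗_{U_0(b)} K_l`, for `l ∈ {0, …, p - 1}`: the tensor
product is the quotient of `U_0(g)` by the left ideal generated by the `x - l(x)`, `x ∈ b`.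
The highest weight vector `1 ⊗ 1` is even. -/
def babyVerma [CharP K p] (l : Fin p) : SuperModule K p where
  carrier := U K p ⧸ borelIdeal p ((l : ℕ) : K)
  part i := (uPart K p i).map ((borelIdeal p ((l : ℕ) : K)).mkQ.restrictScalars K)
  isCompl := by
    set J := borelIdeal p ((l : ℕ) : K) with hJ
    constructor
    · rw [Submodule.disjoint_def]
      rintro _ ⟨u, hu, rfl⟩ ⟨w, hw, h⟩
      have h1 : w - u ∈ J := by
        rw [← Submodule.Quotient.mk_eq_zero, Submodule.Quotient.mk_sub, sub_eq_zero]
        exact h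
      have h2 := parityAut_mem_borelIdeal h1
      rw [map_sub, mem_uPart.1 hu, mem_uPart.1 hw] at h2
      simp only [ZMod.val_zero, pow_zero, one_smul, ZMod.val_one, pow_one, neg_smul] at h2
      have h3 : (2 : K) • u ∈ J := by
        have := J.neg_mem (J.add_mem h1 h2)
        have e : -(w - u + (-w - u)) = (2 : K) • u := by rw [two_smul]; abel
        rwa [e] at this
      have h4 : u ∈ J := by
        have := J.smul_mem (algebraMap K (U K p) 2⁻¹) h3
        rwa [algebraMap_smul, smul_smul, inv_mul_cancel₀ (two_ne_zero_of_fact K p), one_smul] at this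
      exact (Submodule.Quotient.mk_eq_zero J).2 h4
    · rw [codisjoint_iff, eq_top_iff]
      rintro m -
      obtain ⟨u, rfl⟩ := J.mkQ_surjective m
      rw [← half_add_half K p u]
      rw [map_add]
      exact Submodule.add_mem_sup (Submodule.mem_map_of_mem (half_add_mem K p u))
        (Submodule.mem_map_of_mem (half_sub_mem K p u))
  gen_smul_mem := by
    rintro i j x _ ⟨u, hu, rfl⟩
    exact ⟨gen K p (toOsp x) * u, mul_mem_uPart (gen_mem_uPart p x) hu, rfl⟩

end Enveloping

/-! ### Constructing modules from the action of the standard basis -/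

section Action

variable {K : Type u} [Field K]

/-- The standard basis vector `h`. -/
def hEl (K : Type u) [Field K] : ospPart K 0 :=
  ⟨!![0, 0, 0; 0, 1, 0; 0, 0, -1], by rw [mem_even]; simp⟩

/-- The standard basis vector `e`. -/
def eEl (K : Type u) [Field K] : ospPart K 0 :=
  ⟨!![0, 0, 0; 0, 0, 1; 0, 0, 0], by rw [mem_even]; simp⟩

/-- The standard basis vector `f`. -/
def fEl (K : Type u) [Field K] : ospPart K 0 :=
  ⟨!![0, 0, 0; 0, 0, 0; 0, 1, 0], by rw [mem_even]; simp⟩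

/-- The standard basis vector `E`. -/
def oddE (K : Type u) [Field K] : ospPart K 1 :=
  ⟨!![0, 0, 1; 1, 0, 0; 0, 0, 0], by rw [mem_odd]; simp⟩

/-- The standard basis vector `F`. -/
def oddF (K : Type u) [Field K] : ospPart K 1 :=
  ⟨!![0, 1, 0; 0, 0, 0; -1, 0, 0], by rw [mem_odd]; simp⟩

theorem even_eq (x : ospPart K 0) :
    x = x.1 1 1 • hEl K + x.1 1 2 • eEl K + x.1 2 1 • fEl K := by
  obtain ⟨x, hx⟩ := x
  rw [mem_even] at hx
  obtain ⟨h1, h2, h3, h4, h5, h6⟩ := hx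
  apply Subtype.ext
  ext r s
  fin_cases r <;> fin_cases s <;> simp [hEl, eEl, fEl, h1, h2, h3, h4, h5, h6]

theorem pow_relation {p : ℕ} [Fact p.Prime] [Fact (2 < p)] [CharP K p] {A : Type*} [Ring A]
    [Algebra K A] (ρ : osp K →ₗ[K] A)
    (hb : ∀ x y : ospPart K 0,
      ρ (toOsp x) * ρ (toOsp y) - ρ (toOsp y) * ρ (toOsp x) = ρ (superbracket x y))
    (hh : ρ (toOsp (hEl K)) ^ p = ρ (toOsp (hEl K))) (he : ρ (toOsp (eEl K)) ^ p = 0)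
    (hf : ρ (toOsp (fEl K)) ^ p = 0) (x : ospPart K 0) :
    ρ (toOsp x) ^ p = ρ (toOsp (pMap p x)) := by
  have hp : p.Prime := Fact.out
  have hodd : Odd p := odd_of_fact p
  let τ : ospPart K 0 →ₗ[K] A :=
    { toFun := fun x => ρ (toOsp x)
      map_add' := fun x y => ρ.map_add (toOsp x) (toOsp y)
      map_smul' := fun c x => ρ.map_smul c (toOsp x) }
  change τ x ^ p = τ (pMap p x)
  have hadd : ∀ x y : ospPart K 0, τ x ^ p = τ (pMap p x) → τ y ^ p = τ (pMap p y) →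
      τ (x + y) ^ p = τ (pMap p (x + y)) := by
    intro x y hx hy
    let ψ : ospPart K 0 →ₗ[K] A × Matrix (Fin 3) (Fin 3) K := τ.prod (ospPart K 0).subtype
    have key := add_pow_sub_mem (K := K) hp hodd (LinearMap.range ψ) (by
      rintro _ ⟨a, rfl⟩ _ ⟨b, rfl⟩
      refine ⟨⟨(superbracket a b).1, by simpa using superbracket_part a b⟩, ?_⟩
      refine Prod.ext ?_ ?_
      · exact (hb a b).symm
      · simp [ψ, superbracket]) (LinearMap.mem_range_self ψ x) (LinearMap.mem_range_self ψ y)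
    obtain ⟨z, hz⟩ := key
    rw [← map_add] at hz
    have h1 : τ z = τ (x + y) ^ p - τ x ^ p - τ y ^ p := congrArg Prod.fst hz
    have h2 : z.1 = (x + y).1 ^ p - x.1 ^ p - y.1 ^ p := congrArg Prod.snd hz
    have h3 : z = pMap p (x + y) - pMap p x - pMap p y := Subtype.ext h2
    rw [h3, map_sub, map_sub, hx, hy] at h1
    simpa using h1.symm
  have hsmul : ∀ (c : K) (x : ospPart K 0), τ x ^ p = τ (pMap p x) →
      τ (c • x) ^ p = τ (pMap p (c • x)) := by
    intro c x hx
    have : pMap p (c • x) = c ^ p • pMap p x := by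
      apply Subtype.ext
      simp [pMap, smul_pow]
    rw [this, map_smul, map_smul, smul_pow, hx]
  have hpow : ∀ y : ospPart K 0,
      (pMap p y).1 = (y.1 1 1 ^ 2 + y.1 1 2 * y.1 2 1) ^ (p / 2) • y.1 := by
    intro y
    rw [← even_pow y.2, Nat.two_mul_div_two_add_one_of_odd hodd]
    rfl
  have hp2 : p / 2 ≠ 0 := by
    have : 2 < p := Fact.out
    omega
  rw [even_eq x]
  refine hadd _ _ (hadd _ _ (hsmul _ _ ?_) (hsmul _ _ ?_)) (hsmul _ _ ?_)
  · have : pMap p (hEl K) = hEl K := by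
      apply Subtype.ext
      rw [hpow]
      simp [hEl]
    rw [this]
    exact hh
  · have : pMap p (eEl K) = 0 := by
      apply Subtype.ext
      rw [hpow]
      simp [eEl, hp2]
    rw [this, map_zero]
    exact he
  · have : pMap p (fEl K) = 0 := by
      apply Subtype.ext
      rw [hpow]
      simp [fEl, hp2]
    rw [this, map_zero]
    exact hf

/-- The linear map on `osp(1|2)` with prescribed values at the basis `h, e, f, E, F`. -/
def rho {A : Type*} [Ring A] [Algebra K A] (H e f E F : A) : osp K →ₗ[K] A where
  toFun x := x.1 1 1 • H + x.1 1 2 • e + x.1 2 1 • f + x.1 0 2 • E + x.1 0 1 • F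
  map_add' x y := by
    change (x.1 1 1 + y.1 1 1) • H + (x.1 1 2 + y.1 1 2) • e + (x.1 2 1 + y.1 2 1) • f +
      (x.1 0 2 + y.1 0 2) • E + (x.1 0 1 + y.1 0 1) • F = _
    module
  map_smul' c x := by
    change (c * x.1 1 1) • H + (c * x.1 1 2) • e + (c * x.1 2 1) • f +
      (c * x.1 0 2) • E + (c * x.1 0 1) • F = c • _
    module

theorem rho_bracket {A : Type*} [Ring A] [Algebra K A] {H e f E F : A} (he : e = E * E)
    (hf : f = -(F * F)) (hH : H = E * F + F * E) (hE : H * E - E * H = E)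
    (hF : H * F - F * H = -F) (i j : ZMod 2) (x : ospPart K i) (y : ospPart K j) :
    rho H e f E F (toOsp x) * rho H e f E F (toOsp y) - (-1 : K) ^ (i.val * j.val) •
      (rho H e f E F (toOsp y) * rho H e f E F (toOsp x)) =
      rho H e f E F (superbracket x y) := by
  have r1 : e * E - E * e = 0 := by rw [he]; noncomm_ring
  have r2 : e * F - F * e = -E := by
    have : e * F - F * e = -(H * E - E * H) := by rw [he, hH]; noncomm_ring
    rw [this, hE]
  have r3 : f * E - E * f = -F := by
    have : f * E - E * f = H * F - F * H := by rw [hf, hH]; noncomm_ring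
    rw [this, hF]
  have r4 : f * F - F * f = 0 := by rw [hf]; noncomm_ring
  have r5 : H * e - e * H = (2 : K) • e := by
    have : H * e - e * H = (H * E - E * H) * E + E * (H * E - E * H) := by
      rw [he]; noncomm_ring
    rw [this, hE, he, two_smul]
  have r6 : H * f - f * H = (-2 : K) • f := by
    have : H * f - f * H = -((H * F - F * H) * F + F * (H * F - F * H)) := by
      rw [hf]; noncomm_ring
    rw [this, hF, hf, neg_smul, two_smul]; noncomm_ring
  have r7 : e * f - f * e = H := by
    have : e * f - f * e = -((e * F - F * e) * F + F * (e * F - F * e)) := by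
      rw [hf]; noncomm_ring
    rw [this, r2, hH]; noncomm_ring
  obtain ⟨x, hx⟩ := x
  obtain ⟨y, hy⟩ := y
  rcases zmod_two_cases i with rfl | rfl <;> rcases zmod_two_cases j with rfl | rfl <;>
    simp only [mem_even, mem_odd] at hx hy <;>
    simp [rho, toOsp, superbracket, Matrix.mul_apply, Fin.sum_univ_three, hx, hy, ZMod.val_one,
      mul_add, add_mul]
  · linear_combination (norm := module) (x 1 1 * y 1 2 - x 1 2 * y 1 1) • r5 +
      (x 1 1 * y 2 1 - x 2 1 * y 1 1) • r6 + (x 1 2 * y 2 1 - x 2 1 * y 1 2) • r7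
  · linear_combination (norm := module) (x 1 1 * y 0 2) • hE + (x 1 1 * y 0 1) • hF +
      (x 1 2 * y 0 2) • r1 + (x 1 2 * y 0 1) • r2 + (x 2 1 * y 0 2) • r3 + (x 2 1 * y 0 1) • r4
  · linear_combination (norm := module) (-(y 1 1 * x 0 2)) • hE + (-(y 1 1 * x 0 1)) • hF +
      (-(y 1 2 * x 0 2)) • r1 + (-(y 1 2 * x 0 1)) • r2 + (-(y 2 1 * x 0 2)) • r3 +
      (-(y 2 1 * x 0 1)) • r4
  · rw [he, hf, hH]
    module

end Action

/-! ### The simple modules -/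

section Simple

variable (K : Type u) [Field K]

/-- The basis vector `v_i` of `K^n`, with the convention `v_i = 0` for `i ≥ n`. -/
def vec (n i : ℕ) : Fin n → K := fun k => if (k : ℕ) = i then 1 else 0

/-- The operator `v_i ↦ c_i v_(s i)` on `K^n`. -/
def shiftOp (n : ℕ) (c : ℕ → K) (s : ℕ → ℕ) : Module.End K (Fin n → K) :=
  Fintype.linearCombination K fun i : Fin n => c i • vec K n (s i)

variable {K}

theorem vec_of_le {n i : ℕ} (h : n ≤ i) : vec K n i = 0 := by
  ext k
  have := k.2
  simp only [vec, Pi.zero_apply, ite_eq_right_iff]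
  omega

theorem shiftOp_vec {n : ℕ} {c : ℕ → K} {s : ℕ → ℕ} (h : ∀ i, n ≤ i → c i • vec K n (s i) = 0)
    (i : ℕ) : shiftOp K n c s (vec K n i) = c i • vec K n (s i) := by
  by_cases hi : n ≤ i
  · rw [vec_of_le hi, map_zero, h i hi]
  · push Not at hi
    rw [shiftOp, Fintype.linearCombination_apply, Finset.sum_eq_single ⟨i, hi⟩]
    · simp [vec]
    · intro b _ hb
      have : (b : ℕ) ≠ i := fun h => hb (Fin.ext h)
      simp [vec, this]
    · simp

theorem end_ext {n : ℕ} {S T : Module.End K (Fin n → K)}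
    (h : ∀ i, S (vec K n i) = T (vec K n i)) : S = T := by
  refine LinearMap.pi_ext' fun i => LinearMap.ext_ring ?_
  have e : Pi.single i (1 : K) = vec K n i := by
    ext k
    simp [vec, Pi.single_apply, Fin.ext_iff]
  simpa [e] using h i

variable (K)

/-- `h v_i = (l - i) v_i` -/
def opH (l : ℕ) : Module.End K (Fin (2 * l + 1) → K) :=
  shiftOp K _ (fun i => (l : K) - i) (fun i => i)

/-- `f v_i = - v_(i+2)` -/
def opf (l : ℕ) : Module.End K (Fin (2 * l + 1) → K) :=
  shiftOp K _ (fun _ => -1) (fun i => i + 2)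

/-- `F v_i = v_(i+1)` -/
def opF (l : ℕ) : Module.End K (Fin (2 * l + 1) → K) :=
  shiftOp K _ (fun _ => 1) (fun i => i + 1)

/-- `e v_i = - (i/2) (l + 1 - i/2) v_(i-2)` for even `i`, and
`e v_i = - ((i-1)/2) (l - (i-1)/2) v_(i-2)` for odd `i`. -/
def ope (l : ℕ) : Module.End K (Fin (2 * l + 1) → K) :=
  shiftOp K _
    (fun i => if Even i then -((i / 2 : ℕ) : K) * (l + 1 - ((i / 2 : ℕ) : K))
      else -(((i - 1) / 2 : ℕ) : K) * (l - (((i - 1) / 2 : ℕ) : K)))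
    (fun i => i - 2)

/-- `E v_i = - (i/2) v_(i-1)` for even `i`, and `E v_i = (l - (i-1)/2) v_(i-1)` for odd `i`. -/
def opE (l : ℕ) : Module.End K (Fin (2 * l + 1) → K) :=
  shiftOp K _
    (fun i => if Even i then -((i / 2 : ℕ) : K) else (l : K) - (((i - 1) / 2 : ℕ) : K))
    (fun i => i - 1)

variable {K} {l : ℕ}

theorem opH_vec (i : ℕ) : opH K l (vec K _ i) = ((l : K) - i) • vec K _ i :=
  shiftOp_vec (fun i hi => by rw [vec_of_le hi, smul_zero]) i

theorem opf_vec (i : ℕ) : opf K l (vec K _ i) = -vec K _ (i + 2) := by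
  rw [← neg_one_smul K]
  exact shiftOp_vec (fun i hi => by rw [vec_of_le (by omega), smul_zero]) i

theorem opF_vec (i : ℕ) : opF K l (vec K _ i) = vec K _ (i + 1) := by
  rw [← one_smul K (vec K _ (i + 1))]
  exact shiftOp_vec (fun i hi => by rw [vec_of_le (by omega), smul_zero]) i

theorem opE_vec (i : ℕ) : opE K l (vec K _ i) =
    (if Even i then -((i / 2 : ℕ) : K) else (l : K) - (((i - 1) / 2 : ℕ) : K)) •
      vec K _ (i - 1) := by
  refine shiftOp_vec (fun i hi => ?_) i
  rcases Nat.lt_or_ge i (2 * l + 2) with h | h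
  · obtain rfl : i = 2 * l + 1 := by omega
    simp
  · rw [vec_of_le (by omega), smul_zero]

theorem ope_vec (i : ℕ) : ope K l (vec K _ i) =
    (if Even i then -((i / 2 : ℕ) : K) * (l + 1 - ((i / 2 : ℕ) : K))
      else -(((i - 1) / 2 : ℕ) : K) * (l - (((i - 1) / 2 : ℕ) : K))) • vec K _ (i - 2) := by
  refine shiftOp_vec (fun i hi => ?_) i
  rcases Nat.lt_or_ge i (2 * l + 3) with h | h
  · rcases (by omega : i = 2 * l + 1 ∨ i = 2 * (l + 1)) with rfl | rfl
    · simp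
    · simp
  · rw [vec_of_le (by omega), smul_zero]

theorem opE_even (j : ℕ) : opE K l (vec K _ (2 * j)) = (-(j : K)) • vec K _ (2 * j - 1) := by
  simp [opE_vec]

theorem opE_odd (j : ℕ) : opE K l (vec K _ (2 * j + 1)) = ((l : K) - j) • vec K _ (2 * j) := by
  simp [opE_vec]

theorem ope_eq : ope K l = opE K l * opE K l := by
  refine end_ext fun i => ?_
  rw [Module.End.mul_apply]
  rcases Nat.even_or_odd' i with ⟨j, rfl | rfl⟩
  · rw [ope_vec, opE_even]
    cases j with
    | zero => simp
    | succ j =>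
      rw [show 2 * (j + 1) - 1 = 2 * j + 1 by omega, map_smul, opE_odd]
      simp [smul_smul, show 2 * (j + 1) - 2 = 2 * j by omega]
  · rw [ope_vec, opE_odd, map_smul, opE_even]
    simp only [show 2 * j + 1 - 2 = 2 * j - 1 by omega, smul_smul, Nat.not_even_bit1, if_false,
      Nat.add_sub_cancel, Nat.mul_div_cancel_left j two_pos]
    congr 1
    ring

theorem opf_eq : opf K l = -(opF K l * opF K l) := by
  refine end_ext fun i => ?_
  rw [LinearMap.neg_apply, Module.End.mul_apply, opf_vec, opF_vec, opF_vec]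

theorem opH_eq : opH K l = opE K l * opF K l + opF K l * opE K l := by
  refine end_ext fun i => ?_
  rw [LinearMap.add_apply, Module.End.mul_apply, Module.End.mul_apply, opH_vec, opF_vec]
  rcases Nat.even_or_odd' i with ⟨j, rfl | rfl⟩
  · rw [opE_odd, opE_even, map_smul, opF_vec]
    cases j with
    | zero => simp
    | succ j =>
      rw [show 2 * (j + 1) - 1 + 1 = 2 * (j + 1) by omega, ← add_smul]
      congr 1
      push_cast
      ring
  · rw [show 2 * j + 1 + 1 = 2 * (j + 1) by ring, opE_even, opE_odd, map_smul, opF_vec,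
      show 2 * (j + 1) - 1 = 2 * j + 1 by omega, ← add_smul]
    congr 1
    push_cast
    ring

theorem opH_opE : opH K l * opE K l - opE K l * opH K l = opE K l := by
  refine end_ext fun i => ?_
  rw [LinearMap.sub_apply, Module.End.mul_apply, Module.End.mul_apply, opH_vec, map_smul]
  cases i with
  | zero => simp [opE_vec]
  | succ i =>
    rw [opE_vec, map_smul, Nat.add_sub_cancel, opH_vec, smul_comm, ← sub_smul]
    push_cast
    rw [show (l : K) - i - (l - (i + 1)) = 1 by ring, one_smul]

theorem opH_opF : opH K l * opF K l - opF K l * opH K l = -opF K l := by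
  refine end_ext fun i => ?_
  rw [LinearMap.sub_apply, Module.End.mul_apply, Module.End.mul_apply, opH_vec, map_smul,
    LinearMap.neg_apply, opF_vec, opH_vec, ← sub_smul, ← neg_one_smul K (vec K _ (i + 1))]
  congr 1
  push_cast
  ring

theorem opE_pow_vec (k i : ℕ) (h : i < k) : (opE K l ^ k) (vec K _ i) = 0 := by
  induction k generalizing i with
  | zero => omega
  | succ k ih =>
    rw [pow_succ, Module.End.mul_apply]
    cases i with
    | zero => simp [opE_vec]
    | succ i => rw [opE_vec, map_smul, Nat.add_sub_cancel, ih i (by omega), smul_zero]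

theorem opF_pow_vec (k i : ℕ) : (opF K l ^ k) (vec K _ i) = vec K _ (i + k) := by
  induction k generalizing i with
  | zero => simp
  | succ k ih =>
    rw [pow_succ, Module.End.mul_apply, opF_vec, ih]
    congr 1
    ring

theorem opH_pow_vec (k i : ℕ) : (opH K l ^ k) (vec K _ i) = ((l : K) - i) ^ k • vec K _ i := by
  induction k with
  | zero => simp
  | succ k ih => rw [pow_succ, Module.End.mul_apply, opH_vec, map_smul, ih, smul_smul, pow_succ']

theorem opE_pow_eq_zero {k : ℕ} (h : 2 * l + 1 ≤ k) : opE K l ^ k = 0 := by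
  refine end_ext fun i => ?_
  by_cases hi : 2 * l + 1 ≤ i
  · rw [vec_of_le hi, map_zero, map_zero]
  · rw [opE_pow_vec k i (by omega), LinearMap.zero_apply]

theorem opF_pow_eq_zero {k : ℕ} (h : 2 * l + 1 ≤ k) : opF K l ^ k = 0 := by
  refine end_ext fun i => ?_
  rw [opF_pow_vec, vec_of_le (by omega), LinearMap.zero_apply]

theorem neg_mul_self_pow {A : Type*} [Ring A] {p : ℕ} (F : A) (h : F ^ (2 * p) = 0) :
    (-(F * F)) ^ p = 0 := by
  rw [← pow_two, neg_pow, ← pow_mul, h, mul_zero]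

theorem opH_pow_char {p : ℕ} [Fact p.Prime] [CharP K p] : opH K l ^ p = opH K l := by
  refine end_ext fun i => ?_
  rw [opH_pow_vec, opH_vec, sub_pow_char]
  congr 2
  · exact map_natCast (frobenius K p) l
  · exact map_natCast (frobenius K p) i

variable (K)

/-- The action of `osp(1|2)` on `L(l)`. -/
def simpleRho (l : ℕ) : osp K →ₗ[K] Module.End K (Fin (2 * l + 1) → K) :=
  rho (opH K l) (ope K l) (opf K l) (opE K l) (opF K l)

variable (p : ℕ) [Fact p.Prime] [Fact (2 < p)] [CharP K p]

variable {K} in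
theorem simpleRho_bracket (l : ℕ) (i j : ZMod 2) (x : ospPart K i) (y : ospPart K j) :
    simpleRho K l (toOsp x) * simpleRho K l (toOsp y) - (-1 : K) ^ (i.val * j.val) •
      (simpleRho K l (toOsp y) * simpleRho K l (toOsp x)) = simpleRho K l (superbracket x y) :=
  rho_bracket ope_eq opf_eq opH_eq opH_opE opH_opF i j x y

variable {K p} in
theorem simpleRho_pow (l : Fin p) (x : ospPart K 0) :
    simpleRho K (l : ℕ) (toOsp x) ^ p = simpleRho K (l : ℕ) (toOsp (pMap p x)) := by
  have hl := l.2
  refine pow_relation _ (fun x y => ?_) ?_ ?_ ?_ x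
  · have := simpleRho_bracket (l : ℕ) 0 0 x y
    rwa [ZMod.val_zero, mul_zero, pow_zero, one_smul] at this
  · have : simpleRho K l (toOsp (hEl K)) = opH K l := by
      simp [simpleRho, rho, toOsp, hEl]
    rw [this, opH_pow_char]
  · have : simpleRho K l (toOsp (eEl K)) = ope K l := by
      simp [simpleRho, rho, toOsp, eEl]
    rw [this, ope_eq, ← pow_two, ← pow_mul, opE_pow_eq_zero (by omega)]
  · have : simpleRho K l (toOsp (fEl K)) = opf K l := by
      simp [simpleRho, rho, toOsp, fEl]
    rw [this, opf_eq]
    exact neg_mul_self_pow _ (opF_pow_eq_zero (by omega))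

/-- The action of `U_0(osp(1|2))` on `L(l)`. -/
def simpleAction (l : Fin p) : U K p →ₐ[K] Module.End K (Fin (2 * (l : ℕ) + 1) → K) :=
  liftU p (simpleRho K l) (simpleRho_bracket (l : ℕ)) (simpleRho_pow l)

theorem simpleAction_gen (l : Fin p) (x : osp K) :
    simpleAction K p l (gen K p x) = simpleRho K l x :=
  liftU_gen p _ _ _ x

variable {K p}

/-- The component of parity `i` of `L(l)`: the span of the basis vectors `v_k`, `k ≡ i mod 2`. -/
def simplePart (l : ℕ) (i : ZMod 2) : Submodule K (Fin (2 * l + 1) → K) :=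
  Submodule.span K {v | ∃ k : ℕ, (k : ZMod 2) = i ∧ v = vec K _ k}

theorem smul_vec_mem {i : ZMod 2} (c : K) {k : ℕ} (h : c ≠ 0 → (k : ZMod 2) = i) :
    c • vec K _ k ∈ simplePart l i := by
  by_cases hc : c = 0
  · rw [hc, zero_smul]
    exact Submodule.zero_mem _
  · exact Submodule.smul_mem _ _ (Submodule.subset_span ⟨k, h hc, rfl⟩)

theorem simplePart_isCompl : IsCompl (simplePart (K := K) l 0) (simplePart l 1) := by
  have key : ∀ (i : ZMod 2) (v : Fin (2 * l + 1) → K), v ∈ simplePart l i →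
      ∀ k : Fin (2 * l + 1), ((k : ℕ) : ZMod 2) ≠ i → v k = 0 := by
    intro i v hv k hk
    induction hv using Submodule.span_induction with
    | mem v h =>
      obtain ⟨m, hm, rfl⟩ := h
      simp only [vec, ite_eq_right_iff]
      rintro rfl
      exact absurd hm hk
    | zero => rfl
    | add v w _ _ h1 h2 => rw [Pi.add_apply, h1, h2, add_zero]
    | smul c v _ h => rw [Pi.smul_apply, h, smul_zero]
  constructor
  · rw [Submodule.disjoint_def]
    intro v h0 h1
    ext k
    rcases zmod_two_cases ((k : ℕ) : ZMod 2) with h | h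
    · exact key 1 v h1 k (by rw [h]; decide)
    · exact key 0 v h0 k (by rw [h]; decide)
  · rw [codisjoint_iff, eq_top_iff]
    rintro v -
    have e : v = ∑ k, v k • vec K (2 * l + 1) k := by
      ext m
      simp [vec, Fin.val_inj]
    rw [e]
    refine Submodule.sum_mem _ fun k _ => Submodule.smul_mem _ _ ?_
    rcases zmod_two_cases ((k : ℕ) : ZMod 2) with h | h
    · exact Submodule.mem_sup_left (Submodule.subset_span ⟨k, h, rfl⟩)
    · exact Submodule.mem_sup_right (Submodule.subset_span ⟨k, h, rfl⟩)

theorem opH_mem {j : ZMod 2} {v : Fin (2 * l + 1) → K} (hv : v ∈ simplePart l j) :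
    opH K l v ∈ simplePart l j := by
  induction hv using Submodule.span_induction with
  | mem v h =>
    obtain ⟨k, hk, rfl⟩ := h
    rw [opH_vec]
    exact smul_vec_mem _ fun _ => hk
  | zero => rw [map_zero]; exact Submodule.zero_mem _
  | add v w _ _ h1 h2 => rw [map_add]; exact Submodule.add_mem _ h1 h2
  | smul c v _ h => rw [map_smul]; exact Submodule.smul_mem _ _ h

theorem opF_mem {j : ZMod 2} {v : Fin (2 * l + 1) → K} (hv : v ∈ simplePart l j) :
    opF K l v ∈ simplePart l (j + 1) := by
  induction hv using Submodule.span_induction with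
  | mem v h =>
    obtain ⟨k, hk, rfl⟩ := h
    rw [opF_vec]
    exact Submodule.subset_span ⟨k + 1, by rw [← hk]; push_cast; rfl, rfl⟩
  | zero => rw [map_zero]; exact Submodule.zero_mem _
  | add v w _ _ h1 h2 => rw [map_add]; exact Submodule.add_mem _ h1 h2
  | smul c v _ h => rw [map_smul]; exact Submodule.smul_mem _ _ h

theorem opE_mem {j : ZMod 2} {v : Fin (2 * l + 1) → K} (hv : v ∈ simplePart l j) :
    opE K l v ∈ simplePart l (j + 1) := by
  induction hv using Submodule.span_induction with
  | mem v h =>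
    obtain ⟨k, hk, rfl⟩ := h
    rw [opE_vec]
    refine smul_vec_mem _ fun h => ?_
    cases k with
    | zero => simp at h
    | succ k =>
      rw [Nat.add_sub_cancel, ← hk]
      have : (1 : ZMod 2) + 1 = 0 := by decide
      push_cast
      rw [add_assoc, this, add_zero]
  | zero => rw [map_zero]; exact Submodule.zero_mem _
  | add v w _ _ h1 h2 => rw [map_add]; exact Submodule.add_mem _ h1 h2
  | smul c v _ h => rw [map_smul]; exact Submodule.smul_mem _ _ h

theorem simpleRho_mem {i j : ZMod 2} (x : ospPart K i) {v : Fin (2 * l + 1) → K}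
    (hv : v ∈ simplePart l j) : simpleRho K l (toOsp x) v ∈ simplePart l (i + j) := by
  have h2 : ∀ a : ZMod 2, a + 1 + 1 = a := by decide
  obtain ⟨x, hx⟩ := x
  change (x 1 1 • opH K l + x 1 2 • ope K l + x 2 1 • opf K l + x 0 2 • opE K l +
    x 0 1 • opF K l) v ∈ _
  rcases zmod_two_cases i with rfl | rfl
  · rw [mem_even] at hx
    obtain ⟨-, h01, h02, -⟩ := hx
    rw [h01, h02, zero_smul, zero_smul, add_zero, add_zero, zero_add, ope_eq, opf_eq]
    refine Submodule.add_mem _ (Submodule.add_mem _ (Submodule.smul_mem _ _ (opH_mem hv))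
      (Submodule.smul_mem _ _ ?_)) (Submodule.smul_mem _ _ (Submodule.neg_mem _ ?_))
    · have := opE_mem (opE_mem hv)
      rwa [h2] at this
    · have := opF_mem (opF_mem hv)
      rwa [h2] at this
  · rw [mem_odd] at hx
    obtain ⟨-, -, -, h11, h12, h21, -⟩ := hx
    rw [h11, h12, h21, zero_smul, zero_smul, zero_smul, zero_add, zero_add, zero_add, add_comm 1 j]
    exact Submodule.add_mem _ (Submodule.smul_mem _ _ (opE_mem hv))
      (Submodule.smul_mem _ _ (opF_mem hv))

variable (K p)

/-- The module `L(l)`, `l ∈ {0, …, p - 1}`: it has a basis `v_0, …, v_(2l)`, with `v_i` of the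
parity of `i`, and the action of `h, e, f, E, F` is given by `opH`, `ope`, `opf`, `opE`, `opF`. -/
def simpleModule (l : Fin p) : SuperModule K p where
  carrier := Fin (2 * (l : ℕ) + 1) → K
  moduleU := Module.compHom _ (simpleAction K p l).toRingHom
  tower := by
    let _ : Module (U K p) (Fin (2 * (l : ℕ) + 1) → K) :=
      Module.compHom _ (simpleAction K p l).toRingHom
    refine ⟨fun c u m => ?_⟩
    change simpleAction K p l (c • u) m = c • simpleAction K p l u m
    rw [map_smul, LinearMap.smul_apply]
  part i := simplePart (l : ℕ) i
  isCompl := simplePart_isCompl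
  gen_smul_mem := by
    intro i j x m hm
    change simpleAction K p l (gen K p (toOsp x)) m ∈ _
    rw [simpleAction_gen]
    exact simpleRho_mem x hm

end Simple

end OspSuper

end

noncomputable section

namespace OspSuper

/-! ### Identities in rings with elements `E`, `F`, `H` -/

section Identities

variable {A : Type*} [Ring A] {E F H : A}

/-! The algebra is generated by $E$ and $F$, since $e=E^2$, $f=-F^2$ and $h=EF+FE$; moreover
$[h,E]=E$, $[h,F]=-F$, $h^p=h$ and $E^{2p}=F^{2p}=0$. Everything is read off from strings $F^iv$ and
$E^im$.

If $Ev=0$ and $hv=av$, then $EF^{i+1}v=c_iF^iv$ with $c_{2j}=a-j$ and $c_{2j+1}=-(j+1)$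
(`uE_smul_uF_pow`). For $a=l$ and $i<2p-1$ the only zero is $c_{2l}$ (`hwCoeff_ne_zero`). Hence
$L(l)$ is simple, and $F^{2l+1}v$ is always singular, of weight $-l-1=p-l-1$. Every nonzero
supermodule has a homogeneous singular weight vector with weight in the prime field
(`exists_highest_weight_vector`). In a simple module $F^{2l+1}v$ must vanish, as otherwise the
module would be spanned by the $F^iF^{2l+1}v$ and the nilpotent $F$ would be surjective; so the
module is $L(l)$. Dimensions separate the $L(l)$.

In $Z(l)$ the string of the generator spans, and $F^{2l+1}v$ generates a copy of $L(p-l-1)$ with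
quotient $L(l)$. That the string has full length $2p$ is checked without a PBW theorem: an explicit
$4p$-dimensional representation `bigRep`, an extension of one baby Verma module by another, detects
the relevant elements.

The cover of $L(l)$ is $P(l)=U_0/(h-l,\,EFE)$. For $m$ of weight $l$, $F$ can be moved through
powers of $E$ at the cost of polynomials in $FE$ (`uF_smul_uE_pow`). Applied to $F^{2p-1}E^{2p}m=0$,
this gives $E\cdot q(FE)m=0$ with $q=-X(X^{p-1}-1)^2$ (`prod_lwPoly`). So $((FE)^{p-1}-1)^2m$ is
always annihilated by $EFE$, while the same operator fixes vectors already annihilated by $EFE$.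
Together with the projection to weight $l$ this lifts generators, so $P(l)$ is projective. In $P(l)$
the string $E^kg$ of the generator $g$ ends at $k=2(p-l-1)+1$ in a singular vector that generates
$Z(p-l-1)$, and the quotient is $Z(l)$. The kernel of $P(l)\to L(l)$ is superfluous because the even
part of weight $l$ is spanned by $g$ and $FEg$, with $(FE)^2g=0$. Uniqueness of projective covers
carries the filtration to every cover. -/

theorem E_mul_F_sq (hH : H = E * F + F * E) (hF : H * F - F * H = -F) :
    E * F ^ 2 = F ^ 2 * E - F := by
  have : E * F ^ 2 - F ^ 2 * E = H * F - F * H := by rw [hH]; noncomm_ring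
  rw [hF] at this
  rw [sub_eq_iff_eq_add.1 this]; abel

theorem F_mul_E_sq (hH : H = E * F + F * E) (hE : H * E - E * H = E) :
    F * E ^ 2 = E ^ 2 * F + E := by
  have : F * E ^ 2 - E ^ 2 * F = H * E - E * H := by rw [hH]; noncomm_ring
  rw [hE] at this
  rw [sub_eq_iff_eq_add.1 this]; abel

/-- Since $[E,F^2]=-F$ commutes with $F^2$, each further factor $F^2$ contributes the same
correction, and the coefficient grows linearly. -/
theorem E_mul_F_pow_even (hH : H = E * F + F * E) (hF : H * F - F * H = -F) (j : ℕ) :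
    E * F ^ (2 * (j + 1)) = F ^ (2 * (j + 1)) * E - (j + 1 : A) * F ^ (2 * j + 1) := by
  have h2 := E_mul_F_sq hH hF
  induction j with
  | zero => simpa using h2
  | succ j ih =>
    rw [show 2 * (j + 1 + 1) = 2 * (j + 1) + 2 by ring, pow_add, ← mul_assoc, ih, sub_mul,
      mul_assoc, h2, show 2 * (j + 1) + 1 = 2 * j + 1 + 2 by ring, mul_sub, ← mul_assoc,
      mul_assoc _ _ (F ^ 2), ← pow_add, ← pow_add, ← pow_succ]
    push_cast
    rw [show 2 * (j + 1) + 1 = 2 * j + 1 + 2 by ring]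
    noncomm_ring

/-- The mirror image of the previous identity. In characteristic $p$ the correction vanishes for
$j+1=p$, so $E^{2p}$ commutes with $F$; this is how nilpotency of $E$ is checked in the concrete
module. -/
theorem F_mul_E_pow_even (hH : H = E * F + F * E) (hE : H * E - E * H = E) (j : ℕ) :
    F * E ^ (2 * (j + 1)) = E ^ (2 * (j + 1)) * F + (j + 1 : A) * E ^ (2 * j + 1) := by
  have h2 := F_mul_E_sq hH hE
  induction j with
  | zero => simpa using h2
  | succ j ih =>
    rw [show 2 * (j + 1 + 1) = 2 * (j + 1) + 2 by ring, pow_add, ← mul_assoc, ih, add_mul,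
      mul_assoc, h2, show 2 * (j + 1) + 1 = 2 * j + 1 + 2 by ring, mul_add, ← mul_assoc,
      mul_assoc _ _ (E ^ 2), ← pow_add, ← pow_add, ← pow_succ]
    push_cast
    rw [show 2 * (j + 1) + 1 = 2 * j + 1 + 2 by ring]
    noncomm_ring

theorem H_mul_F_pow (hF : H * F - F * H = -F) (i : ℕ) :
    H * F ^ i = F ^ i * H - (i : A) * F ^ i := by
  induction i with
  | zero => simp
  | succ i ih =>
    have h1 : H * F = F * H - F := by rw [sub_eq_iff_eq_add.1 hF]; abel
    rw [pow_succ, ← mul_assoc, ih, sub_mul, mul_assoc, h1]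
    push_cast
    noncomm_ring

theorem H_mul_E_pow (hE : H * E - E * H = E) (i : ℕ) :
    H * E ^ i = E ^ i * H + (i : A) * E ^ i := by
  induction i with
  | zero => simp
  | succ i ih =>
    have h1 : H * E = E * H + E := by rw [sub_eq_iff_eq_add.1 hE]; abel
    rw [pow_succ, ← mul_assoc, ih, add_mul, mul_assoc, h1]
    push_cast
    noncomm_ring

end Identities

/-! ### Elements of the prime field -/

section PrimeField

variable (K : Type u) [Field K] (p : ℕ) [CharP K p]

-- Both sides are monic of degree $p$ and vanish at the $p$ distinct elements $0,\dots,p-1$, so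
-- their difference has too many roots for its degree.
open Polynomial in
theorem prod_X_sub_natCast [Fact p.Prime] :
    ∏ i ∈ Finset.range p, (X - C (i : K)) = X ^ p - X := by
  classical
  have hp : p.Prime := Fact.out
  have hm : (X ^ p - X : K[X]).Monic := by
    apply monic_X_pow_sub
    rw [degree_X]; exact_mod_cast hp.one_lt
  have hinj : Set.InjOn (fun i : ℕ => (i : K)) (Finset.range p) := by
    intro a ha b hb hab
    exact CharP.natCast_injOn_Iio K p (by simpa using ha) (by simpa using hb) hab
  have hprod : (∏ i ∈ Finset.range p, (X - C (i : K))).Monic :=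
    monic_prod_of_monic _ _ fun i _ => monic_X_sub_C _
  refine eq_of_degree_sub_lt_of_eval_finset_eq ((Finset.range p).image fun i : ℕ => (i : K)) ?_ ?_
  · rw [Finset.card_image_of_injOn hinj, Finset.card_range]
    have hd1 : (∏ i ∈ Finset.range p, (X - C (i : K))).degree = (p : WithBot ℕ) := by
      simp_rw [degree_prod, degree_X_sub_C]; simp
    have hd2 : (X ^ p - X : K[X]).degree = (p : WithBot ℕ) := by
      rw [degree_sub_eq_left_of_degree_lt, degree_X_pow]
      rw [degree_X_pow, degree_X]; exact_mod_cast hp.one_lt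
    rw [← hd1]
    refine degree_sub_lt_left (hd1.trans hd2.symm) hprod.ne_zero ?_
    rw [hprod.leadingCoeff, hm.leadingCoeff]
  · intro x hx
    obtain ⟨i, hi, rfl⟩ := Finset.mem_image.1 hx
    rw [eval_prod, Finset.prod_eq_zero hi (by simp)]
    have : ((i : K)) ^ p = i := map_natCast (frobenius K p) i
    simp [this]

variable {K p}

theorem natCast_ne_zero_of_lt {i : ℕ} (h0 : 0 < i) (h : i < p) : (i : K) ≠ 0 := by
  rw [Ne, CharP.cast_eq_zero_iff K p]
  exact fun hd => absurd (Nat.le_of_dvd h0 hd) (by omega)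

theorem natCast_sub_ne_zero {i j : ℕ} (hi : i < p) (hj : j < p) (h : i ≠ j) :
    (i : K) - j ≠ 0 := by
  rw [sub_ne_zero]
  exact fun hij => h (CharP.natCast_injOn_Iio K p hi hj hij)

/-- In $K$ the reflected weight $p-l-1$ is $-l-1$, which is $l-(2l+1)$, the weight of the singular
vector $F^{2l+1}v$. -/
theorem natCast_rev (l : Fin p) : ((Fin.rev l : ℕ) : K) = -l - 1 := by
  have h : ((Fin.rev l : ℕ) : K) + (l + 1 : ℕ) = 0 := by
    rw [← Nat.cast_add, Fin.val_rev, Nat.sub_add_cancel l.2, CharP.cast_eq_zero]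
  push_cast at h
  linear_combination h

end PrimeField

/-! ### Generators and relations of `U_0(osp(1|2))` -/

section Generators

theorem half_ne_zero_of_fact (p : ℕ) [Fact (2 < p)] : p / 2 ≠ 0 := by
  have : 2 < p := Fact.out
  omega

variable (K : Type u) [Field K] (p : ℕ) [Fact p.Prime] [Fact (2 < p)]

/-- The even generator `h` of `U_0(osp(1|2))`. -/
def uH : U K p := gen K p (toOsp (hEl K))

/-- The odd generator `E` of `U_0(osp(1|2))`. -/
def uE : U K p := gen K p (toOsp (oddE K))

/-- The odd generator `F` of `U_0(osp(1|2))`. -/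
def uF : U K p := gen K p (toOsp (oddF K))

theorem osp_eq (x : osp K) :
    x = x.1 1 1 • toOsp (hEl K) + x.1 1 2 • toOsp (eEl K) + x.1 2 1 • toOsp (fEl K) +
      x.1 0 2 • toOsp (oddE K) + x.1 0 1 • toOsp (oddF K) := by
  obtain ⟨x, hx⟩ := x
  rw [mem_osp] at hx
  obtain ⟨h1, h2, h3, h4⟩ := hx
  apply Subtype.ext
  ext r s
  fin_cases r <;> fin_cases s <;> simp [toOsp, hEl, eEl, fEl, oddE, oddF, h1, h2, h3, h4]

theorem uH_eq : uH K p = uE K p * uF K p + uF K p * uE K p := by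
  have h := gen_bracket p (oddE K) (oddF K)
  have e : superbracket (oddE K) (oddF K) = toOsp (hEl K) := by
    apply Subtype.ext
    ext r s
    fin_cases r <;> fin_cases s <;>
      simp [superbracket, toOsp, hEl, oddE, oddF, ZMod.val_one]
  rw [e, ZMod.val_one, mul_one, pow_one, neg_one_smul, sub_neg_eq_add] at h
  exact h.symm

theorem uH_uE : uH K p * uE K p - uE K p * uH K p = uE K p := by
  have h := gen_bracket p (hEl K) (oddE K)
  have e : superbracket (hEl K) (oddE K) = toOsp (oddE K) := by
    apply Subtype.ext
    ext r s
    fin_cases r <;> fin_cases s <;>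
      simp [superbracket, toOsp, hEl, oddE]
  rw [e, ZMod.val_zero, zero_mul, pow_zero, one_smul] at h
  exact h

theorem uH_uF : uH K p * uF K p - uF K p * uH K p = -uF K p := by
  have h := gen_bracket p (hEl K) (oddF K)
  have e : superbracket (hEl K) (oddF K) = -toOsp (oddF K) := by
    apply Subtype.ext
    ext r s
    fin_cases r <;> fin_cases s <;>
      simp [superbracket, toOsp, hEl, oddF]
  rw [e, ZMod.val_zero, zero_mul, pow_zero, one_smul, map_neg] at h
  exact h

theorem pMap_coe (y : ospPart K 0) :
    (pMap p y).1 = (y.1 1 1 ^ 2 + y.1 1 2 * y.1 2 1) ^ (p / 2) • y.1 := by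
  rw [← even_pow y.2, Nat.two_mul_div_two_add_one_of_odd (odd_of_fact p)]
  rfl

theorem uH_pow : uH K p ^ p = uH K p := by
  have : pMap p (hEl K) = hEl K := by
    apply Subtype.ext
    rw [pMap_coe]
    simp [hEl]
  rw [uH, gen_pow, this]

variable [CharP K p]

theorem gen_eEl : gen K p (toOsp (eEl K)) = uE K p * uE K p := by
  have h := gen_bracket p (oddE K) (oddE K)
  have e : superbracket (oddE K) (oddE K) = (2 : K) • toOsp (eEl K) := by
    apply Subtype.ext
    ext r s
    fin_cases r <;> fin_cases s <;>
      simp [superbracket, toOsp, eEl, oddE, ZMod.val_one,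
        one_add_one_eq_two]
  rw [e, ZMod.val_one, mul_one, pow_one, neg_one_smul, sub_neg_eq_add, map_smul, ← two_smul K] at h
  exact (smul_right_injective _ (two_ne_zero_of_fact K p) h).symm

theorem gen_fEl : gen K p (toOsp (fEl K)) = -(uF K p * uF K p) := by
  have h := gen_bracket p (oddF K) (oddF K)
  have e : superbracket (oddF K) (oddF K) = (-2 : K) • toOsp (fEl K) := by
    apply Subtype.ext
    ext r s
    fin_cases r <;> fin_cases s <;>
      simp [superbracket, toOsp, fEl, oddF, ZMod.val_one]
    ring
  rw [e, ZMod.val_one, mul_one, pow_one, neg_one_smul, sub_neg_eq_add, map_smul, ← two_smul K,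
    neg_smul, ← smul_neg] at h
  rw [← neg_eq_iff_eq_neg]
  exact (smul_right_injective _ (two_ne_zero_of_fact K p) h).symm

variable {K} in
theorem gen_eq (x : osp K) :
    gen K p x = x.1 1 1 • uH K p + x.1 1 2 • (uE K p * uE K p) +
      x.1 2 1 • -(uF K p * uF K p) + x.1 0 2 • uE K p + x.1 0 1 • uF K p := by
  conv_lhs => rw [osp_eq K x]
  rw [← gen_eEl, ← gen_fEl]
  simp only [map_add, map_smul]
  rfl

theorem uE_pow : uE K p ^ (2 * p) = 0 := by
  have : pMap p (eEl K) = 0 := by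
    apply Subtype.ext
    rw [pMap_coe]
    simp [eEl, half_ne_zero_of_fact p]
  rw [pow_mul, pow_two, ← gen_eEl, gen_pow, this]
  exact map_zero (gen K p)

theorem uF_pow : uF K p ^ (2 * p) = 0 := by
  have : pMap p (fEl K) = 0 := by
    apply Subtype.ext
    rw [pMap_coe]
    simp [fEl, half_ne_zero_of_fact p]
  have h : gen K p (toOsp (fEl K)) ^ p = 0 := by
    rw [gen_pow, this]
    exact map_zero (gen K p)
  rw [gen_fEl, ← pow_two, (odd_of_fact p).neg_pow, ← pow_mul] at h
  exact neg_eq_zero.1 h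

variable {K p}

/-- The algebra `U_0(osp(1|2))` is generated by `E` and `F`. -/
theorem U_induction {C : U K p → Prop} (hc : ∀ c, C (algebraMap K (U K p) c))
    (hE : C (uE K p)) (hF : C (uF K p)) (hadd : ∀ a b, C a → C b → C (a + b))
    (hmul : ∀ a b, C a → C b → C (a * b)) (u : U K p) : C u := by
  have hs : ∀ (c : K) (a : U K p), C a → C (c • a) := fun c a ha => by
    rw [Algebra.smul_def]; exact hmul _ _ (hc c) ha
  obtain ⟨t, rfl⟩ := RingQuot.mkAlgHom_surjective K (Rel K p) u
  change C (mkU K p t)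
  induction t using TensorAlgebra.induction with
  | algebraMap r => rw [AlgHom.commutes]; exact hc r
  | ι x =>
    rw [mkU_ι, gen_eq, uH_eq, ← neg_one_smul K (uF K p * uF K p)]
    exact hadd _ _ (hadd _ _ (hadd _ _ (hadd _ _ (hs _ _ (hadd _ _ (hmul _ _ hE hF)
      (hmul _ _ hF hE))) (hs _ _ (hmul _ _ hE hE))) (hs _ _ (hs _ _ (hmul _ _ hF hF))))
      (hs _ _ hE)) (hs _ _ hF)
  | mul a b ha hb => rw [map_mul]; exact hmul _ _ ha hb
  | add a b ha hb => rw [map_add]; exact hadd _ _ ha hb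

/-! ### Submodules and homomorphisms tested on the two generators -/

section Module

variable {M N : Type*} [AddCommGroup M] [Module K M] [Module (U K p) M] [IsScalarTower K (U K p) M]
  [AddCommGroup N] [Module K N] [Module (U K p) N] [IsScalarTower K (U K p) N]

/-- A subspace stable under `E` and `F`, as a submodule. -/
def stableSubmodule (S : Submodule K M) (hE : ∀ m ∈ S, uE K p • m ∈ S)
    (hF : ∀ m ∈ S, uF K p • m ∈ S) : Submodule (U K p) M where
  carrier := S
  add_mem' := S.add_mem
  zero_mem' := S.zero_mem
  smul_mem' u := by
    induction u using U_induction with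
    | hc c => intro m hm; rw [algebraMap_smul]; exact S.smul_mem c hm
    | hE => exact fun {m} hm => hE m hm
    | hF => exact fun {m} hm => hF m hm
    | hadd a b ha hb => intro m hm; rw [add_smul]; exact S.add_mem (ha hm) (hb hm)
    | hmul a b ha hb => intro m hm; rw [mul_smul]; exact ha (hb hm)

/-- A linear map commuting with `E` and `F`, as a homomorphism of modules. -/
def homOfCommute (φ : M →ₗ[K] N) (hE : ∀ m, φ (uE K p • m) = uE K p • φ m)
    (hF : ∀ m, φ (uF K p • m) = uF K p • φ m) : M →ₗ[U K p] N where
  toFun := φ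
  map_add' := map_add φ
  map_smul' u := by
    induction u using U_induction with
    | hc c => intro m; rw [RingHom.id_apply, algebraMap_smul, algebraMap_smul, map_smul]
    | hE => exact hE
    | hF => exact hF
    | hadd a b ha hb =>
      intro m
      have ha := ha m
      have hb := hb m
      rw [RingHom.id_apply] at *
      rw [add_smul, map_add, ha, hb, add_smul]
    | hmul a b ha hb =>
      intro m
      have ha := ha (b • m)
      have hb := hb m
      rw [RingHom.id_apply] at *
      rw [mul_smul, ha, hb, mul_smul]

end Module

end Generators

/-! ### Supermodules: homogeneous elements, quotients, filtrations -/

section Super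

variable {K : Type u} [Field K] {p : ℕ} [Fact p.Prime] [Fact (2 < p)]

theorem zmod_two_add_add (i : ZMod 2) : i + 1 + 1 = i := by revert i; decide

/-- Indexing the two components as $i$ and $i+1$ lets later arguments start from any parity without
a case distinction. -/
theorem SuperModule.exists_add (M : SuperModule K p) (i : ZMod 2) (m : M) :
    ∃ a ∈ M.part i, ∃ b ∈ M.part (i + 1), m = a + b := by
  have h : m ∈ M.part 0 ⊔ M.part 1 := by
    rw [codisjoint_iff.1 M.isCompl.codisjoint]; exact Submodule.mem_top
  obtain ⟨a, ha, b, hb, rfl⟩ := Submodule.mem_sup.1 h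
  rcases zmod_two_cases i with rfl | rfl
  · exact ⟨a, ha, b, by rwa [zero_add], rfl⟩
  · exact ⟨b, hb, a, by rwa [show (1 : ZMod 2) + 1 = 0 by decide], add_comm a b⟩

theorem SuperModule.eq_zero_of_mem (M : SuperModule K p) {i : ZMod 2} {m : M}
    (h0 : m ∈ M.part i) (h1 : m ∈ M.part (i + 1)) : m = 0 := by
  have h := Submodule.disjoint_def.1 M.isCompl.disjoint m
  rcases zmod_two_cases i with rfl | rfl
  · exact h h0 (by rwa [zero_add] at h1)
  · exact h (by rwa [show (1 : ZMod 2) + 1 = 0 by decide] at h1) h0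

theorem uH_smul_mem {M : SuperModule K p} {j : ZMod 2} {m : M} (hm : m ∈ M.part j) :
    uH K p • m ∈ M.part j := by
  have h := M.gen_smul_mem (hEl K) hm
  rwa [zero_add] at h

theorem uE_smul_mem {M : SuperModule K p} {j : ZMod 2} {m : M} (hm : m ∈ M.part j) :
    uE K p • m ∈ M.part (j + 1) := by
  rw [add_comm]; exact M.gen_smul_mem (oddE K) hm

theorem uF_smul_mem {M : SuperModule K p} {j : ZMod 2} {m : M} (hm : m ∈ M.part j) :
    uF K p • m ∈ M.part (j + 1) := by
  rw [add_comm]; exact M.gen_smul_mem (oddF K) hm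

theorem uE_pow_smul_mem {M : SuperModule K p} {j : ZMod 2} {m : M} (hm : m ∈ M.part j) (k : ℕ) :
    uE K p ^ k • m ∈ M.part (j + k) := by
  induction k with
  | zero => simpa using hm
  | succ k ih =>
    rw [pow_succ', mul_smul, Nat.cast_succ, ← add_assoc]
    exact uE_smul_mem ih

theorem uF_pow_smul_mem {M : SuperModule K p} {j : ZMod 2} {m : M} (hm : m ∈ M.part j) (k : ℕ) :
    uF K p ^ k • m ∈ M.part (j + k) := by
  induction k with
  | zero => simpa using hm
  | succ k ih =>
    rw [pow_succ', mul_smul, Nat.cast_succ, ← add_assoc]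
    exact uF_smul_mem ih

/-! ### Homogeneous maps: preimages, kernels, ranges, composition -/

section Maps

variable {M N : SuperModule K p} {c : ZMod 2} {φ : M →ₗ[U K p] N}

/-- The component of $x$ of the wrong parity has its image in both parts of the target, so the image
is zero; injectivity then removes the component. This makes inverses of homogeneous isomorphisms
homogeneous. -/
theorem IsHomogeneousMap.mem_of_map_mem (h : IsHomogeneousMap c φ) (hφ : Function.Injective φ)
    {i : ZMod 2} {x : M} (hx : φ x ∈ N.part (i + c)) : x ∈ M.part i := by
  obtain ⟨a, ha, b, hb, rfl⟩ := M.exists_add i x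
  have hb' : φ b = 0 := by
    refine N.eq_zero_of_mem (i := i + c) ?_ ?_
    · rw [map_add] at hx
      exact (Submodule.add_mem_iff_right _ (h i a ha)).1 hx
    · rw [add_right_comm]; exact h _ b hb
  rw [hφ (hb'.trans (map_zero φ).symm), add_zero]
  exact ha

theorem IsHomogeneousMap.ker_isSuperSubmodule (h : IsHomogeneousMap c φ) :
    IsSuperSubmodule (LinearMap.ker φ) := by
  intro m hm
  obtain ⟨a, ha, b, hb, rfl⟩ := M.exists_add 0 m
  rw [zero_add] at hb
  rw [LinearMap.mem_ker, map_add] at hm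
  have ha' : φ a = 0 := by
    refine N.eq_zero_of_mem (i := 0 + c) (h _ a ha) ?_
    rw [eq_neg_of_add_eq_zero_left hm, zero_add, add_comm]
    exact Submodule.neg_mem _ (h _ b hb)
  refine ⟨a, ha, b, hb, ha', ?_, rfl⟩
  rwa [ha', zero_add] at hm

theorem IsHomogeneousMap.range_isSuperSubmodule (h : IsHomogeneousMap c φ) :
    IsSuperSubmodule (LinearMap.range φ) := by
  rintro _ ⟨m, rfl⟩
  obtain ⟨a, ha, b, hb, rfl⟩ := M.exists_add (-c) m
  have h1 := h _ a ha
  have h2 := h _ b hb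
  rw [neg_add_cancel] at h1
  rw [add_right_comm, neg_add_cancel, zero_add] at h2
  exact ⟨_, h1, _, h2, ⟨a, rfl⟩, ⟨b, rfl⟩, map_add φ a b⟩

theorem IsHomogeneousMap.comp {L : SuperModule K p} {d : ZMod 2} {ψ : N →ₗ[U K p] L}
    (hψ : IsHomogeneousMap d ψ) (hφ : IsHomogeneousMap c φ) :
    IsHomogeneousMap (c + d) (ψ ∘ₗ φ) := by
  intro i m hm
  rw [← add_assoc]
  exact hψ _ _ (hφ _ _ hm)

end Maps

theorem subquotientIso_of_surjective {M X : SuperModule K p} {N' N : Submodule (U K p) M}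
    (g : N →ₗ[U K p] X) (hg : Function.Surjective g) (hk : LinearMap.ker g = N'.submoduleOf N)
    (c : ZMod 2) (hc : ∀ (i : ZMod 2) (x : N), (x : M) ∈ M.part i → g x ∈ X.part (i + c)) :
    SubquotientIso N' N X :=
  ⟨(Submodule.quotEquivOfEq _ _ hk.symm).trans (g.quotKerEquivOfSurjective hg), c,
    fun i x hx => hc i x hx⟩

/-- A short exact sequence of homogeneous maps gives a filtration of length two. -/
theorem hasFiltration_of_exact {M X Y : SuperModule K p} {c d : ZMod 2} {ψ : X →ₗ[U K p] M}
    {φ : M →ₗ[U K p] Y} (hψ : IsHomogeneousMap c ψ) (hφ : IsHomogeneousMap d φ)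
    (hi : Function.Injective ψ) (hs : Function.Surjective φ)
    (he : LinearMap.range ψ = LinearMap.ker φ) : HasFiltration M ![X, Y] := by
  refine ⟨![⊥, LinearMap.range ψ, ⊤], ?_, rfl, rfl, ?_⟩
  · intro i
    fin_cases i
    · intro m hm
      rw [show m = 0 from hm]
      exact ⟨0, Submodule.zero_mem _, 0, Submodule.zero_mem _, Submodule.zero_mem _,
        Submodule.zero_mem _, (add_zero 0).symm⟩
    · exact hψ.range_isSuperSubmodule
    · intro m _
      obtain ⟨a, ha, b, hb, rfl⟩ := M.exists_add 0 m
      rw [zero_add] at hb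
      exact ⟨a, ha, b, hb, trivial, trivial, rfl⟩
  · rw [Fin.forall_fin_two]
    constructor
    · refine ⟨bot_le, ?_⟩
      change SubquotientIso ⊥ (LinearMap.range ψ) X
      refine subquotientIso_of_surjective
        ((LinearEquiv.ofInjective ψ hi).symm : LinearMap.range ψ →ₗ[U K p] X)
        (LinearEquiv.ofInjective ψ hi).symm.surjective ?_ c ?_
      · rw [LinearEquiv.ker, Submodule.submoduleOf, Submodule.comap_bot, Submodule.ker_subtype]
      · rintro i ⟨_, x, rfl⟩ hx
        have e : (LinearEquiv.ofInjective ψ hi).symm ⟨ψ x, x, rfl⟩ = x :=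
          (LinearEquiv.ofInjective ψ hi).symm_apply_apply x
        change (LinearEquiv.ofInjective ψ hi).symm ⟨ψ x, x, rfl⟩ ∈ _
        rw [e]
        refine hψ.mem_of_map_mem hi ?_
        -- The inverse of a map of parity $c$ has parity $-c$, which is $c$ in $\mathbb Z/2$.
        have h2 : i + c + c = i := by
          rcases zmod_two_cases c with rfl | rfl
          · simp
          · exact zmod_two_add_add i
        rwa [h2]
    · refine ⟨le_top, ?_⟩
      change SubquotientIso (LinearMap.range ψ) ⊤ Y
      refine subquotientIso_of_surjective (φ ∘ₗ (⊤ : Submodule (U K p) M).subtype) ?_ ?_ d ?_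
      · intro y
        obtain ⟨x, rfl⟩ := hs y
        exact ⟨⟨x, trivial⟩, rfl⟩
      · rw [he, LinearMap.ker_comp]
        rfl
      · exact fun i x hx => hφ i x hx

variable [CharP K p]

/-- The grading of $U_0$ is defined by eigenspaces, whereas homogeneity of the action is only known
on $\mathfrak g$. Induction over the generators writes $u=a+b$ with $a$, $b$ homogeneous and acting
with the right parities; as $2\neq0$, the eigenvalue equation then kills the component of the wrong
parity. -/
theorem uPart_smul_mem {M : SuperModule K p} {i j : ZMod 2} {u : U K p} (hu : u ∈ uPart K p i)
    {m : M} (hm : m ∈ M.part j) : u • m ∈ M.part (i + j) := by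
  have key : ∃ a ∈ uPart K p 0, ∃ b ∈ uPart K p 1, u = a + b ∧
      ∀ (j : ZMod 2) (m : M), m ∈ M.part j → a • m ∈ M.part j ∧ b • m ∈ M.part (j + 1) := by
    clear hu
    induction u using U_induction with
    | hc c =>
      refine ⟨_, ?_, 0, Submodule.zero_mem _, (add_zero _).symm, fun j m hm => ⟨?_, ?_⟩⟩
      · rw [mem_uPart, AlgHom.commutes, ZMod.val_zero, pow_zero, one_smul]
      · rw [algebraMap_smul]; exact Submodule.smul_mem _ _ hm
      · rw [zero_smul]; exact Submodule.zero_mem _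
    | hE =>
      refine ⟨0, Submodule.zero_mem _, _, gen_mem_uPart p (oddE K), (zero_add _).symm,
        fun j m hm => ⟨?_, uE_smul_mem hm⟩⟩
      rw [zero_smul]; exact Submodule.zero_mem _
    | hF =>
      refine ⟨0, Submodule.zero_mem _, _, gen_mem_uPart p (oddF K), (zero_add _).symm,
        fun j m hm => ⟨?_, uF_smul_mem hm⟩⟩
      rw [zero_smul]; exact Submodule.zero_mem _
    | hadd x y hx hy =>
      obtain ⟨a, ha, b, hb, rfl, h⟩ := hx
      obtain ⟨a', ha', b', hb', rfl, h'⟩ := hy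
      refine ⟨a + a', Submodule.add_mem _ ha ha', b + b', Submodule.add_mem _ hb hb', by abel,
        fun j m hm => ⟨?_, ?_⟩⟩
      · rw [add_smul]; exact Submodule.add_mem _ (h j m hm).1 (h' j m hm).1
      · rw [add_smul]; exact Submodule.add_mem _ (h j m hm).2 (h' j m hm).2
    | hmul x y hx hy =>
      obtain ⟨a, ha, b, hb, rfl, h⟩ := hx
      obtain ⟨a', ha', b', hb', rfl, h'⟩ := hy
      have h11 : (1 : ZMod 2) + 1 = 0 := by decide
      refine ⟨a * a' + b * b', Submodule.add_mem _ ?_ ?_, a * b' + b * a',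
        Submodule.add_mem _ ?_ ?_, by noncomm_ring, fun j m hm => ⟨?_, ?_⟩⟩
      · simpa using mul_mem_uPart ha ha'
      · simpa [h11] using mul_mem_uPart hb hb'
      · simpa using mul_mem_uPart ha hb'
      · simpa using mul_mem_uPart hb ha'
      · rw [add_smul, mul_smul, mul_smul]
        refine Submodule.add_mem _ (h _ _ (h' _ _ hm).1).1 ?_
        have := (h _ _ (h' _ _ hm).2).2
        rwa [zmod_two_add_add] at this
      · rw [add_smul, mul_smul, mul_smul]
        exact Submodule.add_mem _ (h _ _ (h' _ _ hm).2).1 (h _ _ (h' _ _ hm).1).2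
  obtain ⟨a, ha, b, hb, rfl, h⟩ := key
  have h2 : ∀ x : U K p, x + x = 0 → x = 0 := fun x hx => by
    rw [← two_smul K x] at hx
    exact (smul_eq_zero.1 hx).resolve_left (two_ne_zero_of_fact K p)
  rw [mem_uPart, map_add, mem_uPart.1 ha, mem_uPart.1 hb] at hu
  rcases zmod_two_cases i with rfl | rfl
  · simp only [ZMod.val_zero, pow_zero, one_smul, ZMod.val_one, pow_one, neg_smul] at hu
    have hb0 : b = 0 := h2 b (by
      have := add_left_cancel hu
      rw [neg_eq_iff_add_eq_zero] at this
      exact this)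
    rw [hb0, add_zero, zero_add]
    exact (h j m hm).1
  · simp only [ZMod.val_zero, pow_zero, one_smul, ZMod.val_one, pow_one, neg_smul, neg_add] at hu
    have ha0 : a = 0 := h2 a (by
      have := add_right_cancel hu
      exact eq_neg_iff_add_eq_zero.1 this)
    rw [ha0, zero_add, add_comm 1 j]
    exact (h j m hm).2

/-- The quotient of `U_0(osp(1|2))` by a left ideal stable under the parity automorphism. -/
def cyclicModule (J : Submodule (U K p) (U K p)) (hJ : ∀ u ∈ J, parityAut K p u ∈ J) :
    SuperModule K p where
  carrier := U K p ⧸ J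
  part i := (uPart K p i).map (J.mkQ.restrictScalars K)
  isCompl := by
    constructor
    · rw [Submodule.disjoint_def]
      rintro _ ⟨u, hu, rfl⟩ ⟨w, hw, h⟩
      have h1 : w - u ∈ J := by
        rw [← Submodule.Quotient.mk_eq_zero, Submodule.Quotient.mk_sub, sub_eq_zero]
        exact h
      have h2 := hJ _ h1
      rw [map_sub, mem_uPart.1 hu, mem_uPart.1 hw] at h2
      simp only [ZMod.val_zero, pow_zero, one_smul, ZMod.val_one, pow_one, neg_smul] at h2
      have h3 : (2 : K) • u ∈ J := by
        have := J.neg_mem (J.add_mem h1 h2)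
        have e : -(w - u + (-w - u)) = (2 : K) • u := by rw [two_smul]; abel
        rwa [e] at this
      have h4 : u ∈ J := by
        have := J.smul_mem (algebraMap K (U K p) 2⁻¹) h3
        rwa [algebraMap_smul, smul_smul, inv_mul_cancel₀ (two_ne_zero_of_fact K p), one_smul] at this
      exact (Submodule.Quotient.mk_eq_zero J).2 h4
    · rw [codisjoint_iff, eq_top_iff]
      rintro m -
      obtain ⟨u, rfl⟩ := J.mkQ_surjective m
      rw [← half_add_half K p u]
      rw [map_add]
      exact Submodule.add_mem_sup (Submodule.mem_map_of_mem (half_add_mem K p u))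
        (Submodule.mem_map_of_mem (half_sub_mem K p u))
  gen_smul_mem := by
    rintro i j x _ ⟨u, hu, rfl⟩
    exact ⟨gen K p (toOsp x) * u, mul_mem_uPart (gen_mem_uPart p x) hu, rfl⟩

/-! ### Generators and universal property of cyclic supermodules -/

section Cyclic

variable {J : Submodule (U K p) (U K p)} {hJ : ∀ u ∈ J, parityAut K p u ∈ J}

/-- The generator of a cyclic module. -/
def cyclicGen (J : Submodule (U K p) (U K p)) (hJ : ∀ u ∈ J, parityAut K p u ∈ J) :
    cyclicModule J hJ :=
  J.mkQ 1

theorem smul_cyclicGen (u : U K p) : u • cyclicGen J hJ = J.mkQ u := by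
  change u • J.mkQ 1 = _
  rw [← map_smul, smul_eq_mul, mul_one]

theorem exists_smul_cyclicGen (m : cyclicModule J hJ) : ∃ u : U K p, u • cyclicGen J hJ = m := by
  obtain ⟨u, hu⟩ := J.mkQ_surjective m
  exact ⟨u, (smul_cyclicGen u).trans hu⟩

theorem smul_cyclicGen_eq_zero {u : U K p} (hu : u ∈ J) : u • cyclicGen J hJ = 0 := by
  rw [smul_cyclicGen]
  exact (Submodule.Quotient.mk_eq_zero J).2 hu

theorem cyclicGen_mem : cyclicGen J hJ ∈ (cyclicModule J hJ).part 0 :=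
  ⟨1, mem_uPart.2 (by simp), rfl⟩

/-- The homomorphism from a cyclic module with prescribed image of the generator. -/
def cyclicHom (M : Type*) [AddCommGroup M] [Module (U K p) M] (m : M)
    (h : ∀ u ∈ J, u • m = 0) : cyclicModule J hJ →ₗ[U K p] M :=
  J.liftQ (LinearMap.toSpanSingleton (U K p) M m) h

theorem cyclicHom_smul {M : Type*} [AddCommGroup M] [Module (U K p) M] {m : M}
    (h : ∀ u ∈ J, u • m = 0) (u : U K p) :
    cyclicHom (hJ := hJ) M m h (u • cyclicGen J hJ) = u • m := by
  rw [smul_cyclicGen]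
  rfl

theorem cyclicHom_gen {M : Type*} [AddCommGroup M] [Module (U K p) M] {m : M}
    (h : ∀ u ∈ J, u • m = 0) : cyclicHom (hJ := hJ) M m h (cyclicGen J hJ) = m := by
  have := cyclicHom_smul (hJ := hJ) h 1
  rwa [one_smul, one_smul] at this

theorem cyclicHom_isHomogeneous {M : SuperModule K p} {m : M} {c : ZMod 2} (hm : m ∈ M.part c)
    (h : ∀ u ∈ J, u • m = 0) : IsHomogeneousMap c (cyclicHom (hJ := hJ) M m h) := by
  rintro i _ ⟨u, hu, rfl⟩
  exact uPart_smul_mem hu hm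

end Cyclic

end Super

/-! ### Strings of weight vectors -/

section Strings

section Coefficients

variable {K : Type u} [Field K]

/-- The coefficient of `F ^ i v` in `E F ^ (i + 1) v`, for a highest weight vector `v` of
weight `a`. -/
def hwCoeff (a : K) (i : ℕ) : K :=
  if Even i then a - (i / 2 : ℕ) else -((i / 2 : ℕ) + 1)

theorem hwCoeff_even (a : K) (j : ℕ) : hwCoeff a (2 * j) = a - j := by
  simp [hwCoeff]

theorem hwCoeff_odd (a : K) (j : ℕ) : hwCoeff a (2 * j + 1) = -(j + 1) := by
  have : (2 * j + 1) / 2 = j := by omega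
  simp [hwCoeff, this]

/-- Even indices give $l-j$ and odd ones $-(j+1)$; with $j<p$ and $j+1<p$ respectively, only $j=l$
in the even case gives zero. At $i=2p-1$ the odd coefficient would be $-p=0$, hence the strict
bound. -/
theorem hwCoeff_ne_zero {p : ℕ} [CharP K p] {l : ℕ} (hl : l < p) {i : ℕ} (hi : i < 2 * p - 1)
    (hne : i ≠ 2 * l) : hwCoeff (l : K) i ≠ 0 := by
  rcases Nat.even_or_odd' i with ⟨j, rfl | rfl⟩
  · rw [hwCoeff_even]
    exact natCast_sub_ne_zero hl (by omega : j < p) (by omega)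
  · rw [hwCoeff_odd, neg_ne_zero]
    exact_mod_cast natCast_ne_zero_of_lt (K := K) (p := p) (Nat.succ_pos j) (by omega)

end Coefficients

variable {K : Type u} [Field K] {p : ℕ} [Fact p.Prime] [Fact (2 < p)]
  {M : Type*} [AddCommGroup M] [Module K M] [Module (U K p) M]

/-- The span of the vectors `F ^ i v`. -/
def fString (v : M) : Submodule K M := Submodule.span K (Set.range fun i : ℕ => uF K p ^ i • v)

theorem uF_pow_smul_mem_fString (v : M) (i : ℕ) :
    uF K p ^ i • v ∈ fString (K := K) (p := p) v :=
  Submodule.subset_span ⟨i, rfl⟩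

theorem self_mem_fString (v : M) : v ∈ fString (K := K) (p := p) v := by
  simpa using uF_pow_smul_mem_fString (K := K) (p := p) v 0

theorem fString_le {v : M} {S : Submodule K M} (h : ∀ i, uF K p ^ i • v ∈ S) :
    fString (K := K) (p := p) v ≤ S :=
  Submodule.span_le.2 (by rintro _ ⟨i, rfl⟩; exact h i)

theorem exists_eq_smul_add {v m : M} (hm : m ∈ fString (K := K) (p := p) v) :
    ∃ c : K, ∃ y ∈ fString (K := K) (p := p) (uF K p • v), m = c • v + y := by
  have : fString (K := K) (p := p) v ≤ K ∙ v ⊔ fString (K := K) (p := p) (uF K p • v) := by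
    refine fString_le fun i => ?_
    cases i with
    | zero =>
      rw [pow_zero, one_smul]
      exact Submodule.mem_sup_left (Submodule.mem_span_singleton_self v)
    | succ i =>
      rw [pow_succ, mul_smul]
      exact Submodule.mem_sup_right (uF_pow_smul_mem_fString _ i)
  obtain ⟨_, h, y, hy, rfl⟩ := Submodule.mem_sup.1 (this hm)
  obtain ⟨c, rfl⟩ := Submodule.mem_span_singleton.1 h
  exact ⟨c, y, hy, rfl⟩

variable [IsScalarTower K (U K p) M]

theorem natCast_smul_eq (n : ℕ) (m : M) : (n : U K p) • m = (n : K) • m := by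
  rw [← map_natCast (algebraMap K (U K p)), algebraMap_smul]

theorem uH_smul_uF_pow {v : M} {a : K} (hH : uH K p • v = a • v) (i : ℕ) :
    uH K p • uF K p ^ i • v = (a - i) • uF K p ^ i • v := by
  rw [← mul_smul, H_mul_F_pow (uH_uF K p), sub_smul, mul_smul, mul_smul, hH, natCast_smul_eq,
    smul_comm, sub_smul]

theorem uH_smul_uE_pow {v : M} {a : K} (hH : uH K p • v = a • v) (i : ℕ) :
    uH K p • uE K p ^ i • v = (a + i) • uE K p ^ i • v := by
  rw [← mul_smul, H_mul_E_pow (uH_uE K p), add_smul, mul_smul, mul_smul, hH, natCast_smul_eq,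
    smul_comm, add_smul]

/-- An even power of $F$ is moved past $E$ by `E_mul_F_pow_even`. For an odd power one factor $F$
stays next to $v$ and contributes $EFv=hv=av$. -/
theorem uE_smul_uF_pow {v : M} {a : K} (hE : uE K p • v = 0) (hH : uH K p • v = a • v) (i : ℕ) :
    uE K p • uF K p ^ (i + 1) • v = hwCoeff a i • uF K p ^ i • v := by
  have hodd : ∀ j : ℕ, ∀ w : M, uE K p • uF K p ^ (2 * (j + 1)) • w =
      uF K p ^ (2 * (j + 1)) • uE K p • w - ((j : K) + 1) • uF K p ^ (2 * j + 1) • w := by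
    intro j w
    rw [← mul_smul, E_mul_F_pow_even (uH_eq K p) (uH_uF K p), sub_smul, mul_smul, mul_smul,
      ← Nat.cast_succ, natCast_smul_eq, Nat.cast_succ]
  have hEF : uE K p • uF K p • v = a • v := by
    have h := congrArg (· • v) (uH_eq K p)
    simp only [add_smul, mul_smul, hE, smul_zero, add_zero, hH] at h
    exact h.symm
  rcases Nat.even_or_odd' i with ⟨j, rfl | rfl⟩
  · rw [hwCoeff_even, pow_succ, mul_smul]
    cases j with
    | zero => simpa using hEF
    | succ j =>
      rw [hodd, hEF, ← mul_smul _ (uF K p), ← pow_succ,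
        smul_comm, Nat.cast_succ, show 2 * j + 1 + 1 = 2 * (j + 1) by ring, ← sub_smul]
  · rw [hwCoeff_odd, show 2 * j + 1 + 1 = 2 * (j + 1) by ring, hodd, hE, smul_zero, zero_sub,
      neg_smul]

theorem exists_uE_pow_smul_uF_pow {v : M} {a : K} (hE : uE K p • v = 0)
    (hH : uH K p • v = a • v) (k : ℕ) (hk : ∀ i < k, hwCoeff a i ≠ 0) :
    ∃ c : K, c ≠ 0 ∧ uE K p ^ k • uF K p ^ k • v = c • v := by
  induction k with
  | zero => exact ⟨1, one_ne_zero, by simp⟩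
  | succ k ih =>
    obtain ⟨c, hc, h⟩ := ih fun i hi => hk i (by omega)
    refine ⟨hwCoeff a k * c, mul_ne_zero (hk k (by omega)) hc, ?_⟩
    rw [pow_succ (uE K p), mul_smul, uE_smul_uF_pow hE hH, smul_comm, h, mul_smul]

theorem uF_smul_mem_fString {v m : M} (hm : m ∈ fString (K := K) (p := p) v) :
    uF K p • m ∈ fString (K := K) (p := p) v := by
  refine fString_le (S := (fString (K := K) (p := p) v).comap
    (Algebra.lsmul K K M (uF K p))) (fun i => ?_) hm
  change uF K p • uF K p ^ i • v ∈ fString (K := K) (p := p) v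
  rw [← mul_smul, ← pow_succ']
  exact uF_pow_smul_mem_fString v (i + 1)

theorem uE_smul_mem_fString {v m : M} {a : K} (hE : uE K p • v = 0) (hH : uH K p • v = a • v)
    (hm : m ∈ fString (K := K) (p := p) v) : uE K p • m ∈ fString (K := K) (p := p) v := by
  refine fString_le (S := (fString (K := K) (p := p) v).comap
    (Algebra.lsmul K K M (uE K p))) (fun i => ?_) hm
  change uE K p • uF K p ^ i • v ∈ fString (K := K) (p := p) v
  cases i with
  | zero => rw [pow_zero, one_smul, hE]; exact Submodule.zero_mem _
  | succ i =>
    rw [uE_smul_uF_pow hE hH]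
    exact Submodule.smul_mem _ _ (uF_pow_smul_mem_fString v i)

theorem uF_pow_smul_eq_zero {v m : M} {k : ℕ} (hv : uF K p ^ k • v = 0)
    (hm : m ∈ fString (K := K) (p := p) v) : uF K p ^ k • m = 0 := by
  refine fString_le (S := LinearMap.ker (Algebra.lsmul K K M (uF K p ^ k))) (fun i => ?_) hm
  change uF K p ^ k • uF K p ^ i • v = 0
  rw [← mul_smul, ← pow_add, add_comm, pow_add, mul_smul,
    hv, smul_zero]

/-- A lowest-term argument: if $F^jv$ is the first string vector with a nonzero coefficient $c$ in
$m$, then $F^{n-j}$ kills all later terms and leaves $cF^nv$. Linear independence of the string is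
not needed. -/
theorem exists_uF_pow_smul_eq {n : ℕ} {v m : M} (hv : uF K p ^ (n + 1) • v = 0)
    (hm : m ∈ fString (K := K) (p := p) v) (h0 : m ≠ 0) :
    ∃ (k : ℕ) (c : K), c ≠ 0 ∧ uF K p ^ k • m = c • uF K p ^ n • v := by
  induction n generalizing v m with
  | zero =>
    obtain ⟨c, y, hy, rfl⟩ := exists_eq_smul_add hm
    have hy0 : y = 0 := by
      have := uF_pow_smul_eq_zero (k := 0) (by simpa using hv) hy
      simpa using this
    subst hy0
    refine ⟨0, c, ?_, by simp⟩
    rintro rfl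
    simp at h0
  | succ n ih =>
    obtain ⟨c, y, hy, rfl⟩ := exists_eq_smul_add hm
    have hv' : uF K p ^ (n + 1) • uF K p • v = 0 := by rw [← mul_smul, ← pow_succ, hv]
    by_cases hc : c = 0
    · subst hc
      simp only [zero_smul, zero_add] at h0 ⊢
      obtain ⟨k, c, hc, h⟩ := ih hv' hy h0
      exact ⟨k, c, hc, by rw [h, ← mul_smul (uF K p ^ n), ← pow_succ]⟩
    · refine ⟨n + 1, c, hc, ?_⟩
      rw [smul_add, uF_pow_smul_eq_zero hv' hy, add_zero, smul_comm]

variable [CharP K p]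

/-- The submodule generated by a highest weight vector. -/
def hwSubmodule (v : M) (a : K) (hE : uE K p • v = 0) (hH : uH K p • v = a • v) :
    Submodule (U K p) M :=
  stableSubmodule (fString (K := K) (p := p) v) (fun _ h => uE_smul_mem_fString hE hH h)
    (fun _ h => uF_smul_mem_fString h)

end Strings

/-! ### The modules `L(l)` -/

section SimpleModules

variable {K : Type u} [Field K] {p : ℕ} [Fact p.Prime] [Fact (2 < p)] [CharP K p]

/-- The basis vector `v_i` of `L(l)`. -/
def simpleVec (K : Type u) [Field K] {p : ℕ} [Fact p.Prime] [Fact (2 < p)] [CharP K p]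
    (l : Fin p) (i : ℕ) : simpleModule K p l :=
  vec K (2 * (l : ℕ) + 1) i

theorem simpleVec_of_le {l : Fin p} {i : ℕ} (h : 2 * (l : ℕ) + 1 ≤ i) : simpleVec K l i = 0 :=
  vec_of_le h

theorem simpleVec_ne_zero {l : Fin p} {i : ℕ} (h : i < 2 * (l : ℕ) + 1) :
    simpleVec K l i ≠ 0 := by
  intro h0
  have h1 : vec K (2 * (l : ℕ) + 1) i ⟨i, h⟩ = 0 := congrFun h0 ⟨i, h⟩
  simp [vec] at h1

theorem simpleVec_mem (l : Fin p) (i : ℕ) : simpleVec K l i ∈ (simpleModule K p l).part i := by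
  change vec K (2 * (l : ℕ) + 1) i ∈ simplePart (l : ℕ) (i : ZMod 2)
  exact Submodule.subset_span ⟨i, rfl, rfl⟩

theorem gen_smul_simpleModule {l : Fin p} (x : osp K) (m : simpleModule K p l) :
    gen K p x • m = simpleRho K (l : ℕ) x m := by
  change simpleAction K p l (gen K p x) m = _
  rw [simpleAction_gen]

theorem uF_smul_simpleVec (l : Fin p) (i : ℕ) :
    uF K p • simpleVec K l i = simpleVec K l (i + 1) := by
  have : simpleRho K (l : ℕ) (toOsp (oddF K)) = opF K l := by
    simp [simpleRho, rho, toOsp, oddF]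
  rw [uF, gen_smul_simpleModule, this]
  exact opF_vec i

theorem uE_smul_simpleVec_zero (l : Fin p) : uE K p • simpleVec K l 0 = 0 := by
  have : simpleRho K (l : ℕ) (toOsp (oddE K)) = opE K l := by
    simp [simpleRho, rho, toOsp, oddE]
  rw [uE, gen_smul_simpleModule, this]
  refine (opE_vec 0).trans ?_
  simp
  rfl

theorem uH_smul_simpleVec_zero (l : Fin p) :
    uH K p • simpleVec K l 0 = ((l : ℕ) : K) • simpleVec K l 0 := by
  have : simpleRho K (l : ℕ) (toOsp (hEl K)) = opH K l := by
    simp [simpleRho, rho, toOsp, hEl]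
  rw [uH, gen_smul_simpleModule, this]
  refine (opH_vec 0).trans ?_
  simp [simpleVec]
  rfl

theorem uF_pow_smul_simpleVec (l : Fin p) (i : ℕ) :
    uF K p ^ i • simpleVec K l 0 = simpleVec K l i := by
  induction i with
  | zero => rw [pow_zero, one_smul]
  | succ i ih => rw [pow_succ', mul_smul, ih, uF_smul_simpleVec]

theorem simpleVec_ext {l : Fin p} {M : Type*} [AddCommGroup M] [Module K M]
    {S T : simpleModule K p l →ₗ[K] M} (h : ∀ i, S (simpleVec K l i) = T (simpleVec K l i)) :
    S = T := by
  refine LinearMap.pi_ext' fun i => LinearMap.ext_ring ?_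
  have e : Pi.single i (1 : K) = simpleVec K l i := by
    ext k
    simp [simpleVec, vec, Pi.single_apply, Fin.ext_iff]
  exact (congrArg S e).trans ((h i).trans (congrArg T e).symm)

theorem fString_simpleVec (l : Fin p) :
    fString (K := K) (p := p) (simpleVec K l 0) = ⊤ := by
  rw [← Submodule.ker_mkQ (fString (K := K) (p := p) (simpleVec K l 0)), LinearMap.ker_eq_top]
  refine simpleVec_ext fun i => ?_
  rw [LinearMap.zero_apply, ← LinearMap.mem_ker, Submodule.ker_mkQ, ← uF_pow_smul_simpleVec l i]
  exact uF_pow_smul_mem_fString (simpleVec K l 0) i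

theorem simpleModule_eq_top {l : Fin p} {N : Submodule (U K p) (simpleModule K p l)}
    (h : simpleVec K l 0 ∈ N) : N = ⊤ := by
  rw [eq_top_iff]
  rintro m -
  have hm : m ∈ fString (K := K) (p := p) (simpleVec K l 0) := by
    rw [fString_simpleVec]; exact Submodule.mem_top
  exact fString_le (K := K) (p := p) (v := simpleVec K l 0) (S := N.restrictScalars K)
    (fun i => N.smul_mem _ h) hm

theorem simpleModule_eq_bot_or_eq_top {l : Fin p} (N : Submodule (U K p) (simpleModule K p l)) :
    N = ⊥ ∨ N = ⊤ := by
  refine or_iff_not_imp_left.2 fun hN => simpleModule_eq_top ?_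
  obtain ⟨m, hm, h0⟩ := Submodule.exists_mem_ne_zero_of_ne_bot hN
  -- Any nonzero vector is pushed down to a multiple of the last vector $v_{2l}$ and then raised to
  -- $v_0$ by $E^{2l}$; the coefficients met on the way have index below $2l$, hence are nonzero.
  obtain ⟨k, c, hc, h⟩ := exists_uF_pow_smul_eq (K := K) (p := p) (n := 2 * (l : ℕ))
    (v := simpleVec K l 0) (by rw [uF_pow_smul_simpleVec, simpleVec_of_le le_rfl])
    (by rw [fString_simpleVec]; exact Submodule.mem_top) h0
  obtain ⟨d, hd, h'⟩ := exists_uE_pow_smul_uF_pow (uE_smul_simpleVec_zero l)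
    (uH_smul_simpleVec_zero l) (2 * (l : ℕ))
    fun i hi => hwCoeff_ne_zero (K := K) l.2 (by have := l.2; omega) (by omega)
  have h1 : uE K p ^ (2 * (l : ℕ)) • uF K p ^ k • m = (c * d) • simpleVec K l 0 := by
    rw [h, smul_comm, h', mul_smul]
  have h2 : (c * d) • simpleVec K l 0 ∈ N.restrictScalars K := by
    rw [← h1]
    exact N.smul_mem _ (N.smul_mem _ hm)
  exact (Submodule.smul_mem_iff _ (mul_ne_zero hc hd)).1 h2

theorem simpleModule_isSimple (l : Fin p) : (simpleModule K p l).IsSimple :=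
  ⟨⟨simpleVec K l 0, 0, simpleVec_ne_zero (Nat.succ_pos _)⟩,
    fun N _ => simpleModule_eq_bot_or_eq_top N⟩

theorem finrank_simpleModule (l : Fin p) :
    Module.finrank K (simpleModule K p l) = 2 * (l : ℕ) + 1 :=
  Module.finrank_fin_fun K

/-! ### Homomorphisms out of $L(l)$ -/

section SimpleHom

variable {M : Type*} [AddCommGroup M] [Module K M] [Module (U K p) M]

/-- The linear map sending `v_i` to `F ^ i v`. -/
def stringMap (l : Fin p) (v : M) : simpleModule K p l →ₗ[K] M :=
  Fintype.linearCombination K fun i : Fin (2 * (l : ℕ) + 1) => uF K p ^ (i : ℕ) • v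

theorem stringMap_simpleVec {l : Fin p} {v : M} {i : ℕ} (hi : i < 2 * (l : ℕ) + 1) :
    stringMap l v (simpleVec K l i) = uF K p ^ i • v := by
  rw [stringMap]
  refine (Fintype.linearCombination_apply K _ _).trans ?_
  rw [Finset.sum_eq_single ⟨i, hi⟩]
  · simp [simpleVec, vec]
  · intro b _ hb
    have : (b : ℕ) ≠ i := fun h => hb (Fin.ext h)
    simp [simpleVec, vec, this]
  · simp

variable [IsScalarTower K (U K p) M]

/-- The homomorphism from `L(l)` given by a highest weight vector `v` with `F ^ (2 l + 1) v = 0`. -/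
def simpleHom (l : Fin p) (v : M) (hE : uE K p • v = 0) (hH : uH K p • v = ((l : ℕ) : K) • v)
    (hF : uF K p ^ (2 * (l : ℕ) + 1) • v = 0) : simpleModule K p l →ₗ[U K p] M :=
  have hv : ∀ i, stringMap l v (simpleVec K l i) = uF K p ^ i • v := by
    intro i
    rcases Nat.lt_or_ge i (2 * (l : ℕ) + 1) with h | h
    · exact stringMap_simpleVec h
    · obtain ⟨k, rfl⟩ := Nat.exists_eq_add_of_le h
      rw [simpleVec_of_le h, map_zero, add_comm, pow_add, mul_smul, hF, smul_zero]
  homOfCommute (stringMap l v)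
    (by
      intro m
      refine LinearMap.congr_fun (f := stringMap l v ∘ₗ Algebra.lsmul K K _ (uE K p))
        (g := Algebra.lsmul K K _ (uE K p) ∘ₗ stringMap l v) (simpleVec_ext fun i => ?_) m
      simp only [LinearMap.comp_apply, Algebra.lsmul_coe, hv]
      cases i with
      | zero => rw [uE_smul_simpleVec_zero, map_zero, pow_zero, one_smul, hE]
      | succ i =>
        rw [← uF_pow_smul_simpleVec, uE_smul_uF_pow (uE_smul_simpleVec_zero l)
          (uH_smul_simpleVec_zero l), uE_smul_uF_pow hE hH, map_smul, uF_pow_smul_simpleVec, hv])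
    (by
      intro m
      refine LinearMap.congr_fun (f := stringMap l v ∘ₗ Algebra.lsmul K K _ (uF K p))
        (g := Algebra.lsmul K K _ (uF K p) ∘ₗ stringMap l v) (simpleVec_ext fun i => ?_) m
      simp only [LinearMap.comp_apply, Algebra.lsmul_coe, hv]
      rw [uF_smul_simpleVec, hv, pow_succ', mul_smul])

variable {l : Fin p} {v : M} {hE : uE K p • v = 0} {hH : uH K p • v = ((l : ℕ) : K) • v}
  {hF : uF K p ^ (2 * (l : ℕ) + 1) • v = 0}

theorem simpleHom_simpleVec (i : ℕ) :
    simpleHom l v hE hH hF (simpleVec K l i) = uF K p ^ i • v := by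
  have h0 : simpleHom l v hE hH hF (simpleVec K l 0) = v := by
    refine (stringMap_simpleVec (Nat.succ_pos _)).trans ?_
    rw [pow_zero, one_smul]
  rw [← uF_pow_smul_simpleVec, map_smul, h0]

theorem simpleHom_injective (hv : v ≠ 0) : Function.Injective (simpleHom l v hE hH hF) := by
  rw [← LinearMap.ker_eq_bot]
  refine (simpleModule_eq_bot_or_eq_top _).resolve_right fun h => hv ?_
  have h1 : simpleVec K l 0 ∈ LinearMap.ker (simpleHom l v hE hH hF) := by
    rw [h]; exact Submodule.mem_top
  rw [LinearMap.mem_ker, simpleHom_simpleVec, pow_zero, one_smul] at h1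
  exact h1

end SimpleHom

theorem simpleHom_isHomogeneous {M : SuperModule K p} {l : Fin p} {v : M} {c : ZMod 2}
    (hv : v ∈ M.part c) (hE : uE K p • v = 0) (hH : uH K p • v = ((l : ℕ) : K) • v)
    (hF : uF K p ^ (2 * (l : ℕ) + 1) • v = 0) :
    IsHomogeneousMap c (simpleHom l v hE hH hF) := by
  intro i m hm
  have hle : (simpleModule K p l).part i ≤
      (M.part (i + c)).comap ((simpleHom l v hE hH hF).restrictScalars K) := by
    refine Submodule.span_le.2 ?_
    rintro _ ⟨k, rfl, rfl⟩
    change simpleHom l v hE hH hF (simpleVec K l k) ∈ M.part (k + c)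
    rw [simpleHom_simpleVec, add_comm]
    exact uF_pow_smul_mem hv k
  exact hle hm

/-- The dimension $2l+1$ determines $l$. -/
theorem eq_of_superIso {l m : Fin p}
    (h : SuperIso (simpleModule K p l) (simpleModule K p m)) : l = m := by
  obtain ⟨φ, -⟩ := h
  have := (φ.restrictScalars K).finrank_eq
  rw [finrank_simpleModule, finrank_simpleModule] at this
  exact Fin.ext (by omega)

end SimpleModules

/-! ### Classification of the simple modules -/

section Classification

variable {K : Type u} [Field K] {p : ℕ} [Fact p.Prime] [Fact (2 < p)]

theorem uE_smul_uH_smul {M : Type*} [AddCommGroup M] [Module (U K p) M] (m : M) :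
    uE K p • uH K p • m = uH K p • uE K p • m - uE K p • m := by
  rw [← mul_smul, ← mul_smul, ← sub_smul]
  congr 1
  rw [eq_sub_iff_add_eq', ← eq_sub_iff_add_eq]
  exact (uH_uE K p).symm

/-- The coefficient with index $2l$ is $l-l$: this is the one place where a string of highest weight
$l$ breaks before its end. -/
theorem uE_smul_singular {M : Type*} [AddCommGroup M] [Module K M] [Module (U K p) M]
    [IsScalarTower K (U K p) M] {l : ℕ} {v : M} (hE : uE K p • v = 0)
    (hH : uH K p • v = (l : K) • v) : uE K p • uF K p ^ (2 * l + 1) • v = 0 := by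
  rw [uE_smul_uF_pow hE hH, hwCoeff_even, sub_self, zero_smul]

variable [CharP K p]

theorem exists_highest_weight_vector (M : SuperModule K p) [Nontrivial M] :
    ∃ (l : Fin p) (c : ZMod 2) (v : M), v ∈ M.part c ∧ v ≠ 0 ∧ uE K p • v = 0 ∧
      uH K p • v = ((l : ℕ) : K) • v := by
  obtain ⟨c, m, hm, h0⟩ : ∃ c, ∃ m ∈ M.part c, m ≠ 0 := by
    obtain ⟨m, hm⟩ := exists_ne (0 : M)
    obtain ⟨a, ha, b, hb, rfl⟩ := M.exists_add 0 m
    by_cases h : a = 0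
    · exact ⟨_, b, hb, fun h' => hm (by rw [h, h', add_zero])⟩
    · exact ⟨_, a, ha, h⟩
  classical
  -- The last nonzero $E^km$ is killed by $E$ and homogeneous, but need not yet be an eigenvector of
  -- $h$.
  have hex : ∃ k, uE K p ^ k • m = 0 := ⟨2 * p, by rw [uE_pow, zero_smul]⟩
  obtain ⟨k, hk⟩ : ∃ k, Nat.find hex = k + 1 := by
    refine Nat.exists_eq_succ_of_ne_zero fun h => h0 ?_
    have := Nat.find_spec hex
    rwa [h, pow_zero, one_smul] at this
  have hk1 : uE K p ^ (k + 1) • m = 0 := by rw [← hk]; exact Nat.find_spec hex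
  have hk0 : uE K p ^ k • m ≠ 0 := Nat.find_min hex (by omega)
  rw [pow_succ', mul_smul] at hk1
  have hkm := uE_pow_smul_mem hm k
  generalize uE K p ^ k • m = v at hk1 hk0 hkm
  generalize c + (k : ZMod 2) = d at hkm
  -- Here $w_k=(h-0)(h-1)\cdots(h-(k-1))v$. Since $h^p=h$, $w_p=0$, so the last nonzero $w_k$ is an
  -- eigenvector whose weight is the natural number $k<p$.
  let w : ℕ → M := fun k => Polynomial.aeval (uH K p)
    (∏ i ∈ Finset.range k, (Polynomial.X - Polynomial.C (i : K))) • v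
  have hw0 : w 0 = v := by simp [w]
  have hws : ∀ k, w (k + 1) = uH K p • w k - (k : K) • w k := by
    intro k
    simp only [w]
    rw [Finset.prod_range_succ, mul_comm, map_mul, mul_smul, map_sub, Polynomial.aeval_X,
      Polynomial.aeval_C, sub_smul, algebraMap_smul]
  have hwp : w p = 0 := by
    simp only [w]
    rw [prod_X_sub_natCast, map_sub, map_pow, Polynomial.aeval_X, uH_pow, sub_self, zero_smul]
  have hwm : ∀ k, w k ∈ M.part d ∧ uE K p • w k = 0 := by
    intro k
    induction k with
    | zero => rw [hw0]; exact ⟨hkm, hk1⟩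
    | succ k ih =>
      rw [hws]
      refine ⟨Submodule.sub_mem _ (uH_smul_mem ih.1) (Submodule.smul_mem _ _ ih.1), ?_⟩
      rw [smul_sub, uE_smul_uH_smul, ih.2, smul_zero, smul_comm, ih.2, smul_zero, sub_zero,
        sub_zero]
  have hex : ∃ k, w k = 0 := ⟨p, hwp⟩
  obtain ⟨k, hk⟩ : ∃ k, Nat.find hex = k + 1 := by
    refine Nat.exists_eq_succ_of_ne_zero fun h => hk0 ?_
    have := Nat.find_spec hex
    rwa [h, hw0] at this
  have hkp : k < p := by
    have := Nat.find_le (h := hex) hwp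
    omega
  have hk2 : w (k + 1) = 0 := by rw [← hk]; exact Nat.find_spec hex
  rw [hws, sub_eq_zero] at hk2
  exact ⟨⟨k, hkp⟩, d, w k, (hwm k).1, Nat.find_min hex (by omega), (hwm k).2, hk2⟩

theorem hwSubmodule_isSuperSubmodule {M : SuperModule K p} {v : M} {a : K} {c : ZMod 2}
    (hv : v ∈ M.part c) (hE : uE K p • v = 0) (hH : uH K p • v = a • v) :
    IsSuperSubmodule (hwSubmodule v a hE hH) := by
  intro m hm
  have hle : fString (K := K) (p := p) v ≤
      (fString (K := K) (p := p) v ⊓ M.part 0) ⊔ (fString (K := K) (p := p) v ⊓ M.part 1) := by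
    refine fString_le fun i => ?_
    have h1 := uF_pow_smul_mem_fString (K := K) (p := p) v i
    have h2 := uF_pow_smul_mem hv i
    rcases zmod_two_cases (c + i) with h | h <;> rw [h] at h2
    · exact Submodule.mem_sup_left ⟨h1, h2⟩
    · exact Submodule.mem_sup_right ⟨h1, h2⟩
  obtain ⟨a, ha, b, hb, rfl⟩ := Submodule.mem_sup.1 (hle hm)
  exact ⟨a, ha.2, b, hb.2, ha.1, hb.1, rfl⟩

theorem exists_superIso_simpleModule {M : SuperModule K p} (hM : M.IsSimple) :
    ∃ l : Fin p, SuperIso M (simpleModule K p l) := by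
  have := hM.1
  obtain ⟨l, c, v, hv, h0, hE, hH⟩ := exists_highest_weight_vector M
  have hF : uF K p ^ (2 * (l : ℕ) + 1) • v = 0 := by
    by_contra hne
    have hE' := uE_smul_singular hE hH
    have hH' := uH_smul_uF_pow hH (2 * (l : ℕ) + 1)
    -- If nonzero, the singular vector $F^{2l+1}v$ generates the simple module, so every vector is a
    -- combination of positive powers of $F$ applied to $v$. Then $F$ is surjective, which
    -- contradicts $F^{2p}=0$.
    have htop : hwSubmodule _ _ hE' hH' = ⊤ := by
      refine (hM.2 _ (hwSubmodule_isSuperSubmodule (uF_pow_smul_mem hv _) hE' hH')).resolve_left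
        fun hbot => hne ?_
      have : uF K p ^ (2 * (l : ℕ) + 1) • v ∈ hwSubmodule _ _ hE' hH' := self_mem_fString _
      rwa [hbot] at this
    have hrange : ∀ m : M, ∃ y : M, m = uF K p • y := by
      intro m
      have hm : m ∈ hwSubmodule _ _ hE' hH' := by rw [htop]; exact Submodule.mem_top
      have hle : fString (K := K) (p := p) (uF K p ^ (2 * (l : ℕ) + 1) • v) ≤
          LinearMap.range (Algebra.lsmul K K M (uF K p)) := by
        refine fString_le fun i => ⟨uF K p ^ (i + 2 * (l : ℕ)) • v, ?_⟩
        change uF K p • uF K p ^ (i + 2 * (l : ℕ)) • v = _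
        rw [← mul_smul, ← mul_smul, ← pow_add, ← pow_succ', add_assoc]
      obtain ⟨y, hy⟩ := hle hm
      exact ⟨y, hy.symm⟩
    have hpow : ∀ k : ℕ, ∃ y : M, v = uF K p ^ k • y := by
      intro k
      induction k with
      | zero => exact ⟨v, by rw [pow_zero, one_smul]⟩
      | succ k ih =>
        obtain ⟨y, hy⟩ := ih
        obtain ⟨z, hz⟩ := hrange y
        exact ⟨z, by rw [hy, hz, pow_succ, mul_smul]⟩
    obtain ⟨y, hy⟩ := hpow (2 * p)
    rw [uF_pow, zero_smul] at hy
    exact h0 hy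
  have hi := simpleHom_injective (hE := hE) (hH := hH) (hF := hF) h0
  have hom := simpleHom_isHomogeneous hv hE hH hF
  have hs : Function.Surjective (simpleHom l v hE hH hF) := by
    rw [← LinearMap.range_eq_top]
    refine (hM.2 _ hom.range_isSuperSubmodule).resolve_left fun hbot => h0 ?_
    have h1 : v ∈ LinearMap.range (simpleHom l v hE hH hF) :=
      ⟨simpleVec K l 0, by rw [simpleHom_simpleVec, pow_zero, one_smul]⟩
    rwa [hbot] at h1
  refine ⟨l, (LinearEquiv.ofBijective _ ⟨hi, hs⟩).symm, c, fun i m hm => ?_⟩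
  refine hom.mem_of_map_mem hi ?_
  have e : simpleHom l v hE hH hF ((LinearEquiv.ofBijective _ ⟨hi, hs⟩).symm m) = m :=
    LinearEquiv.apply_symm_apply (LinearEquiv.ofBijective _ ⟨hi, hs⟩) m
  have h2 : i + c + c = i := by
    rcases zmod_two_cases c with rfl | rfl
    · simp
    · exact zmod_two_add_add i
  rw [h2]
  exact e.symm ▸ hm

end Classification

/-! ### A concrete module of dimension `4 p` -/

section Concrete

variable (K : Type u) [Field K] (p : ℕ)

/-- The vectors `x_i` of the concrete module. -/
def vecX (i : ℕ) : (Fin (2 * p) → K) × (Fin (2 * p) → K) := (vec K _ i, 0)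

/-- The vectors `y_i` of the concrete module. -/
def vecY (i : ℕ) : (Fin (2 * p) → K) × (Fin (2 * p) → K) := (0, vec K _ i)

/-- The operator `v_i ↦ v_(i+1)`. -/
def opUp : Module.End K (Fin (2 * p) → K) := shiftOp K _ (fun _ => 1) (fun i => i + 1)

/-- The operator `v_i ↦ (a - i) v_i`. -/
def opDiag (a : K) : Module.End K (Fin (2 * p) → K) :=
  shiftOp K _ (fun i => a - i) (fun i => i)

/-- The action of `E` on a baby Verma module of highest weight `a`. -/
def opDown (a : K) : Module.End K (Fin (2 * p) → K) :=
  shiftOp K _ (fun i => if i = 0 then 0 else hwCoeff a (i - 1)) (fun i => i - 1)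

/-- The operator `v_i ↦ (-1) ^ i v_(s+i)`. -/
def opLink (s : ℕ) : Module.End K (Fin (2 * p) → K) :=
  shiftOp K _ (fun i => (-1) ^ i) (fun i => s + i)

/-- The action of `F` on the concrete module. -/
def bigF : Module.End K ((Fin (2 * p) → K) × (Fin (2 * p) → K)) :=
  LinearMap.prodMap (opUp K p) (opUp K p)

/-- The action of `h` on the concrete module. -/
def bigH (a b : K) : Module.End K ((Fin (2 * p) → K) × (Fin (2 * p) → K)) :=
  LinearMap.prodMap (opDiag K p a) (opDiag K p b)

/-- The action of `E` on the concrete module. -/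
def bigE (a b : K) (s : ℕ) : Module.End K ((Fin (2 * p) → K) × (Fin (2 * p) → K)) :=
  LinearMap.prodMap (opDown K p a) (opDown K p b) +
    LinearMap.inr K _ _ ∘ₗ opLink K p s ∘ₗ LinearMap.fst K _ _

variable {K p}

theorem end_prod_ext {S T : Module.End K ((Fin (2 * p) → K) × (Fin (2 * p) → K))}
    (hX : ∀ i, S (vecX K p i) = T (vecX K p i)) (hY : ∀ i, S (vecY K p i) = T (vecY K p i)) :
    S = T := by
  have e : ∀ i : Fin (2 * p), Pi.single i (1 : K) = vec K _ i := by
    intro i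
    ext k
    simp [vec, Pi.single_apply, Fin.ext_iff]
  refine LinearMap.prod_ext ?_ ?_ <;> refine LinearMap.pi_ext' fun i => LinearMap.ext_ring ?_
  · simpa [e, vecX] using hX i
  · simpa [e, vecY] using hY i

theorem bigF_vecX (i : ℕ) : bigF K p (vecX K p i) = vecX K p (i + 1) := by
  have : opUp K p (vec K _ i) = vec K _ (i + 1) := by
    rw [← one_smul K (vec K _ (i + 1))]
    exact shiftOp_vec (fun i hi => by rw [vec_of_le (by omega), smul_zero]) i
  simp [bigF, vecX, this]

theorem bigF_vecY (i : ℕ) : bigF K p (vecY K p i) = vecY K p (i + 1) := by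
  have : opUp K p (vec K _ i) = vec K _ (i + 1) := by
    rw [← one_smul K (vec K _ (i + 1))]
    exact shiftOp_vec (fun i hi => by rw [vec_of_le (by omega), smul_zero]) i
  simp [bigF, vecY, this]

theorem opDiag_vec (a : K) (i : ℕ) : opDiag K p a (vec K _ i) = (a - i) • vec K _ i :=
  shiftOp_vec (fun i hi => by rw [vec_of_le hi, smul_zero]) i

theorem bigH_vecX (a b : K) (i : ℕ) : bigH K p a b (vecX K p i) = (a - i) • vecX K p i := by
  simp [bigH, vecX, opDiag_vec]

theorem bigH_vecY (a b : K) (i : ℕ) : bigH K p a b (vecY K p i) = (b - i) • vecY K p i := by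
  simp [bigH, vecY, opDiag_vec]

theorem vecX_of_le {i : ℕ} (h : 2 * p ≤ i) : vecX K p i = 0 := by
  rw [vecX, vec_of_le h]; rfl

theorem vecY_of_le {i : ℕ} (h : 2 * p ≤ i) : vecY K p i = 0 := by
  rw [vecY, vec_of_le h]; rfl

theorem vecY_ne_zero {i : ℕ} (h : i < 2 * p) : vecY K p i ≠ 0 := by
  intro h0
  have h1 : vec K (2 * p) i ⟨i, h⟩ = 0 := congrFun (congrArg Prod.snd h0) ⟨i, h⟩
  simp [vec] at h1

theorem opLink_vec (s i : ℕ) : opLink K p s (vec K _ i) = (-1 : K) ^ i • vec K _ (s + i) :=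
  shiftOp_vec (fun i hi => by rw [vec_of_le (by omega), smul_zero]) i

theorem bigF_pow_vecX (k i : ℕ) : (bigF K p ^ k) (vecX K p i) = vecX K p (i + k) := by
  induction k generalizing i with
  | zero => simp
  | succ k ih => rw [pow_succ, Module.End.mul_apply, bigF_vecX, ih, add_right_comm, add_assoc]

theorem bigF_pow_vecY (k i : ℕ) : (bigF K p ^ k) (vecY K p i) = vecY K p (i + k) := by
  induction k generalizing i with
  | zero => simp
  | succ k ih => rw [pow_succ, Module.End.mul_apply, bigF_vecY, ih, add_right_comm, add_assoc]

theorem bigF_pow : bigF K p ^ (2 * p) = 0 :=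
  end_prod_ext (fun i => by rw [bigF_pow_vecX, vecX_of_le (by omega), LinearMap.zero_apply])
    (fun i => by rw [bigF_pow_vecY, vecY_of_le (by omega), LinearMap.zero_apply])

theorem bigH_bigF (a b : K) :
    bigH K p a b * bigF K p - bigF K p * bigH K p a b = -bigF K p := by
  refine end_prod_ext (fun i => ?_) (fun i => ?_) <;>
    simp only [LinearMap.sub_apply, LinearMap.neg_apply, Module.End.mul_apply, bigF_vecX,
      bigF_vecY, bigH_vecX, bigH_vecY, map_smul] <;>
    push_cast <;> module

variable [CharP K p]

theorem opDown_vec (a : K) (i : ℕ) : opDown K p a (vec K _ i) =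
    (if i = 0 then 0 else hwCoeff a (i - 1)) • vec K _ (i - 1) := by
  refine shiftOp_vec (fun i hi => ?_) i
  rcases Nat.lt_or_ge i (2 * p + 1) with h | h
  · obtain rfl : i = 2 * p := by omega
    -- This is the boundary case: $v_{2p}$ is zero but its formal target $v_{2p-1}$ is not, so the
    -- coefficient itself must vanish. It does, being $-p$; the case $p=0$ is split off because
    -- primality is not assumed here.
    split_ifs with h0
    · rw [zero_smul]
    · obtain ⟨q, rfl⟩ : ∃ q, p = q + 1 := Nat.exists_eq_succ_of_ne_zero (by omega)
      have h1 : 2 * (q + 1) - 1 = 2 * q + 1 := by omega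
      have h2 : ((q : K) + 1) = 0 := by exact_mod_cast CharP.cast_eq_zero K (q + 1)
      rw [h1, hwCoeff_odd, h2, neg_zero, zero_smul]
  · rw [vec_of_le (by omega), smul_zero]

theorem bigE_vecX_zero (a b : K) (s : ℕ) : bigE K p a b s (vecX K p 0) = vecY K p s := by
  simp [bigE, vecX, vecY, opDown_vec, opLink_vec]

theorem bigE_vecX_succ (a b : K) (s i : ℕ) : bigE K p a b s (vecX K p (i + 1)) =
    hwCoeff a i • vecX K p i + (-1 : K) ^ (i + 1) • vecY K p (s + (i + 1)) := by
  simp [bigE, vecX, vecY, opDown_vec, opLink_vec]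

theorem bigE_vecY_zero (a b : K) (s : ℕ) : bigE K p a b s (vecY K p 0) = 0 := by
  simp [bigE, vecY, opDown_vec]

theorem bigE_vecY_succ (a b : K) (s i : ℕ) :
    bigE K p a b s (vecY K p (i + 1)) = hwCoeff b i • vecY K p i := by
  simp [bigE, vecY, opDown_vec]

theorem hwCoeff_zero (a : K) : hwCoeff a 0 = a := by
  simp [hwCoeff]

/-- This is the relation $EF+FE=h$ evaluated on $F^{i+1}v$. -/
theorem hwCoeff_add (a : K) (i : ℕ) : hwCoeff a (i + 1) + hwCoeff a i = a - (i + 1) := by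
  rcases Nat.even_or_odd' i with ⟨j, rfl | rfl⟩
  · rw [hwCoeff_odd, hwCoeff_even]; push_cast; ring
  · rw [hwCoeff_odd, show 2 * j + 1 + 1 = 2 * (j + 1) by ring, hwCoeff_even]; push_cast; ring

/-- On each of the two strings this is `hwCoeff_add`. The extra terms $x_i\mapsto(-1)^iy_{s+i}$
cancel because the alternating sign makes the link anticommute with $F$. -/
theorem bigH_eq (a b : K) (s : ℕ) :
    bigH K p a b = bigE K p a b s * bigF K p + bigF K p * bigE K p a b s := by
  refine end_prod_ext (fun i => ?_) (fun i => ?_)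
  · cases i with
    | zero =>
      simp only [LinearMap.add_apply, Module.End.mul_apply, bigF_vecX, bigF_vecY, bigH_vecX,
        bigE_vecX_zero, bigE_vecX_succ, hwCoeff_zero]
      push_cast
      module
    | succ i =>
      simp only [LinearMap.add_apply, Module.End.mul_apply, bigF_vecX, bigF_vecY, bigH_vecX,
        bigE_vecX_succ, map_add, map_smul]
      push_cast
      rw [← hwCoeff_add, show s + (i + 1) + 1 = s + (i + 1 + 1) by ring]
      module
  · cases i with
    | zero =>
      simp only [LinearMap.add_apply, Module.End.mul_apply, bigF_vecY, bigH_vecY,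
        bigE_vecY_zero, bigE_vecY_succ, hwCoeff_zero, map_zero]
      push_cast
      module
    | succ i =>
      simp only [LinearMap.add_apply, Module.End.mul_apply, bigF_vecY, bigH_vecY,
        bigE_vecY_succ, map_smul]
      push_cast
      rw [← hwCoeff_add]
      module

/-- The link sends weight $a-i$ to weight $b-s-i$, and $E$ must raise weights by one: this forces
$b=a+s+1$. -/
theorem bigH_bigE {a b : K} {s : ℕ} (h : b = a + s + 1) :
    bigH K p a b * bigE K p a b s - bigE K p a b s * bigH K p a b = bigE K p a b s := by
  subst h
  refine end_prod_ext (fun i => ?_) (fun i => ?_) <;> cases i <;>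
    simp only [LinearMap.sub_apply, Module.End.mul_apply, bigH_vecX, bigH_vecY, map_add, map_smul,
      bigE_vecX_zero, bigE_vecX_succ, bigE_vecY_zero, bigE_vecY_succ, map_zero] <;>
    push_cast <;> module

theorem bigE_pow_vecY {a b : K} {s k i : ℕ} (h : i < k) :
    (bigE K p a b s ^ k) (vecY K p i) = 0 := by
  induction k generalizing i with
  | zero => omega
  | succ k ih =>
    rw [pow_succ, Module.End.mul_apply]
    cases i with
    | zero => rw [bigE_vecY_zero, map_zero]
    | succ i => rw [bigE_vecY_succ, map_smul, ih (by omega), smul_zero]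

/-- As $E^{2p}$ commutes with $F$ and the module is generated by $x_0$ and $y_0$ under $F$, only
these two vectors matter. On $x_0$ one step leads to $y_s$, and $s<2p-1$ leaves enough further steps
to reach zero. -/
theorem bigE_pow {a b : K} {s : ℕ} (h : b = a + s + 1) (hs : s + 1 < 2 * p) :
    bigE K p a b s ^ (2 * p) = 0 := by
  obtain ⟨q, hq⟩ : ∃ q, p = q + 1 := Nat.exists_eq_succ_of_ne_zero (by omega)
  have hcomm : Commute (bigF K p) (bigE K p a b s ^ (2 * p)) := by
    have h1 := F_mul_E_pow_even (bigH_eq a b s) (bigH_bigE h) q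
    have h2 : (q + 1 : Module.End K ((Fin (2 * p) → K) × (Fin (2 * p) → K))) = 0 := by
      have h3 : ((q + 1 : ℕ) : K) = 0 := by rw [← hq]; exact CharP.cast_eq_zero K p
      have h4 := congrArg (algebraMap K
        (Module.End K ((Fin (2 * p) → K) × (Fin (2 * p) → K)))) h3
      rw [map_natCast, map_zero] at h4
      exact_mod_cast h4
    rw [h2, zero_mul, add_zero, ← hq] at h1
    exact h1
  have hx : (bigE K p a b s ^ (2 * p)) (vecX K p 0) = 0 := by
    obtain ⟨k, hk⟩ : ∃ k, 2 * p = k + 1 := ⟨2 * p - 1, by omega⟩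
    have hpow : bigE K p a b s ^ (2 * p) = bigE K p a b s ^ (k + 1) := congrArg _ hk
    rw [hpow, pow_succ, Module.End.mul_apply, bigE_vecX_zero, bigE_pow_vecY (by omega)]
  have hy : (bigE K p a b s ^ (2 * p)) (vecY K p 0) = 0 := bigE_pow_vecY (by omega)
  refine end_prod_ext (fun i => ?_) (fun i => ?_)
  · have h1 := bigF_pow_vecX (K := K) (p := p) i 0
    rw [zero_add] at h1
    rw [← h1, ← Module.End.mul_apply, ← (hcomm.pow_left i).eq, Module.End.mul_apply, hx, map_zero,
      LinearMap.zero_apply]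
  · have h1 := bigF_pow_vecY (K := K) (p := p) i 0
    rw [zero_add] at h1
    rw [← h1, ← Module.End.mul_apply, ← (hcomm.pow_left i).eq, Module.End.mul_apply, hy, map_zero,
      LinearMap.zero_apply]

/-- The link condition $b=a+s+1$ for $a=l$, $b=p-l-1$ and $s=2(p-l-1)$. With this $s$, moreover,
$EFEx_0=(b-s/2)y_s=0$, so $x_0$ satisfies the defining relations of the generator of $P(l)$. -/
theorem rev_cast_eq (l : Fin p) :
    ((Fin.rev l : ℕ) : K) = (l : ℕ) + (2 * (Fin.rev l : ℕ) : ℕ) + 1 := by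
  push_cast
  rw [natCast_rev]
  ring

/-- The concrete representation of `osp(1|2)`. -/
def bigRho (K : Type u) [Field K] {p : ℕ} (l : Fin p) :
    osp K →ₗ[K] Module.End K ((Fin (2 * p) → K) × (Fin (2 * p) → K)) :=
  rho (bigH K p (l : ℕ) (Fin.rev l : ℕ))
    (bigE K p (l : ℕ) (Fin.rev l : ℕ) (2 * (Fin.rev l : ℕ)) *
      bigE K p (l : ℕ) (Fin.rev l : ℕ) (2 * (Fin.rev l : ℕ)))
    (-(bigF K p * bigF K p))
    (bigE K p (l : ℕ) (Fin.rev l : ℕ) (2 * (Fin.rev l : ℕ))) (bigF K p)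

theorem bigRho_bracket (l : Fin p) (i j : ZMod 2) (x : ospPart K i) (y : ospPart K j) :
    bigRho K l (toOsp x) * bigRho K l (toOsp y) - (-1 : K) ^ (i.val * j.val) •
      (bigRho K l (toOsp y) * bigRho K l (toOsp x)) = bigRho K l (superbracket x y) :=
  rho_bracket rfl rfl (bigH_eq _ _ _) (bigH_bigE (rev_cast_eq l)) (bigH_bigF _ _) i j x y

variable [Fact p.Prime]

theorem bigH_pow {a b : K} (ha : a ^ p = a) (hb : b ^ p = b) :
    bigH K p a b ^ p = bigH K p a b := by
  have hpow : ∀ i : ℕ, (i : K) ^ p = i := fun i => map_natCast (frobenius K p) i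
  have hX : ∀ k i, (bigH K p a b ^ k) (vecX K p i) = (a - i) ^ k • vecX K p i := by
    intro k i
    induction k with
    | zero => simp
    | succ k ih => rw [pow_succ, Module.End.mul_apply, bigH_vecX, map_smul, ih, smul_smul, pow_succ']
  have hY : ∀ k i, (bigH K p a b ^ k) (vecY K p i) = (b - i) ^ k • vecY K p i := by
    intro k i
    induction k with
    | zero => simp
    | succ k ih => rw [pow_succ, Module.End.mul_apply, bigH_vecY, map_smul, ih, smul_smul, pow_succ']
  refine end_prod_ext (fun i => ?_) (fun i => ?_)
  · rw [hX, bigH_vecX, sub_pow_char, ha, hpow]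
  · rw [hY, bigH_vecY, sub_pow_char, hb, hpow]

variable [Fact (2 < p)]

theorem bigRho_pow (l : Fin p) (x : ospPart K 0) :
    bigRho K l (toOsp x) ^ p = bigRho K l (toOsp (pMap p x)) := by
  have hpow : ∀ i : ℕ, (i : K) ^ p = i := fun i => map_natCast (frobenius K p) i
  refine pow_relation _ (fun x y => ?_) ?_ ?_ ?_ x
  · have := bigRho_bracket l 0 0 x y
    rwa [ZMod.val_zero, mul_zero, pow_zero, one_smul] at this
  · have : bigRho K l (toOsp (hEl K)) = bigH K p (l : ℕ) (Fin.rev l : ℕ) := by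
      simp [bigRho, rho, toOsp, hEl]
    rw [this, bigH_pow (hpow _) (hpow _)]
  · have : bigRho K l (toOsp (eEl K)) =
        bigE K p (l : ℕ) (Fin.rev l : ℕ) (2 * (Fin.rev l : ℕ)) *
          bigE K p (l : ℕ) (Fin.rev l : ℕ) (2 * (Fin.rev l : ℕ)) := by
      simp [bigRho, rho, toOsp, eEl]
    rw [this, ← pow_two, ← pow_mul, bigE_pow (rev_cast_eq l) (by omega)]
  · have : bigRho K l (toOsp (fEl K)) = -(bigF K p * bigF K p) := by
      simp [bigRho, rho, toOsp, fEl]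
    rw [this]
    exact neg_mul_self_pow _ bigF_pow

/-- The concrete representation of `U_0(osp(1|2))`. -/
def bigRep (K : Type u) [Field K] {p : ℕ} [Fact p.Prime] [Fact (2 < p)] [CharP K p] (l : Fin p) :
    U K p →ₐ[K] Module.End K ((Fin (2 * p) → K) × (Fin (2 * p) → K)) :=
  liftU p (bigRho K l) (bigRho_bracket l) (bigRho_pow l)

theorem bigRep_uF (l : Fin p) : bigRep K l (uF K p) = bigF K p := by
  rw [uF, bigRep, liftU_gen]
  simp [bigRho, rho, toOsp, oddF]

theorem bigRep_uE (l : Fin p) : bigRep K l (uE K p) =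
    bigE K p (l : ℕ) (Fin.rev l : ℕ) (2 * (Fin.rev l : ℕ)) := by
  rw [uE, bigRep, liftU_gen]
  simp [bigRho, rho, toOsp, oddE]

theorem bigRep_uH (l : Fin p) : bigRep K l (uH K p) = bigH K p (l : ℕ) (Fin.rev l : ℕ) := by
  rw [uH, bigRep, liftU_gen]
  simp [bigRho, rho, toOsp, hEl]

/-- A test for non-membership: an element that does not kill $x$ lies outside every left ideal whose
generators kill $x$. It bounds cyclic modules from below. -/
theorem bigRep_eq_zero_of_mem_span {l : Fin p} {S : Set (U K p)}
    {x : (Fin (2 * p) → K) × (Fin (2 * p) → K)} (h : ∀ s ∈ S, bigRep K l s x = 0) {u : U K p}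
    (hu : u ∈ Submodule.span (U K p) S) : bigRep K l u x = 0 := by
  induction hu using Submodule.span_induction with
  | mem u hu => exact h u hu
  | zero => rw [map_zero, LinearMap.zero_apply]
  | add a b _ _ ha hb => rw [map_add, LinearMap.add_apply, ha, hb, add_zero]
  | smul a u _ hu => rw [smul_eq_mul, map_mul, Module.End.mul_apply, hu, map_zero]

end Concrete

/-! ### Baby Verma modules -/

section BabyVerma

variable {K : Type u} [Field K] {p : ℕ} [Fact p.Prime] [Fact (2 < p)]

theorem uE_mem_borelIdeal (a : K) : uE K p ∈ borelIdeal p a :=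
  Submodule.subset_span ⟨toOsp (oddE K), by simp [toOsp, oddE], by simp [toOsp, oddE], by
    simp [toOsp, oddE, uE]⟩

theorem uH_sub_mem_borelIdeal (a : K) : uH K p - algebraMap K _ a ∈ borelIdeal p a :=
  Submodule.subset_span ⟨toOsp (hEl K), by simp [toOsp, hEl], by simp [toOsp, hEl], by
    simp [toOsp, hEl, uH]⟩

theorem smul_eq_zero_of_mem_span {M : Type*} [AddCommGroup M] [Module (U K p) M] {S : Set (U K p)}
    {m : M} (h : ∀ s ∈ S, s • m = 0) (u : U K p) (hu : u ∈ Submodule.span (U K p) S) :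
    u • m = 0 :=
  (Submodule.span_le (p := LinearMap.ker (LinearMap.toSpanSingleton (U K p) M m))).2
    (fun s hs => h s hs) hu

variable [CharP K p]

/-- The highest weight vector of `Z(l)`. -/
def babyGen (K : Type u) [Field K] {p : ℕ} [Fact p.Prime] [Fact (2 < p)] [CharP K p] (l : Fin p) :
    babyVerma K p l :=
  -- `babyVerma` unfolds to the cyclic module of the Borel ideal, so the results on cyclic modules
  -- apply to it directly.
  cyclicGen (borelIdeal p ((l : ℕ) : K)) fun _ => parityAut_mem_borelIdeal

theorem uE_smul_babyGen (l : Fin p) : uE K p • babyGen K l = 0 :=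
  smul_cyclicGen_eq_zero (hJ := fun _ => parityAut_mem_borelIdeal) (uE_mem_borelIdeal _)

theorem uH_smul_babyGen (l : Fin p) : uH K p • babyGen K l = ((l : ℕ) : K) • babyGen K l := by
  have := smul_cyclicGen_eq_zero (hJ := fun _ => parityAut_mem_borelIdeal)
    (uH_sub_mem_borelIdeal (K := K) (p := p) ((l : ℕ) : K))
  rw [sub_smul, algebraMap_smul, sub_eq_zero] at this
  exact this

theorem babyGen_mem (l : Fin p) : babyGen K l ∈ (babyVerma K p l).part 0 :=
  cyclicGen_mem (hJ := fun _ => parityAut_mem_borelIdeal)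

/-- The generator $e$ is redundant because $e=E\cdot E$ lies in the left ideal generated by $E$. -/
theorem borelIdeal_eq_span (a : K) :
    borelIdeal p a = Submodule.span (U K p) {uE K p, uH K p - algebraMap K _ a} := by
  refine le_antisymm (Submodule.span_le.2 ?_) (Submodule.span_le.2 ?_)
  · rintro _ ⟨x, h1, h2, rfl⟩
    have hE : uE K p ∈ Submodule.span (U K p) {uE K p, uH K p - algebraMap K _ a} :=
      Submodule.subset_span (by simp)
    have hH : uH K p - algebraMap K _ a ∈
        Submodule.span (U K p) {uE K p, uH K p - algebraMap K _ a} :=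
      Submodule.subset_span (by simp)
    have e : gen K p x - algebraMap K (U K p) (a * x.1 1 1) =
        algebraMap K (U K p) (x.1 1 1) • (uH K p - algebraMap K _ a) +
          (x.1 1 2 • uE K p + algebraMap K _ (x.1 0 2)) • uE K p := by
      rw [gen_eq, h1, h2, zero_smul, zero_smul, mul_comm a]
      simp only [add_zero, smul_eq_mul, map_mul, mul_sub, add_mul, Algebra.smul_def, mul_assoc]
      abel
    rw [SetLike.mem_coe, e]
    exact Submodule.add_mem _ (Submodule.smul_mem _ _ hH) (Submodule.smul_mem _ _ hE)
  · rintro _ (rfl | rfl)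
    · exact uE_mem_borelIdeal a
    · exact uH_sub_mem_borelIdeal a

theorem smul_eq_zero_of_mem_borelIdeal {M : Type*} [AddCommGroup M] [Module K M]
    [Module (U K p) M] [IsScalarTower K (U K p) M] {m : M} {a : K} (hE : uE K p • m = 0)
    (hH : uH K p • m = a • m) (u : U K p) (hu : u ∈ borelIdeal p a) : u • m = 0 := by
  rw [borelIdeal_eq_span] at hu
  refine smul_eq_zero_of_mem_span ?_ u hu
  rintro _ (rfl | rfl)
  · exact hE
  · rw [sub_smul, algebraMap_smul, hH, sub_self]

/-- The homomorphism from `Z(l)` given by a highest weight vector. -/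
def babyHom {M : Type*} [AddCommGroup M] [Module K M]
    [Module (U K p) M] [IsScalarTower K (U K p) M] (l : Fin p) (v : M) (hE : uE K p • v = 0)
    (hH : uH K p • v = ((l : ℕ) : K) • v) : babyVerma K p l →ₗ[U K p] M :=
  cyclicHom (hJ := fun _ => parityAut_mem_borelIdeal) M v (smul_eq_zero_of_mem_borelIdeal hE hH)

theorem babyHom_babyGen {M : Type*} [AddCommGroup M] [Module K M]
    [Module (U K p) M] [IsScalarTower K (U K p) M] {l : Fin p} {v : M} {hE : uE K p • v = 0}
    {hH : uH K p • v = ((l : ℕ) : K) • v} : babyHom l v hE hH (babyGen K l) = v :=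
  cyclicHom_gen (hJ := fun _ => parityAut_mem_borelIdeal) _

theorem babyHom_isHomogeneous {M : SuperModule K p} {l : Fin p} {v : M} {c : ZMod 2}
    (hv : v ∈ M.part c) (hE : uE K p • v = 0) (hH : uH K p • v = ((l : ℕ) : K) • v) :
    IsHomogeneousMap c (babyHom l v hE hH) :=
  cyclicHom_isHomogeneous (hJ := fun _ => parityAut_mem_borelIdeal) hv _

theorem fString_babyGen (l : Fin p) : fString (K := K) (p := p) (babyGen K l) = ⊤ := by
  rw [eq_top_iff]
  rintro m -
  obtain ⟨u, rfl⟩ := exists_smul_cyclicGen (hJ := fun _ => parityAut_mem_borelIdeal) m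
  exact (hwSubmodule (babyGen K l) _ (uE_smul_babyGen l) (uH_smul_babyGen l)).smul_mem u
    (self_mem_fString (K := K) (p := p) (babyGen K l))

theorem uF_pow_smul_babyGen_ne_zero (l : Fin p) : uF K p ^ (2 * p - 1) • babyGen K l ≠ 0 := by
  intro h
  have h1 : uF K p ^ (2 * p - 1) ∈ borelIdeal p ((l : ℕ) : K) :=
    (Submodule.Quotient.mk_eq_zero _).1 ((smul_cyclicGen
      (hJ := fun _ => parityAut_mem_borelIdeal) _).symm.trans h)
  rw [borelIdeal_eq_span] at h1
  -- The representation for $p-l-1$ is used, because there the $y$-string has highest weight $l$ and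
  -- $y_0$ satisfies the relations of the generator of $Z(l)$.
  have h2 := bigRep_eq_zero_of_mem_span (l := Fin.rev l) (x := vecY K p 0) (by
    rintro _ (rfl | rfl)
    · rw [bigRep_uE, bigE_vecY_zero]
    · rw [map_sub, LinearMap.sub_apply, bigRep_uH, bigH_vecY, AlgHom.commutes, Fin.rev_rev, Nat.cast_zero, sub_zero, Module.algebraMap_end_apply,
        sub_self]) h1
  rw [map_pow, bigRep_uF, bigF_pow_vecY] at h2
  have hp : 0 < p := (Fact.out : p.Prime).pos
  exact vecY_ne_zero (by omega) h2

/-- Every nonzero submodule of $Z(l)$ contains the bottom vector $F^{2p-1}v$, so injectivity of a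
map out of $Z(l)$ can be tested on that vector alone. -/
theorem babyVerma_eq_bot_of_not_mem {l : Fin p} {N : Submodule (U K p) (babyVerma K p l)}
    (h : uF K p ^ (2 * p - 1) • babyGen K l ∉ N) : N = ⊥ := by
  by_contra hN
  obtain ⟨m, hm, h0⟩ := Submodule.exists_mem_ne_zero_of_ne_bot hN
  have hp : 0 < p := (Fact.out : p.Prime).pos
  obtain ⟨k, c, hc, hk⟩ := exists_uF_pow_smul_eq (K := K) (p := p) (n := 2 * p - 1)
    (v := babyGen K l) (by rw [Nat.sub_add_cancel (by omega), uF_pow, zero_smul])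
    (by rw [fString_babyGen]; exact Submodule.mem_top) h0
  have h2 : c • uF K p ^ (2 * p - 1) • babyGen K l ∈ N.restrictScalars K := by
    rw [← hk]
    exact N.smul_mem _ hm
  exact h ((Submodule.smul_mem_iff _ hc).1 h2)

theorem babyVerma_hasCompositionFactors (l : Fin p) :
    HasCompositionFactors (babyVerma K p l)
      ![simpleModule K p (Fin.rev l), simpleModule K p l] := by
  refine ⟨fun i => by fin_cases i <;> exact simpleModule_isSimple _, ?_⟩
  have hE := uE_smul_babyGen (K := K) l
  have hH := uH_smul_babyGen (K := K) l
  have hval := Fin.val_rev l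
  have hl := l.2
  have hE' := uE_smul_singular hE hH
  have hH' : uH K p • uF K p ^ (2 * (l : ℕ) + 1) • babyGen K l =
      ((Fin.rev l : ℕ) : K) • uF K p ^ (2 * (l : ℕ) + 1) • babyGen K l := by
    rw [uH_smul_uF_pow hH, natCast_rev]
    congr 1
    push_cast
    ring
  have hF' : uF K p ^ (2 * (Fin.rev l : ℕ) + 1) • uF K p ^ (2 * (l : ℕ) + 1) • babyGen K l = 0 := by
    rw [← mul_smul, ← pow_add, show 2 * (Fin.rev l : ℕ) + 1 + (2 * (l : ℕ) + 1) = 2 * p by omega,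
      uF_pow, zero_smul]
  have hne : uF K p ^ (2 * (l : ℕ) + 1) • babyGen K l ≠ 0 := by
    intro h
    refine uF_pow_smul_babyGen_ne_zero (K := K) l ?_
    rw [show 2 * p - 1 = 2 * (Fin.rev l : ℕ) + (2 * (l : ℕ) + 1) by omega, pow_add, mul_smul, h,
      smul_zero]
  let ψ := simpleHom (Fin.rev l) _ hE' hH' hF'
  let φ := babyHom l (simpleVec K l 0) (uE_smul_simpleVec_zero l) (uH_smul_simpleVec_zero l)
  have hφ : ∀ i, φ (uF K p ^ i • babyGen K l) = simpleVec K l i := by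
    intro i
    rw [map_smul, babyHom_babyGen, uF_pow_smul_simpleVec]
  have hsurj : Function.Surjective φ := by
    rw [← LinearMap.range_eq_top]
    exact simpleModule_eq_top ⟨babyGen K l, babyHom_babyGen⟩
  refine hasFiltration_of_exact (ψ := ψ) (φ := φ)
    (simpleHom_isHomogeneous (uF_pow_smul_mem (babyGen_mem l) _) hE' hH' hF')
    (babyHom_isHomogeneous (simpleVec_mem l 0) _ _) (simpleHom_injective hne) hsurj
    (le_antisymm ?_ ?_)
  · rw [LinearMap.range_le_ker_iff]
    refine LinearMap.ext fun x => ?_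
    refine LinearMap.congr_fun (f := (φ ∘ₗ ψ).restrictScalars K) (g := 0)
      (simpleVec_ext fun i => ?_) x
    change φ (ψ (simpleVec K (Fin.rev l) i)) = 0
    rw [simpleHom_simpleVec, ← mul_smul, ← pow_add, hφ, simpleVec_of_le (by omega)]
  · intro m hm
    -- The linear map $v_i\mapsto F^iv$ is a section of $\varphi$ over $K$. The claim is that $m$
    -- minus its lifted image lies in the range of $\psi$; on string vectors the difference is zero
    -- up to $i=2l$ and lies in the lower string afterwards.
    have hle : fString (K := K) (p := p) (babyGen K l) ≤
        ((LinearMap.range ψ).restrictScalars K).comap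
          (LinearMap.id - stringMap l (babyGen K l) ∘ₗ φ.restrictScalars K) := by
      refine fString_le fun i => ?_
      change uF K p ^ i • babyGen K l - stringMap l (babyGen K l) (φ (uF K p ^ i • babyGen K l)) ∈
        LinearMap.range ψ
      rw [hφ]
      rcases Nat.lt_or_ge i (2 * (l : ℕ) + 1) with h | h
      · rw [stringMap_simpleVec h, sub_self]
        exact Submodule.zero_mem _
      · rw [simpleVec_of_le h, map_zero, sub_zero]
        obtain ⟨k, rfl⟩ := Nat.exists_eq_add_of_le h
        exact ⟨simpleVec K (Fin.rev l) k, by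
          rw [simpleHom_simpleVec, ← mul_smul, ← pow_add, add_comm k]⟩
    have h1 := hle (by rw [fString_babyGen]; exact Submodule.mem_top : m ∈ _)
    change m - stringMap l (babyGen K l) (φ m) ∈ LinearMap.range ψ at h1
    rwa [LinearMap.mem_ker.1 hm, map_zero, sub_zero] at h1

end BabyVerma

/-! ### Strings of powers of `E` -/

section EStrings

open Polynomial

section Coefficients

variable {K : Type u} [Field K]

/-- The polynomial `q` with `F E ^ (k + 1) m = E ^ k q(F E) m` for `m` of weight `a`. -/
def lwPoly (a : K) (k : ℕ) : K[X] :=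
  if Even k then X + C ((k / 2 : ℕ) : K) else C (a + (k / 2 : ℕ) + 1) - X

theorem lwPoly_even (a : K) (j : ℕ) : lwPoly a (2 * j) = X + C (j : K) := by
  simp [lwPoly]

theorem lwPoly_odd (a : K) (j : ℕ) : lwPoly a (2 * j + 1) = C (a + j + 1) - X := by
  have : (2 * j + 1) / 2 = j := by omega
  simp [lwPoly, this]

theorem prod_range_two_mul_succ {R : Type*} [CommRing R] (f : ℕ → R) (n : ℕ) :
    ∏ j ∈ Finset.range (2 * n + 1), f (j + 1) =
      (∏ i ∈ Finset.range (n + 1), f (2 * i + 1)) * ∏ i ∈ Finset.range n, f (2 * (i + 1)) := by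
  induction n with
  | zero => simp
  | succ n ih =>
    rw [show 2 * (n + 1) + 1 = 2 * n + 1 + 1 + 1 by ring, Finset.prod_range_succ,
      Finset.prod_range_succ, ih, Finset.prod_range_succ _ (n + 1), Finset.prod_range_succ _ n,
      Finset.prod_range_succ _ n]
    rw [show 2 * n + 1 + 1 = 2 * (n + 1) by ring]
    ring

/-- The coefficient of `E ^ k m` in `F E ^ (k + 1) m`, for `m` of weight `a` with `E F E m = 0`. -/
def lwCoeff (a : K) (k : ℕ) : K := if Even k then ((k / 2 : ℕ) : K) else a + (k / 2 : ℕ) + 1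

variable {p : ℕ} [CharP K p]

/-- Even $k=2j$ gives $j$ with $0<j<p$. Odd $k=2j+1$ gives $l+j+1=j-(p-l-1)$ in $K$, which vanishes
only at the excluded index. -/
theorem lwCoeff_ne_zero {l : Fin p} {k : ℕ} (h0 : 0 < k) (hk : k < 2 * p)
    (hne : k ≠ 2 * (Fin.rev l : ℕ) + 1) : lwCoeff ((l : ℕ) : K) k ≠ 0 := by
  have hrev := Fin.val_rev l
  have hl := l.2
  rcases Nat.even_or_odd' k with ⟨j, rfl | rfl⟩
  · simp only [lwCoeff, even_two_mul, if_true, Nat.mul_div_cancel_left j two_pos]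
    exact natCast_ne_zero_of_lt (p := p) (by omega) (by omega)
  · have : (2 * j + 1) / 2 = j := by omega
    simp only [lwCoeff, Nat.not_even_bit1, if_false, this]
    have e : ((l : ℕ) : K) + j + 1 = j - (Fin.rev l : ℕ) := by rw [natCast_rev]; ring
    rw [e]
    exact natCast_sub_ne_zero (p := p) (by omega) (by omega) (by omega)

theorem prod_X_add_natCast [Fact p.Prime] (hodd : Odd p) :
    ∏ i ∈ Finset.range p, (X + C (i : K)) = X ^ p - X := by
  have h := congrArg (fun q : K[X] => q.comp (-X)) (prod_X_sub_natCast K p)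
  simp only [prod_comp, sub_comp, X_comp, C_comp, pow_comp, hodd.neg_pow] at h
  have e : ∀ i : ℕ, (-X - C (i : K)) = -1 * (X + C (i : K)) := fun i => by ring
  simp only [e, Finset.prod_mul_distrib, Finset.prod_const, Finset.card_range,
    hodd.neg_one_pow] at h
  linear_combination -h

/-- The odd indices contribute $c-X$ for all $c$ in the prime field, with product $X-X^p$; the even
ones contribute $X+i$ with $0<i<p$, with product $X^{p-1}-1$. The result does not depend on $l$. -/
theorem prod_lwPoly [Fact p.Prime] (hodd : Odd p) (l : ℕ) :
    ∏ j ∈ Finset.range (2 * p - 1), lwPoly (l : K) (j + 1) =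
      -(X * (X ^ (p - 1) - 1) ^ 2) := by
  obtain ⟨q, hq⟩ : ∃ q, p = q + 1 :=
    Nat.exists_eq_succ_of_ne_zero (Fact.out : p.Prime).ne_zero
  have hX := prod_X_add_natCast (K := K) hodd
  have hB : ∏ i ∈ Finset.range q, (X + C (((i + 1 : ℕ)) : K)) = X ^ q - 1 := by
    have h := hX
    rw [hq, Finset.prod_range_succ'] at h
    refine mul_right_cancel₀ (X_ne_zero (R := K)) ?_
    rw [Nat.cast_zero, C_0, add_zero] at h
    rw [h]
    ring
  have hA : ∏ i ∈ Finset.range p, (C ((l : K) + i + 1) - X) = X - X ^ p := by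
    -- After the substitution $X\mapsto l+1-X$, Frobenius fixes $l+1$ and the constants cancel.
    have h := congrArg (fun q : K[X] => q.comp (C ((l : K) + 1) - X)) hX
    simp only [prod_comp, add_comp, sub_comp, X_comp, C_comp, pow_comp] at h
    have hl : ((l : K) + 1) ^ p = (l : K) + 1 := by
      have := map_natCast (frobenius K p) (l + 1)
      push_cast at this
      exact this
    rw [sub_pow_char, ← C_pow, hl] at h
    have e : ∀ i : ℕ, C ((l : K) + i + 1) - X = C ((l : K) + 1) - X + C (i : K) := fun i => by
      simp only [C_add]; ring
    simp only [e, h]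
    ring
  rw [hq, show 2 * (q + 1) - 1 = 2 * q + 1 by omega, prod_range_two_mul_succ, ← hq]
  simp only [lwPoly_odd, lwPoly_even]
  rw [hA, hB, hq, Nat.add_sub_cancel]
  ring

/-- Equal parity together with congruence modulo the odd prime $p$ would give congruence modulo
$2p$. Weights alone cannot tell apart positions that differ by $p$ in a string of length $2p$. -/
theorem natCast_sub_ne_zero_of_even {i j : ℕ} (h2 : (2 : K) ≠ 0) (hi : i < 2 * p) (hj : j < 2 * p)
    (hne : i ≠ j) (hpar : Even (i + j)) : (i : K) - j ≠ 0 := by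
  have key : ∀ {a b : ℕ}, a < b → b < 2 * p → Even (a + b) → (b : K) - a ≠ 0 := by
    intro a b hab hb hpar
    obtain ⟨d, rfl⟩ := Nat.exists_eq_add_of_le hab.le
    obtain ⟨e, rfl⟩ : ∃ e, d = 2 * e := by
      rw [← add_assoc, Nat.even_add] at hpar
      obtain ⟨e, rfl⟩ := hpar.1 ⟨a, rfl⟩
      exact ⟨e, by ring⟩
    push_cast
    rw [add_sub_cancel_left]
    exact mul_ne_zero h2 (natCast_ne_zero_of_lt (p := p) (by omega) (by omega))
  rcases Nat.lt_or_gt_of_ne hne with h | h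
  · rw [← neg_sub, neg_ne_zero]
    exact key h hj hpar
  · exact key h hi (by rwa [add_comm])

end Coefficients

variable {K : Type u} [Field K] {p : ℕ} [Fact p.Prime] [Fact (2 < p)]
  {M : Type*} [AddCommGroup M] [Module K M] [Module (U K p) M] [IsScalarTower K (U K p) M]

/-- $FE$ has weight zero, so polynomials in $FE$ preserve weight spaces. -/
theorem uH_mul_uF_mul_uE : uH K p * (uF K p * uE K p) = uF K p * uE K p * uH K p := by
  have h1 := uH_uE K p
  have h2 := uH_uF K p
  rw [sub_eq_iff_eq_add] at h1 h2
  rw [← mul_assoc, h2, add_mul, mul_assoc, h1]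
  noncomm_ring

theorem uH_smul_aeval {m : M} {a : K} (hH : uH K p • m = a • m) (q : K[X]) :
    uH K p • aeval (uF K p * uE K p) q • m = a • aeval (uF K p * uE K p) q • m := by
  have hc : Commute (uH K p) (aeval (uF K p * uE K p) q) := by
    induction q using Polynomial.induction_on' with
    | add q r hq hr => rw [map_add]; exact hq.add_right hr
    | monomial n c =>
      rw [aeval_monomial]
      exact Commute.mul_right (Algebra.commutes c (uH K p)).symm
        (Commute.pow_right uH_mul_uF_mul_uE n)
  rw [← mul_smul, hc.eq, mul_smul, hH, smul_comm]

theorem uF_smul_uE_pow {m : M} {a : K} (hH : uH K p • m = a • m) (k : ℕ) :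
    uF K p • uE K p ^ (k + 1) • m =
      uE K p ^ k • aeval (uF K p * uE K p) (lwPoly a k) • m := by
  have heven : ∀ j : ℕ, ∀ w : M, uF K p • uE K p ^ (2 * (j + 1)) • w =
      uE K p ^ (2 * (j + 1)) • uF K p • w + ((j : K) + 1) • uE K p ^ (2 * j + 1) • w := by
    intro j w
    rw [← mul_smul, F_mul_E_pow_even (uH_eq K p) (uH_uE K p), add_smul, mul_smul, mul_smul,
      ← Nat.cast_succ, natCast_smul_eq, Nat.cast_succ]
  have hEF : uE K p • uF K p • m = a • m - (uF K p * uE K p) • m := by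
    have h := congrArg (· • m) (uH_eq K p)
    simp only [add_smul, hH] at h
    rw [h, add_sub_cancel_right, mul_smul]
  rcases Nat.even_or_odd' k with ⟨j, rfl | rfl⟩
  · rw [lwPoly_even, map_add, aeval_X, aeval_C, add_smul, algebraMap_smul]
    cases j with
    | zero => simp [mul_smul]
    | succ j =>
      rw [pow_succ, mul_smul, heven, smul_add, mul_smul,
        ← mul_smul (uE K p ^ (2 * j + 1)) (uE K p) m, ← pow_succ, smul_comm _ ((j + 1 : ℕ) : K), Nat.cast_succ, show 2 * j + 1 + 1 = 2 * (j + 1) by ring]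
  · rw [lwPoly_odd, map_sub, aeval_X, aeval_C, sub_smul, algebraMap_smul,
      show 2 * j + 1 + 1 = 2 * (j + 1) by ring, heven, show 2 * (j + 1) = 2 * j + 1 + 1 by ring,
      pow_succ, mul_smul, hEF, smul_comm _ (uE K p ^ (2 * j + 1)), ← smul_add]
    congr 1
    rw [add_assoc a, add_smul a]
    abel

/-- Each step replaces $m$ by a polynomial in $FE$ applied to $m$. This vector has the same weight,
so the induction hypothesis applies to it. -/
theorem uF_pow_smul_uE_pow {m : M} {a : K} (hH : uH K p • m = a • m) (n : ℕ) :
    uF K p ^ n • uE K p ^ (n + 1) • m = uE K p • aeval (uF K p * uE K p)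
      (∏ j ∈ Finset.range n, lwPoly a (j + 1)) • m := by
  induction n generalizing m with
  | zero => simp
  | succ n ih =>
    rw [pow_succ, mul_smul, uF_smul_uE_pow hH, ih (uH_smul_aeval hH _), Finset.prod_range_succ,
      map_mul, mul_smul]

theorem uF_smul_uE_pow_of_eq_zero {m : M} {a : K} (hH : uH K p • m = a • m)
    (hE : uE K p • uF K p • uE K p • m = 0) {k : ℕ} (hk : 0 < k) :
    uF K p • uE K p ^ (k + 1) • m = lwCoeff a k • uE K p ^ k • m := by
  obtain ⟨k, rfl⟩ := Nat.exists_eq_succ_of_ne_zero hk.ne'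
  have hX : uE K p ^ (k + 1) • (uF K p * uE K p) • m = 0 := by
    rw [pow_succ, mul_smul, mul_smul, hE, smul_zero]
  rw [Nat.succ_eq_add_one, uF_smul_uE_pow hH, lwPoly, lwCoeff]
  split_ifs
  · rw [map_add, aeval_X, aeval_C, add_smul, algebraMap_smul, smul_add, hX, zero_add, smul_comm]
  · rw [map_sub, aeval_X, aeval_C, sub_smul, algebraMap_smul, smul_sub, hX, sub_zero, smul_comm]

variable [CharP K p]

/-- The case $n=2p-1$ of the preceding identity, whose left side contains $E^{2p}=0$. The vector
$((FE)^{p-1}-1)^2m$ is therefore killed by $EFE$ for any $m$ of weight $l$. -/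
theorem uE_smul_eq_zero {m : M} {l : ℕ} (hH : uH K p • m = (l : K) • m) :
    uE K p • (uF K p * uE K p) • aeval (uF K p * uE K p) ((X ^ (p - 1) - 1) ^ 2 : K[X]) • m = 0 := by
  have h := uF_pow_smul_uE_pow hH (2 * p - 1)
  have hp : 0 < p := (Fact.out : p.Prime).pos
  rw [Nat.sub_add_cancel (by omega), uE_pow, zero_smul, smul_zero, prod_lwPoly (odd_of_fact p),
    map_neg, map_mul, aeval_X, neg_smul, smul_neg, mul_smul] at h
  exact neg_eq_zero.1 h.symm

theorem uE_pow_smul_eq_zero {l : Fin p} {m : M} (hH : uH K p • m = ((l : ℕ) : K) • m)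
    (hE : uE K p • uF K p • uE K p • m = 0) {k : ℕ} (hk : 2 * (Fin.rev l : ℕ) + 1 < k) :
    uE K p ^ k • m = 0 := by
  -- Descending induction from $E^{2p}=0$: if $E^{k+1}m=0$, then $0=FE^{k+1}m$ is a nonzero multiple
  -- of $E^km$.
  have key : ∀ d k : ℕ, 2 * p ≤ k + d → 2 * (Fin.rev l : ℕ) + 1 < k → uE K p ^ k • m = 0 := by
    intro d
    induction d with
    | zero =>
      intro k h _
      obtain ⟨e, rfl⟩ := Nat.exists_eq_add_of_le (add_zero k ▸ h)
      rw [add_comm, pow_add, uE_pow, mul_zero, zero_smul]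
    | succ d ih =>
      intro k h hk
      rcases Nat.lt_or_ge k (2 * p) with h2 | h2
      · have h1 := uF_smul_uE_pow_of_eq_zero hH hE (k := k) (by omega)
        rw [ih (k + 1) (by omega) (by omega), smul_zero] at h1
        exact (smul_eq_zero.1 h1.symm).resolve_left (lwCoeff_ne_zero (by omega) h2 (by omega))
      · exact ih k (by omega) hk
  exact key (2 * p) k (by omega) hk

theorem exists_uF_pow_smul_uE_pow {l : Fin p} {m : M} (hH : uH K p • m = ((l : ℕ) : K) • m)
    (hE : uE K p • uF K p • uE K p • m = 0) {k : ℕ} (hk : k ≤ 2 * (Fin.rev l : ℕ)) :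
    ∃ c : K, c ≠ 0 ∧ uF K p ^ k • uE K p ^ (k + 1) • m = c • uE K p • m := by
  induction k with
  | zero => exact ⟨1, one_ne_zero, by simp⟩
  | succ k ih =>
    obtain ⟨c, hc, h⟩ := ih (by omega)
    have hl := (Fin.rev l).2
    refine ⟨lwCoeff ((l : ℕ) : K) (k + 1) * c,
      mul_ne_zero (lwCoeff_ne_zero (by omega) (by omega) (by omega)) hc, ?_⟩
    rw [pow_succ (uF K p), mul_smul, uF_smul_uE_pow_of_eq_zero hH hE (by omega), smul_comm, h,
      mul_smul]

end EStrings

/-! ### Weight projections -/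

section WeightProjection

open Polynomial

variable {K : Type u} [Field K] {p : ℕ} [Fact p.Prime] [Fact (2 < p)]

theorem aeval_mem_uPart {x : U K p} (hx : parityAut K p x = x) (q : K[X]) :
    aeval x q ∈ uPart K p 0 := by
  rw [mem_uPart, ← Polynomial.aeval_algHom_apply, hx, ZMod.val_zero, pow_zero, one_smul]

theorem parityAut_of_mem_zero {u : U K p} (hu : u ∈ uPart K p 0) : parityAut K p u = u := by
  rw [mem_uPart.1 hu, ZMod.val_zero, pow_zero, one_smul]

theorem parityAut_of_mem_one {u : U K p} (hu : u ∈ uPart K p 1) : parityAut K p u = -u := by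
  rw [mem_uPart.1 hu, ZMod.val_one, pow_one, neg_one_smul]

theorem parityAut_uH : parityAut K p (uH K p) = uH K p :=
  parityAut_of_mem_zero (gen_mem_uPart p (hEl K))

theorem parityAut_uE : parityAut K p (uE K p) = -uE K p :=
  parityAut_of_mem_one (gen_mem_uPart p (oddE K))

theorem parityAut_uF : parityAut K p (uF K p) = -uF K p :=
  parityAut_of_mem_one (gen_mem_uPart p (oddF K))

theorem parityAut_uF_mul_uE : parityAut K p (uF K p * uE K p) = uF K p * uE K p := by
  rw [map_mul, parityAut_uE, parityAut_uF, neg_mul_neg]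

variable (K p) in
/-- The projection to the weight space of weight `l`. -/
def wtProj (l : ℕ) : U K p := aeval (uH K p) (1 - (X - C (l : K)) ^ (p - 1))

theorem wtProj_mem (l : ℕ) : wtProj K p l ∈ uPart K p 0 := aeval_mem_uPart parityAut_uH _

section Module

variable {M : Type*} [AddCommGroup M] [Module K M] [Module (U K p) M] [IsScalarTower K (U K p) M]

theorem aeval_smul_of_smul_eq {x : U K p} {m : M} {a : K} (h : x • m = a • m) (q : K[X]) :
    aeval x q • m = q.eval a • m := by
  induction q using Polynomial.induction_on' with
  | add q r hq hr => rw [map_add, add_smul, hq, hr, eval_add, add_smul]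
  | monomial n c =>
    have hn : x ^ n • m = a ^ n • m := by
      induction n with
      | zero => simp
      | succ n ih => rw [pow_succ, mul_smul, h, smul_comm, ih, smul_smul, pow_succ']
    rw [aeval_monomial, mul_smul, hn, eval_monomial, mul_smul, algebraMap_smul]

theorem wtProj_smul {m : M} {l : ℕ} (h : uH K p • m = (l : K) • m) :
    wtProj K p l • m = m := by
  have : p - 1 ≠ 0 := by
    have : 2 < p := Fact.out
    omega
  rw [wtProj, aeval_smul_of_smul_eq h]
  simp [this]

variable [CharP K p]

theorem wtProj_smul_eq_zero {m : M} {a : K} {l : ℕ} (h : uH K p • m = a • m) (ha : a ^ p = a)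
    (hne : a - l ≠ 0) : wtProj K p l • m = 0 := by
  have hl : (l : K) ^ p = l := map_natCast (frobenius K p) l
  have h1 : (a - l) ^ (p - 1) = 1 := by
    refine mul_right_cancel₀ hne ?_
    rw [← pow_succ, Nat.sub_add_cancel (Fact.out : p.Prime).one_le, sub_pow_char, ha, hl, one_mul]
  rw [wtProj, aeval_smul_of_smul_eq h]
  simp [h1]

/-- $(X-l)(1-(X-l)^{p-1})=X-X^p$ by Frobenius, and $h^p=h$. -/
theorem uH_smul_wtProj (l : ℕ) (m : M) :
    uH K p • wtProj K p l • m = (l : K) • wtProj K p l • m := by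
  have hl : (l : K) ^ p = l := map_natCast (frobenius K p) l
  have h1 : (X - C (l : K)) * (1 - (X - C (l : K)) ^ (p - 1)) = X - X ^ p := by
    rw [mul_sub, mul_one, ← pow_succ', Nat.sub_add_cancel (Fact.out : p.Prime).one_le,
      sub_pow_char, ← C_pow, hl]
    ring
  have h2 := congrArg (fun q => aeval (uH K p) q • m) h1
  simp only [map_mul, map_sub, map_pow, aeval_X, aeval_C, uH_pow, sub_self, zero_smul] at h2
  rw [mul_smul, sub_smul, algebraMap_smul, sub_eq_zero] at h2
  rw [wtProj]
  simpa only [map_sub, map_pow, aeval_X, aeval_C] using h2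

end Module

end WeightProjection

/-! ### Projective covers of the simple modules -/

section Projective

open Polynomial

variable {K : Type u} [Field K] {p : ℕ} [Fact p.Prime] [Fact (2 < p)]

variable (K p) in
/-- The left ideal generated by `h - l` and `E F E`. -/
def projIdeal (l : ℕ) : Submodule (U K p) (U K p) :=
  Submodule.span (U K p)
    {uH K p - algebraMap K (U K p) l, uE K p * (uF K p * uE K p)}

theorem parityAut_mem_projIdeal {l : ℕ} {u : U K p} (hu : u ∈ projIdeal K p l) :
    parityAut K p u ∈ projIdeal K p l := by
  induction hu using Submodule.span_induction with
  | mem u h =>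
    obtain rfl | rfl := h
    · rw [map_sub, parityAut_uH, AlgHom.commutes]
      exact Submodule.subset_span (by simp)
    · rw [map_mul, parityAut_uF_mul_uE, parityAut_uE, neg_mul]
      exact Submodule.neg_mem _ (Submodule.subset_span (by simp))
  | zero => simp
  | add u w _ _ hu hw => rw [map_add]; exact Submodule.add_mem _ hu hw
  | smul a u _ hu => rw [smul_eq_mul, map_mul]; exact Submodule.smul_mem _ _ hu

theorem smul_eq_zero_of_mem_projIdeal {M : Type*} [AddCommGroup M] [Module K M]
    [Module (U K p) M] [IsScalarTower K (U K p) M] {m : M} {l : ℕ}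
    (hH : uH K p • m = (l : K) • m) (hE : uE K p • uF K p • uE K p • m = 0) (u : U K p)
    (hu : u ∈ projIdeal K p l) : u • m = 0 := by
  refine smul_eq_zero_of_mem_span ?_ u hu
  rintro _ (rfl | rfl)
  · rw [sub_smul, algebraMap_smul, hH, sub_self]
  · rw [mul_smul, mul_smul, hE]

variable [CharP K p]

variable (K) in
/-- The module `P(l)`. -/
def projModule (l : Fin p) : SuperModule K p :=
  cyclicModule (projIdeal K p l) fun _ => parityAut_mem_projIdeal

variable (K) in
/-- The generator of `P(l)`. -/
def projGen (l : Fin p) : projModule K l :=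
  cyclicGen (projIdeal K p l) fun _ => parityAut_mem_projIdeal

theorem projGen_mem (l : Fin p) : projGen K l ∈ (projModule K l).part 0 :=
  cyclicGen_mem (hJ := fun _ => parityAut_mem_projIdeal)

theorem exists_smul_projGen {l : Fin p} (m : projModule K l) :
    ∃ u : U K p, u • projGen K l = m :=
  exists_smul_cyclicGen (hJ := fun _ => parityAut_mem_projIdeal) m

theorem projModule_eq_top {l : Fin p} {N : Submodule (U K p) (projModule K l)}
    (h : projGen K l ∈ N) : N = ⊤ := by
  rw [eq_top_iff]
  rintro m -
  obtain ⟨u, rfl⟩ := exists_smul_projGen m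
  exact N.smul_mem u h

theorem uH_smul_projGen (l : Fin p) : uH K p • projGen K l = ((l : ℕ) : K) • projGen K l := by
  have := smul_cyclicGen_eq_zero (hJ := fun _ => parityAut_mem_projIdeal)
    (Submodule.subset_span (by simp) : uH K p - algebraMap K _ ((l : ℕ) : K) ∈ projIdeal K p l)
  rw [sub_smul, algebraMap_smul, sub_eq_zero] at this
  exact this

theorem uE_uF_uE_smul_projGen (l : Fin p) : uE K p • uF K p • uE K p • projGen K l = 0 := by
  have := smul_cyclicGen_eq_zero (hJ := fun _ => parityAut_mem_projIdeal)
    (Submodule.subset_span (by simp) : uE K p * (uF K p * uE K p) ∈ projIdeal K p l)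
  rw [mul_smul, mul_smul] at this
  exact this

/-- The homomorphism from `P(l)` with prescribed image of the generator. -/
def projHom {M : Type*} [AddCommGroup M] [Module K M]
    [Module (U K p) M] [IsScalarTower K (U K p) M] (l : Fin p) (m : M)
    (hH : uH K p • m = ((l : ℕ) : K) • m) (hE : uE K p • uF K p • uE K p • m = 0) :
    projModule K l →ₗ[U K p] M :=
  cyclicHom (hJ := fun _ => parityAut_mem_projIdeal) M m (smul_eq_zero_of_mem_projIdeal hH hE)

theorem projHom_projGen {M : Type*} [AddCommGroup M] [Module K M]
    [Module (U K p) M] [IsScalarTower K (U K p) M] {l : Fin p} {m : M}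
    {hH : uH K p • m = ((l : ℕ) : K) • m} {hE : uE K p • uF K p • uE K p • m = 0} :
    projHom l m hH hE (projGen K l) = m :=
  cyclicHom_gen (hJ := fun _ => parityAut_mem_projIdeal) _

theorem projHom_isHomogeneous {M : SuperModule K p} {l : Fin p} {m : M} {c : ZMod 2}
    (hm : m ∈ M.part c) (hH : uH K p • m = ((l : ℕ) : K) • m)
    (hE : uE K p • uF K p • uE K p • m = 0) : IsHomogeneousMap c (projHom l m hH hE) :=
  cyclicHom_isHomogeneous (hJ := fun _ => parityAut_mem_projIdeal) hm _

theorem projModule_isProjective (l : Fin p) : (projModule K l).IsProjective := by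
  intro M N g f hg hf hs
  obtain ⟨m, hm, hgm⟩ : ∃ m ∈ M.part 0, g m = f (projGen K l) := by
    obtain ⟨m, hm⟩ := hs (f (projGen K l))
    obtain ⟨a, ha, b, hb, rfl⟩ := M.exists_add 0 m
    refine ⟨a, ha, ?_⟩
    have hb' : g b = 0 := by
      refine N.eq_zero_of_mem (i := 0) ?_ ?_
      · rw [map_add] at hm
        rw [← add_sub_cancel_left (g a) (g b), hm]
        have h1 := hf 0 _ (projGen_mem l)
        have h2 := hg 0 a ha
        rw [add_zero] at h1 h2
        exact Submodule.sub_mem _ h1 h2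
      · simpa using hg _ b hb
    rw [← hm, map_add, hb', add_zero]
  have hH : uH K p • f (projGen K l) = ((l : ℕ) : K) • f (projGen K l) := by
    rw [← map_smul, uH_smul_projGen, ← algebraMap_smul (U K p), map_smul, algebraMap_smul]
  have hE : uE K p • uF K p • uE K p • f (projGen K l) = 0 := by
    rw [← map_smul, ← map_smul, ← map_smul, uE_uF_uE_smul_projGen, map_zero]
  -- An arbitrary even preimage $m$ is corrected twice: it is projected to weight $l$, and then
  -- $((FE)^{p-1}-1)^2$ forces the relation $EFE=0$.
  have hH' := uH_smul_aeval (uH_smul_wtProj (K := K) (p := p) (l : ℕ) m)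
    ((X ^ (p - 1) - 1) ^ 2 : K[X])
  have hE' := uE_smul_eq_zero (uH_smul_wtProj (K := K) (p := p) (l : ℕ) m)
  rw [mul_smul] at hE'
  refine ⟨projHom l _ hH' hE', projHom_isHomogeneous ?_ hH' hE', ?_⟩
  · have h1 := uPart_smul_mem (aeval_mem_uPart parityAut_uF_mul_uE
      ((X ^ (p - 1) - 1) ^ 2 : K[X])) (uPart_smul_mem (wtProj_mem (l : ℕ)) hm)
    simpa only [add_zero] using h1
  · refine LinearMap.ext fun x => ?_
    obtain ⟨u, rfl⟩ := exists_smul_projGen x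
    rw [map_smul, map_smul, LinearMap.comp_apply, projHom_projGen, map_smul, map_smul, hgm,
      wtProj_smul hH]
    congr 1
    -- The correction does not change the image: $(X^{p-1}-1)^2\equiv1$ modulo $X^2$ since $p>2$,
    -- and $(FE)^2$ kills $f(g)$ for the generator $g$.
    obtain ⟨r, hr⟩ : ∃ r : K[X], (X ^ (p - 1) - 1) ^ 2 = r * X ^ 2 + 1 := by
      obtain ⟨q, hq⟩ : ∃ q, p - 1 = q + 2 := ⟨p - 3, by have : 2 < p := Fact.out; omega⟩
      exact ⟨X ^ q * (X ^ (q + 2) - 2), by rw [hq]; ring⟩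
    rw [hr, map_add, map_mul, map_pow, aeval_X, map_one, add_smul, one_smul, mul_smul, pow_two,
      mul_smul, mul_smul, mul_smul, hE, smul_zero, smul_zero, zero_add]

end Projective

/-! ### Uniqueness of covers, the filtration of $P(l)$, and its projection to $L(l)$ -/

section Cover

variable {K : Type u} [Field K] {p : ℕ} [Fact p.Prime] [Fact (2 < p)]

/-- Projective covers are unique. -/
theorem IsProjectiveCover.exists_isomorphism {P P' L : SuperModule K p} {π : P →ₗ[U K p] L}
    {π' : P' →ₗ[U K p] L} (h : IsProjectiveCover π) (h' : IsProjectiveCover π') :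
    ∃ (s : P →ₗ[U K p] P') (k : P' →ₗ[U K p] P), IsHomogeneousMap 0 s ∧ IsHomogeneousMap 0 k ∧
      k ∘ₗ s = LinearMap.id ∧ s ∘ₗ k = LinearMap.id := by
  obtain ⟨k, hk, hkπ⟩ := h'.1 P L π π' h.2.1 h'.2.1 h.2.2.1
  have hks : Function.Surjective k := by
    rw [← LinearMap.range_eq_top]
    -- As $\pi k=\pi'$ is onto, the range of $k$ and $\ker\pi$ together fill $P$; superfluity of the
    -- kernel makes $k$ surjective.
    refine h.2.2.2 _ hk.range_isSuperSubmodule (eq_top_iff.2 fun x _ => ?_)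
    obtain ⟨y, hy⟩ := h'.2.2.1 (π x)
    rw [← add_sub_cancel (k y) x]
    refine Submodule.add_mem_sup ⟨y, rfl⟩ ?_
    rw [LinearMap.mem_ker, map_sub, sub_eq_zero, ← hy, ← hkπ]
    rfl
  obtain ⟨s, hs, hid⟩ := h.1 P' P k LinearMap.id hk (fun i m hm => by rwa [add_zero]) hks
  have hss : Function.Surjective s := by
    rw [← LinearMap.range_eq_top]
    -- The same argument applies to the section $s$: since $ks=\mathrm{id}$, the elements $s(k(x))$
    -- and $x$ have the same image under $\pi'=\pi k$.
    refine h'.2.2.2 _ hs.range_isSuperSubmodule (eq_top_iff.2 fun x _ => ?_)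
    rw [← add_sub_cancel (s (k x)) x]
    refine Submodule.add_mem_sup ⟨k x, rfl⟩ ?_
    have h1 : k (s (k x)) = k x := LinearMap.congr_fun hid (k x)
    rw [LinearMap.mem_ker, map_sub, sub_eq_zero, ← hkπ, LinearMap.comp_apply,
      LinearMap.comp_apply, h1]
  refine ⟨s, k, hs, hk, hid, LinearMap.ext fun x => ?_⟩
  obtain ⟨y, rfl⟩ := hss x
  have h1 : k (s y) = y := LinearMap.congr_fun hid y
  rw [LinearMap.comp_apply, h1, LinearMap.id_apply]

variable [CharP K p]

variable (K) in
/-- The vector of highest weight in `P(l)` generating `Z(p - l - 1)`. -/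
def projTop (l : Fin p) : projModule K l := uE K p ^ (2 * (Fin.rev l : ℕ) + 1) • projGen K l

theorem projTop_mem (l : Fin p) : projTop K l ∈ (projModule K l).part 1 := by
  have h := uE_pow_smul_mem (projGen_mem (K := K) l) (2 * (Fin.rev l : ℕ) + 1)
  have e : (0 : ZMod 2) + ((2 * (Fin.rev l : ℕ) + 1 : ℕ) : ZMod 2) = 1 := by
    have : (2 : ZMod 2) = 0 := by decide
    push_cast
    rw [this]
    ring
  rwa [e] at h

theorem uE_smul_projTop (l : Fin p) : uE K p • projTop K l = 0 := by
  rw [projTop, ← mul_smul, ← pow_succ']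
  exact uE_pow_smul_eq_zero (uH_smul_projGen l) (uE_uF_uE_smul_projGen l) (by omega)

theorem uH_smul_projTop (l : Fin p) :
    uH K p • projTop K l = ((Fin.rev l : ℕ) : K) • projTop K l := by
  rw [projTop, uH_smul_uE_pow (uH_smul_projGen l)]
  congr 1
  push_cast
  rw [natCast_rev]
  ring

theorem exists_uF_pow_smul_projTop (l : Fin p) :
    ∃ c : K, c ≠ 0 ∧ uF K p ^ (2 * (Fin.rev l : ℕ)) • projTop K l = c • uE K p • projGen K l :=
  exists_uF_pow_smul_uE_pow (uH_smul_projGen l) (uE_uF_uE_smul_projGen l) le_rfl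

theorem uF_pow_smul_projTop_ne_zero (l : Fin p) : uF K p ^ (2 * p - 1) • projTop K l ≠ 0 := by
  obtain ⟨c, hc, h⟩ := exists_uF_pow_smul_projTop (K := K) l
  have hrev := Fin.val_rev l
  have hl := l.2
  rw [show 2 * p - 1 = 2 * (l : ℕ) + 1 + 2 * (Fin.rev l : ℕ) by omega, pow_add, mul_smul, h,
    smul_comm, smul_ne_zero_iff_right hc, ← mul_smul]
  intro h0
  have h1 : uF K p ^ (2 * (l : ℕ) + 1) * uE K p ∈ projIdeal K p l :=
    (Submodule.Quotient.mk_eq_zero _).1 ((smul_cyclicGen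
      (hJ := fun _ => parityAut_mem_projIdeal) _).symm.trans h0)
  -- Here $x_0$ satisfies the relations of $P(l)$, whereas
  -- $F^{2l+1}Ex_0=F^{2l+1}y_{2(p-l-1)}=y_{2p-1}\neq0$.
  have h2 := bigRep_eq_zero_of_mem_span (l := l) (x := vecX K p 0) (by
    rintro _ (rfl | rfl)
    · rw [map_sub, LinearMap.sub_apply, bigRep_uH, bigH_vecX, AlgHom.commutes, Nat.cast_zero,
        sub_zero, Module.algebraMap_end_apply, sub_self]
    · rw [map_mul, map_mul, bigRep_uE, bigRep_uF, Module.End.mul_apply, Module.End.mul_apply,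
        bigE_vecX_zero, bigF_vecY, bigE_vecY_succ, hwCoeff_even, sub_self, zero_smul]) h1
  rw [map_mul, map_pow, bigRep_uF, bigRep_uE, Module.End.mul_apply, bigE_vecX_zero,
    bigF_pow_vecY] at h2
  exact vecY_ne_zero (by omega) h2

/-- The embedding of `Z(p - l - 1)` into `P(l)`. -/
def projSub (l : Fin p) : babyVerma K p (Fin.rev l) →ₗ[U K p] projModule K l :=
  babyHom (Fin.rev l) (projTop K l) (uE_smul_projTop l) (uH_smul_projTop l)

/-- The projection of `P(l)` to `Z(l)`. -/
def projQuot (l : Fin p) : projModule K l →ₗ[U K p] babyVerma K p l :=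
  projHom l (babyGen K l) (uH_smul_babyGen l) (by rw [uE_smul_babyGen, smul_zero, smul_zero])

theorem projSub_babyGen (l : Fin p) : projSub l (babyGen K (Fin.rev l)) = projTop K l :=
  babyHom_babyGen

theorem projQuot_projGen (l : Fin p) : projQuot l (projGen K l) = babyGen K l :=
  projHom_projGen

theorem projSub_isHomogeneous (l : Fin p) : IsHomogeneousMap 1 (projSub (K := K) l) :=
  babyHom_isHomogeneous (projTop_mem l) _ _

theorem projQuot_isHomogeneous (l : Fin p) : IsHomogeneousMap 0 (projQuot (K := K) l) :=
  projHom_isHomogeneous (babyGen_mem l) _ _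

theorem projSub_injective (l : Fin p) : Function.Injective (projSub (K := K) l) := by
  rw [← LinearMap.ker_eq_bot]
  refine babyVerma_eq_bot_of_not_mem fun h => uF_pow_smul_projTop_ne_zero (K := K) l ?_
  rwa [LinearMap.mem_ker, map_smul, projSub_babyGen] at h

theorem projQuot_surjective (l : Fin p) : Function.Surjective (projQuot (K := K) l) := by
  intro m
  obtain ⟨u, rfl⟩ := exists_smul_cyclicGen (hJ := fun _ => parityAut_mem_borelIdeal) m
  exact ⟨u • projGen K l, by rw [map_smul, projQuot_projGen]; rfl⟩

/-- Descending from the singular vector returns a nonzero multiple of $Eg$. This matters because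
$Eg$ generates the kernel of $P(l)\to Z(l)$. -/
theorem uE_smul_projGen_mem_range (l : Fin p) :
    uE K p • projGen K l ∈ LinearMap.range (projSub (K := K) l) := by
  obtain ⟨c, hc, h⟩ := exists_uF_pow_smul_projTop (K := K) l
  have h1 : c • uE K p • projGen K l ∈ (LinearMap.range (projSub (K := K) l)).restrictScalars K :=
    ⟨uF K p ^ (2 * (Fin.rev l : ℕ)) • babyGen K (Fin.rev l), by
      rw [← h, map_smul, projSub_babyGen]⟩
  exact (Submodule.smul_mem_iff _ hc).1 h1

theorem range_projSub (l : Fin p) :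
    LinearMap.range (projSub (K := K) l) = LinearMap.ker (projQuot l) := by
  refine le_antisymm ?_ ?_
  · rintro _ ⟨x, rfl⟩
    obtain ⟨u, rfl⟩ := exists_smul_cyclicGen (hJ := fun _ => parityAut_mem_borelIdeal) x
    change projQuot l (projSub l (u • babyGen K (Fin.rev l))) = 0
    rw [map_smul, projSub_babyGen, projTop, map_smul, map_smul, projQuot_projGen, pow_succ,
      mul_smul, uE_smul_babyGen, smul_zero, smul_zero]
  · intro m hm
    obtain ⟨u, rfl⟩ := exists_smul_projGen m
    rw [LinearMap.mem_ker, map_smul, projQuot_projGen] at hm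
    have hu : u ∈ borelIdeal p ((l : ℕ) : K) :=
      (Submodule.Quotient.mk_eq_zero _).1 ((smul_cyclicGen
        (hJ := fun _ => parityAut_mem_borelIdeal) _).symm.trans hm)
    rw [borelIdeal_eq_span] at hu
    refine (Submodule.span_le (p := (LinearMap.range (projSub (K := K) l)).comap
      (LinearMap.toSpanSingleton (U K p) _ (projGen K l)))).2 ?_ hu
    rintro _ (rfl | rfl)
    · exact uE_smul_projGen_mem_range l
    · change (uH K p - algebraMap K _ _) • projGen K l ∈ LinearMap.range (projSub l)
      rw [sub_smul, algebraMap_smul, uH_smul_projGen, sub_self]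
      exact Submodule.zero_mem _

/-- The exact sequence $Z(p-l-1)\to P(l)\to Z(l)$ expresses $P(l)$ through the $F$-strings that span
its two ends. -/
theorem fString_sup_fString (l : Fin p) :
    fString (K := K) (p := p) (projGen K l) ⊔ fString (K := K) (p := p) (projTop K l) = ⊤ := by
  rw [eq_top_iff]
  rintro m -
  have hle : fString (K := K) (p := p) (babyGen K l) ≤
      (fString (K := K) (p := p) (projGen K l)).map ((projQuot l).restrictScalars K) :=
    fString_le fun i => ⟨uF K p ^ i • projGen K l, uF_pow_smul_mem_fString _ i, by
      change projQuot l _ = _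
      rw [map_smul, projQuot_projGen]⟩
  rw [fString_babyGen] at hle
  obtain ⟨y, hy, hym⟩ := hle (Submodule.mem_top : projQuot l m ∈ _)
  have hker : m - y ∈ LinearMap.ker (projQuot l) := by
    rw [LinearMap.mem_ker, map_sub, sub_eq_zero]
    exact hym.symm
  rw [← range_projSub] at hker
  obtain ⟨x, hx⟩ := hker
  have hle2 : fString (K := K) (p := p) (babyGen K (Fin.rev l)) ≤
      (fString (K := K) (p := p) (projTop K l)).comap ((projSub l).restrictScalars K) :=
    fString_le fun i => by
      change projSub l (uF K p ^ i • babyGen K (Fin.rev l)) ∈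
        fString (K := K) (p := p) (projTop K l)
      rw [map_smul, projSub_babyGen]
      exact uF_pow_smul_mem_fString _ i
  rw [fString_babyGen] at hle2
  have h3 : projSub l x ∈ fString (K := K) (p := p) (projTop K l) :=
    hle2 (Submodule.mem_top : x ∈ _)
  rw [hx] at h3
  rw [← add_sub_cancel y m]
  exact Submodule.add_mem_sup hy h3

theorem natCast_zmod_two_of_even {i : ℕ} (h : Even i) : (i : ZMod 2) = 0 :=
  (ZMod.natCast_eq_zero_iff_even).2 h

/-- Among the vectors of the two spanning strings, all but $g$ and a multiple of $FEg$ are odd or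
killed by the projection to weight $l$. -/
theorem exists_eq_of_weight (l : Fin p) {m : projModule K l} (hm : m ∈ (projModule K l).part 0)
    (hH : uH K p • m = ((l : ℕ) : K) • m) :
    ∃ a b : K, m = a • projGen K l + b • uF K p • uE K p • projGen K l := by
  have h2 := two_ne_zero_of_fact K p
  have hp : 0 < p := (Fact.out : p.Prime).pos
  have hrev := Fin.val_rev l
  have hl := l.2
  have hcast : ∀ i : ℕ, (i : K) ^ p = i := fun i => map_natCast (frobenius K p) i
  let x : projModule K l := uF K p • uE K p • projGen K l
  let R : Submodule K (projModule K l) :=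
    LinearMap.ker (Algebra.lsmul K K (projModule K l) (wtProj K p (l : ℕ))) ⊓
      (projModule K l).part 0
  have hgen : ∀ i : ℕ, uF K p ^ i • projGen K l ∈
      (Submodule.span K {projGen K l, x} ⊔ (projModule K l).part 1) ⊔ R := by
    intro i
    have hpart := uF_pow_smul_mem (projGen_mem (K := K) l) i
    rw [zero_add] at hpart
    rcases Nat.even_or_odd i with hi | hi
    · rcases Nat.eq_zero_or_pos i with rfl | hi0
      · rw [pow_zero, one_smul]
        exact Submodule.mem_sup_left (Submodule.mem_sup_left (Submodule.subset_span (by simp)))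
      rcases Nat.lt_or_ge i (2 * p) with h | h
      · refine Submodule.mem_sup_right ⟨?_, by rwa [natCast_zmod_two_of_even hi] at hpart⟩
        refine wtProj_smul_eq_zero (uH_smul_uF_pow (uH_smul_projGen l) i) ?_ ?_
        · rw [sub_pow_char, hcast, hcast]
        · rw [sub_sub_cancel_left, neg_ne_zero]
          have := natCast_sub_ne_zero_of_even (K := K) h2 h (j := 0) (by omega) (by omega)
            (by simpa using hi)
          simpa using this
      · obtain ⟨k, rfl⟩ := Nat.exists_eq_add_of_le h
        rw [pow_add, uF_pow, zero_mul, zero_smul]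
        exact Submodule.zero_mem _
    · rw [ZMod.natCast_eq_one_iff_odd.2 hi] at hpart
      exact Submodule.mem_sup_left (Submodule.mem_sup_right hpart)
  have htop : ∀ i : ℕ, uF K p ^ i • projTop K l ∈
      (Submodule.span K {projGen K l, x} ⊔ (projModule K l).part 1) ⊔ R := by
    intro i
    have hpart := uF_pow_smul_mem (projTop_mem (K := K) l) i
    rcases Nat.even_or_odd i with hi | hi
    · rw [natCast_zmod_two_of_even hi, add_zero] at hpart
      exact Submodule.mem_sup_left (Submodule.mem_sup_right hpart)
    · rw [ZMod.natCast_eq_one_iff_odd.2 hi, show (1 : ZMod 2) + 1 = 0 by decide] at hpart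
      rcases Nat.lt_or_ge i (2 * p) with h | h
      -- The top vector is odd, so its even descendants have odd $i$; their weight $p-l-1-i$ equals
      -- $l$ only at this index, where the vector is a multiple of $FEg$.
      · rcases eq_or_ne i (2 * (Fin.rev l : ℕ) + 1) with rfl | hne
        · obtain ⟨c, -, hc⟩ := exists_uF_pow_smul_projTop (K := K) l
          rw [pow_succ', mul_smul, hc, smul_comm]
          exact Submodule.mem_sup_left (Submodule.mem_sup_left (Submodule.smul_mem _ _
            (Submodule.subset_span (by simp [x]))))
        · refine Submodule.mem_sup_right ⟨?_, hpart⟩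
          refine wtProj_smul_eq_zero (uH_smul_uF_pow (uH_smul_projTop l) i) ?_ ?_
          · rw [sub_pow_char, hcast, hcast]
          · have h3 := natCast_sub_ne_zero_of_even (K := K) h2 (i := 2 * (Fin.rev l : ℕ) + 1)
              (by omega) h hne.symm (by
                obtain ⟨d, rfl⟩ := hi
                exact ⟨(Fin.rev l : ℕ) + d + 1, by ring⟩)
            have e : ((Fin.rev l : ℕ) : K) - i - (l : ℕ) =
                ((2 * (Fin.rev l : ℕ) + 1 : ℕ) : K) - i := by
              push_cast
              rw [natCast_rev]
              ring
            rwa [e]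
      · obtain ⟨k, rfl⟩ := Nat.exists_eq_add_of_le h
        rw [pow_add, uF_pow, zero_mul, zero_smul]
        exact Submodule.zero_mem _
  have hmem := (sup_le (fString_le hgen) (fString_le htop)) (by
    rw [fString_sup_fString]; exact Submodule.mem_top : m ∈ _)
  obtain ⟨y, hy, r, ⟨hr, hr0⟩, rfl⟩ := Submodule.mem_sup.1 hmem
  obtain ⟨s, hs, o, ho, rfl⟩ := Submodule.mem_sup.1 hy
  have hx0 : x ∈ (projModule K l).part 0 := by
    have := uF_smul_mem (uE_smul_mem (projGen_mem (K := K) l))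
    rwa [zmod_two_add_add] at this
  have hs0 : s ∈ (projModule K l).part 0 := by
    refine Submodule.span_le.2 ?_ hs
    rintro _ (rfl | rfl)
    · exact projGen_mem l
    · exact hx0
  have ho0 : o = 0 := by
    refine (projModule K l).eq_zero_of_mem (i := 0) ?_ (by rwa [zero_add])
    rw [add_right_comm] at hm
    exact (Submodule.add_mem_iff_right _ (Submodule.add_mem _ hs0 hr0)).1 hm
  obtain ⟨a, b, rfl⟩ := Submodule.mem_span_pair.1 hs
  have hxH : uH K p • x = ((l : ℕ) : K) • x := by
    have h1 := uH_smul_aeval (uH_smul_projGen (K := K) l) Polynomial.X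
    rw [Polynomial.aeval_X, mul_smul] at h1
    exact h1
  have hsH : wtProj K p (l : ℕ) • (a • projGen K l + b • x) = a • projGen K l + b • x := by
    rw [smul_add, smul_comm, smul_comm _ b, wtProj_smul (uH_smul_projGen l), wtProj_smul hxH]
  have hr' : wtProj K p (l : ℕ) • r = 0 := hr
  refine ⟨a, b, ?_⟩
  rw [← wtProj_smul hH, ho0, add_zero, smul_add, hsH, hr', add_zero]

variable (K) in
/-- The projection of `P(l)` to `L(l)`. -/
def projCover (l : Fin p) : projModule K l →ₗ[U K p] simpleModule K p l :=
  projHom l (simpleVec K l 0) (uH_smul_simpleVec_zero l)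
    (by rw [uE_smul_simpleVec_zero, smul_zero, smul_zero])

theorem projCover_projGen (l : Fin p) : projCover K l (projGen K l) = simpleVec K l 0 :=
  projHom_projGen

theorem projCover_isHomogeneous (l : Fin p) : IsHomogeneousMap 0 (projCover K l) :=
  projHom_isHomogeneous (simpleVec_mem l 0) _ _

theorem projCover_isProjectiveCover (l : Fin p) : IsProjectiveCover (projCover K l) := by
  refine ⟨projModule_isProjective l, projCover_isHomogeneous l, ?_, fun N hN hsup => ?_⟩
  · rw [← LinearMap.range_eq_top]
    exact simpleModule_eq_top ⟨projGen K l, projCover_projGen l⟩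
  obtain ⟨n, hn, k, hk, hnk⟩ := Submodule.mem_sup.1
    (by rw [hsup]; exact Submodule.mem_top : projGen K l ∈ N ⊔ LinearMap.ker (projCover K l))
  obtain ⟨n₀, hn₀, n₁, hn₁, hn₀N, -, rfl⟩ := hN n hn
  obtain ⟨k₀, hk₀, k₁, hk₁, hk₀N, -, rfl⟩ :=
    (projCover_isHomogeneous (K := K) l).ker_isSuperSubmodule k hk
  -- The generator is even, so the odd components cancel; after projection to weight $l$ the
  -- component in $N$ has the form $ag+bFEg$.
  have heven : n₀ + k₀ = projGen K l := by
    have h1 : n₁ + k₁ = 0 := by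
      refine (projModule K l).eq_zero_of_mem (i := 0) ?_
        (by rw [zero_add]; exact Submodule.add_mem _ hn₁ hk₁)
      rw [add_add_add_comm] at hnk
      have h2 : n₀ + k₀ + (n₁ + k₁) ∈ (projModule K l).part 0 := by
        rw [hnk]; exact projGen_mem l
      exact (Submodule.add_mem_iff_right _ (Submodule.add_mem _ hn₀ hk₀)).1 h2
    rw [add_add_add_comm, h1, add_zero] at hnk
    exact hnk
  have hw : wtProj K p (l : ℕ) • n₀ + wtProj K p (l : ℕ) • k₀ = projGen K l := by
    rw [← smul_add, heven, wtProj_smul (uH_smul_projGen l)]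
  obtain ⟨a, b, hab⟩ := exists_eq_of_weight l (m := wtProj K p (l : ℕ) • n₀)
    (by simpa using uPart_smul_mem (wtProj_mem (l : ℕ)) hn₀) (uH_smul_wtProj _ _)
  have hk' : projCover K l (wtProj K p (l : ℕ) • k₀) = 0 := by
    rw [map_smul, LinearMap.mem_ker.1 hk₀N, smul_zero]
  -- In $L(l)$ the term $FEg$ maps to zero, so comparing images gives $a=1$.
  have ha : a = 1 := by
    have h1 := congrArg (projCover K l) hw
    rw [map_add, hk', add_zero, hab, map_add, ← algebraMap_smul (U K p) a,
      ← algebraMap_smul (U K p) b, map_smul, map_smul, map_smul, map_smul, projCover_projGen,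
      uE_smul_simpleVec_zero, smul_zero, smul_zero, add_zero, algebraMap_smul] at h1
    have h2 : (a - 1) • simpleVec K l 0 = 0 := by rw [sub_smul, h1, one_smul, sub_self]
    exact sub_eq_zero.1 ((smul_eq_zero.1 h2).resolve_right (simpleVec_ne_zero (Nat.succ_pos _)))
  refine projModule_eq_top ?_
  have h3 : wtProj K p (l : ℕ) • n₀ ∈ N.restrictScalars K := N.smul_mem _ hn₀N
  have h4 : uF K p • uE K p • wtProj K p (l : ℕ) • n₀ ∈ N.restrictScalars K :=
    N.smul_mem _ (N.smul_mem _ h3)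
  -- For $n=g+bFEg$, the element $n-bFEn$ equals $g$ because $(FE)^2g=0$. Hence $g\in N$.
  have h5 := Submodule.sub_mem _ h3 (Submodule.smul_mem _ b h4)
  rw [hab, ha, one_smul, smul_add, smul_add, smul_comm _ b, uE_uF_uE_smul_projGen, smul_zero,
    smul_zero, add_zero, add_sub_cancel_right] at h5
  exact h5

theorem IsProjectiveCover.hasFiltration {l : Fin p} {P : SuperModule K p}
    {π : P →ₗ[U K p] simpleModule K p l} (h : IsProjectiveCover π) :
    HasFiltration P ![babyVerma K p (Fin.rev l), babyVerma K p l] := by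
  obtain ⟨s, k, hs, hk, hid, hid'⟩ := (projCover_isProjectiveCover l).exists_isomorphism h
  have hks : ∀ x, k (s x) = x := fun x => LinearMap.congr_fun hid x
  have hsk : ∀ x, s (k x) = x := fun x => LinearMap.congr_fun hid' x
  refine hasFiltration_of_exact (ψ := s ∘ₗ projSub l) (φ := projQuot l ∘ₗ k)
    (hs.comp (projSub_isHomogeneous l)) ((projQuot_isHomogeneous l).comp hk) ?_ ?_ ?_
  · exact (Function.LeftInverse.injective hks).comp (projSub_injective l)
  · exact (projQuot_surjective l).comp (Function.RightInverse.surjective hks)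
  · ext x
    rw [LinearMap.mem_ker, LinearMap.comp_apply, ← LinearMap.mem_ker, ← range_projSub]
    constructor
    · rintro ⟨y, rfl⟩
      exact ⟨y, (hks _).symm⟩
    · rintro ⟨y, hy⟩
      exact ⟨y, by rw [LinearMap.comp_apply, hy, hsk]⟩

end Cover

end OspSuper

end

/-- The restricted representations (`χ = 0`) of `osp(1|2)` over an algebraically closed field of
characteristic `p > 2`. Here `Fin.rev l` is `p - l - 1`. -/
theorem mainTheorem12 (K : Type u) [Field K] [IsAlgClosed K] (p : ℕ) [Fact p.Prime]
    [Fact (2 < p)] [CharP K p] :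
    -- (i) the `L(l)`, of dimension `2 l + 1`, represent the `p` isomorphism classes of
    -- irreducible modules
    ((∀ l : Fin p, (OspSuper.simpleModule K p l).IsSimple ∧
        Module.finrank K (OspSuper.simpleModule K p l) = 2 * (l : ℕ) + 1) ∧
      (∀ l m : Fin p,
        OspSuper.SuperIso (OspSuper.simpleModule K p l) (OspSuper.simpleModule K p m) → l = m) ∧
      (∀ M : OspSuper.SuperModule K p, M.IsSimple →
        ∃ l : Fin p, OspSuper.SuperIso M (OspSuper.simpleModule K p l))) ∧
    -- (ii) the composition factors of `Z(l)` are `L(p - l - 1)` and `L(l)`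
    (∀ l : Fin p, OspSuper.HasCompositionFactors (OspSuper.babyVerma K p l)
      ![OspSuper.simpleModule K p (Fin.rev l), OspSuper.simpleModule K p l]) ∧
    -- (iii) the projective cover of `L(l)` (which exists) is filtered by `Z(p - l - 1)`, `Z(l)`
    (∀ l : Fin p,
      (∃ (P : OspSuper.SuperModule K p)
        (π : P →ₗ[OspSuper.U K p] OspSuper.simpleModule K p l), OspSuper.IsProjectiveCover π) ∧
      ∀ (P : OspSuper.SuperModule K p)
        (π : P →ₗ[OspSuper.U K p] OspSuper.simpleModule K p l), OspSuper.IsProjectiveCover π →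
        OspSuper.HasFiltration P
          ![OspSuper.babyVerma K p (Fin.rev l), OspSuper.babyVerma K p l]) := by
  exact ⟨⟨fun l => ⟨OspSuper.simpleModule_isSimple l, OspSuper.finrank_simpleModule l⟩,
      fun _ _ => OspSuper.eq_of_superIso, fun _ => OspSuper.exists_superIso_simpleModule⟩,
    OspSuper.babyVerma_hasCompositionFactors,
    fun l => ⟨⟨_, _, OspSuper.projCover_isProjectiveCover l⟩, fun _ _ h => h.hasFiltration⟩⟩
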